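/- Work in ZFC, with $V=\bigcup_\alpha V_\alpha$ the universe of sets. A $\Sigma_0$ formula is a formula of the language $\{\in\}$ all of whose quantifiers are bounded ($\forall x\in y$, $\exists x\in y$); a $\Sigma_1$ formula is a block of existential quantifiers followed by a $\Sigma_0$ formula. A relational structure of type $\tau:I\to\omega$ ($I$ a set) is a pair $\langle A,\langle R_i\rangle_{i\in I}\rangle$ with $A$ a nonempty set and $R_i\subseteq A^{\tau(i)}$ for all $i\in I$. An ordinal $\alpha$ *reflects* a class $\mathcal C$ of relational structures of the same type if for every $A\in\mathcal C$ there are $B\in\mathcal C\cap V_\alpha$ and an elementary embedding of $B$ into $A$. For $n\in\{0,1\}$, $\alpha$ *witnesses* $\mathbf\Sigma_n$-SR if $\alpha$ reflects every class of relational structures of the same type that is definable by a $\Sigma_n$ formula with parameters in $V_\alpha$. $\mathbf\Sigma_1$-SR is the schema asserting, for each $\Sigma_1$ formula $\varphi(x,\bar y)$ and all parameters $\bar p$ in $V$, that if $\{x:\varphi(x,\bar p)\}$ is a class of relational structures of the same type, then some ordinal reflects it. Finally, $C^{(1)}$ is the class of all cardinals $\kappa$ such that $V_\kappa\preceq_{\Sigma_1}V$,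 i.e. for every $\Sigma_1$ formula $\varphi(\bar x)$ and every $\bar a$ in $V_\kappa$, $V_\kappa\models\varphi(\bar a)$ if and only if $\varphi(\bar a)$ holds in $V$. **Proposition.** For every ordinal $\alpha$ the following are equivalent: 1. $\alpha$ witnesses $\mathbf\Sigma_0$-SR; 2. $\alpha$ witnesses $\mathbf\Sigma_1$-SR; 3. $\alpha\in C^{(1)}$. Moreover $\mathbf\Sigma_1$-SR is provable in ZFC; that is, every instance of the schema holds in every model of ZFC. -/

import Mathlib

universe u v

open scoped FirstOrder ZFSet
open ZFSet (pair omega IsFunc)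

/-! ### The language of set theory and the first levels of the Lévy hierarchy -/

/-- The only non-logical symbol of the language of set theory: binary membership. -/
inductive MemSymbol : ℕ → Type
  | mem : MemSymbol 2

/-- The first-order language `{∈}` of set theory. -/
def setLang : FirstOrder.Language := ⟨fun _ => Empty, MemSymbol⟩

/-- The atomic formula `x ∈ y`. -/
def memFormula {β : Type} {n : ℕ} (x y : β ⊕ Fin n) : setLang.BoundedFormula β n :=
  FirstOrder.Language.Relations.boundedFormula₂ (L := setLang) MemSymbol.mem
    (FirstOrder.Language.Term.var x) (FirstOrder.Language.Term.var y)

/-- `Σ₀` formulas: built from atomic formulas by connectives (`⊥` and `→` are the primitive ones)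
and bounded quantifiers `∀ x ∈ y`; the quantifier `∃ x ∈ y` is `¬ ∀ x ∈ y, ¬`. -/
inductive IsSigmaZero {β : Type} : ∀ {n : ℕ}, setLang.BoundedFormula β n → Prop
  | falsum {n : ℕ} : IsSigmaZero (⊥ : setLang.BoundedFormula β n)
  | eq {n : ℕ} (x y : β ⊕ Fin n) :
      IsSigmaZero (FirstOrder.Language.Term.bdEqual (L := setLang)
        (FirstOrder.Language.Term.var x) (FirstOrder.Language.Term.var y))
  | mem {n : ℕ} (x y : β ⊕ Fin n) : IsSigmaZero (memFormula x y)
  | imp {n : ℕ} {φ ψ : setLang.BoundedFormula β n} :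
      IsSigmaZero φ → IsSigmaZero ψ → IsSigmaZero (φ.imp ψ)
  | ball {n : ℕ} (y : β ⊕ Fin n) {φ : setLang.BoundedFormula β (n + 1)} :
      IsSigmaZero φ →
      IsSigmaZero
        ((memFormula (Sum.inr (Fin.last n)) (Sum.map id Fin.castSucc y)).imp φ).all

/-- `Σ₁` formulas: a block of existential quantifiers followed by a `Σ₀` formula. -/
inductive IsSigmaOne {β : Type} : ∀ {n : ℕ}, setLang.BoundedFormula β n → Prop
  | of_sigmaZero {n : ℕ} {φ : setLang.BoundedFormula β n} : IsSigmaZero φ → IsSigmaOne φ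
  | ex {n : ℕ} {φ : setLang.BoundedFormula β (n + 1)} : IsSigmaOne φ → IsSigmaOne φ.ex

/-- The universe `V` as a structure `(V, ∈)`. -/
instance instStructureV : setLang.Structure ZFSet.{u} where
  funMap := fun f => f.elim
  RelMap := fun r => match r with
    | MemSymbol.mem => fun x => x 0 ∈ x 1

/-- Every set `a` as a structure `(a, ∈)`. -/
instance instStructureSet (a : ZFSet.{u}) : setLang.Structure {x : ZFSet.{u} // x ∈ a} where
  funMap := fun f => f.elim
  RelMap := fun r => match r with
    | MemSymbol.mem => fun x => (x 0 : ZFSet.{u}) ∈ (x 1 : ZFSet.{u})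

/-- `C^(1)`: the class of cardinals `κ` such that `V_κ` is a `Σ₁`-elementary substructure of `V`. -/
def classCOne : Set Ordinal.{u} :=
  {κ | (∃ c : Cardinal.{u}, κ = c.ord) ∧
    ∀ (k : ℕ) (φ : setLang.Formula (Fin k)), IsSigmaOne φ →
      ∀ a : Fin k → {x : ZFSet.{u} // x ∈ V_ κ},
        φ.Realize a ↔ φ.Realize (fun i => (a i : ZFSet.{u}))}

/-! ### Relational structures as sets -/

/-- The von Neumann numeral `n`. -/
def numeral : ℕ → ZFSet.{u}
  | 0 => ∅
  | n + 1 => insert (numeral n) (numeral n)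

/-- An `n`-tuple as a set: the function `i ↦ x i` with domain `n`. -/
noncomputable def tuple {n : ℕ} (x : Fin n → ZFSet.{u}) : ZFSet.{u} :=
  ZFSet.range fun i : Fin n => pair (numeral i) (x i)

/-- A type of relational structures: a function that assigns to each element of some index set `I`
a natural number, its arity. -/
def IsRelType (τ : ZFSet.{u}) : Prop :=
  ∃ I : ZFSet.{u}, IsFunc I omega τ

/-- A relational structure `⟨A, ⟨R_i⟩_{i ∈ I}⟩` of type `τ : I → ω`, with `A` a nonempty set and
`R_i ⊆ A ^ τ(i)`. The field `rel` is the function `i ↦ R_i`. -/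
structure RelStr (τ : ZFSet.{u}) where
  carrier : ZFSet.{u}
  rel : ZFSet.{u}
  carrier_nonempty : ∃ x, x ∈ carrier
  rel_dom : ∀ z ∈ rel, ∃ i n X, pair i n ∈ τ ∧ z = pair i X
  rel_fun : ∀ i n, pair i n ∈ τ → ∃! X, pair i X ∈ rel
  rel_sub : ∀ (i X : ZFSet.{u}) (n : ℕ), pair i (numeral n) ∈ τ → pair i X ∈ rel →
    ∀ t ∈ X, ∃ x : Fin n → ZFSet.{u}, (∀ k, x k ∈ carrier) ∧ t = tuple x

namespace RelStr

variable {τ : ZFSet.{u}}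

/-- The structure as a set: the ordered pair `⟨A, ⟨R_i⟩_{i ∈ I}⟩`. -/
def code (S : RelStr τ) : ZFSet.{u} := pair S.carrier S.rel

/-- The universe of the structure as a type. -/
def Carrier (S : RelStr τ) : Type (u + 1) := {x : ZFSet.{u} // x ∈ S.carrier}

end RelStr

/-- The first-order language of type `τ`: an `n`-ary relation symbol for every `i` of arity `n`. -/
def relLang (τ : ZFSet.{u}) : FirstOrder.Language.{0, u + 1} :=
  ⟨fun _ => Empty, fun n => {i : ZFSet.{u} // pair i (numeral n) ∈ τ}⟩

instance instStructureRelStr {τ : ZFSet.{u}} (S : RelStr τ) :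
    (relLang τ).Structure S.Carrier where
  funMap := fun f => f.elim
  RelMap := fun i x => ∃ X, pair i.1 X ∈ S.rel ∧ tuple (fun k => (x k).1) ∈ X

/-! ### Structural reflection in `V` -/

/-- `α` reflects the class `C` of structures of type `τ`: for every `A` in `C` there are `B` in
`C ∩ V_α` and an elementary embedding of `B` into `A`. -/
def Reflects (α : Ordinal.{u}) (τ : ZFSet.{u}) (C : Set ZFSet.{u}) : Prop :=
  ∀ A : RelStr τ, A.code ∈ C →
    ∃ B : RelStr τ, B.code ∈ C ∧ B.code ∈ V_ α ∧ Nonempty (B.Carrier ↪ₑ[relLang τ] A.Carrier)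

/-- `α` witnesses `Γ`-SR (boldface): it reflects every class of relational structures of the same
type that is definable by a `Γ` formula with parameters in `V_α`. Variable `0` of the formula is
the one that ranges over the class. -/
def WitnessesSR (Γ : ∀ k : ℕ, setLang.Formula (Fin k) → Prop) (α : Ordinal.{u}) : Prop :=
  ∀ (k : ℕ) (φ : setLang.Formula (Fin (k + 1))), Γ (k + 1) φ →
  ∀ p : Fin k → ZFSet.{u}, (∀ i, p i ∈ V_ α) →
  ∀ τ : ZFSet.{u}, IsRelType τ →
    (∀ x : ZFSet.{u}, φ.Realize (Fin.cons x p : Fin (k + 1) → ZFSet.{u}) →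
      ∃ S : RelStr τ, S.code = x) →
    Reflects α τ {x | φ.Realize (Fin.cons x p : Fin (k + 1) → ZFSet.{u})}

/-! ### Set theory inside an arbitrary `{∈}`-structure

The predicates of this section are the usual formulas of set theory, read in an arbitrary
`{∈}`-structure `M`: all their quantifiers range over the elements of `M`. -/

namespace Internal

variable {M : Type v} [setLang.Structure M]

/-- The membership relation of `M`. -/
def Mem (x y : M) : Prop :=
  FirstOrder.Language.Structure.RelMap (L := setLang) MemSymbol.mem ![x, y]

local infix:50 " ε " => Mem

/-- `x ⊆ y` -/
def Sub (x y : M) : Prop := ∀ z, z ε x → z ε y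

/-- `x = ∅` -/
def IsEmptySet (x : M) : Prop := ∀ z, ¬ z ε x

/-- `s = x ∪ {x}` -/
def IsSucc (s x : M) : Prop := ∀ z, z ε s ↔ z ε x ∨ z = x

/-- `z = {x, y}` -/
def IsUPair (z x y : M) : Prop := ∀ w, w ε z ↔ w = x ∨ w = y

/-- `z = ⟨x, y⟩ = {{x}, {x, y}}` -/
def IsOPair (z x y : M) : Prop := ∃ a b, IsUPair a x x ∧ IsUPair b x y ∧ IsUPair z a b

variable (M) in
/-- `M` is a model of `ZFC`. The two schemata range over the subsets of `M` and of `M × M` that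
are defined in `M` by a formula with parameters. -/
structure IsModelZFC : Prop where
  extensionality : ∀ x y : M, (∀ z, z ε x ↔ z ε y) → x = y
  foundation : ∀ x : M, (∃ y, y ε x) → ∃ y, y ε x ∧ ∀ z, z ε y → ¬ z ε x
  pairing : ∀ x y : M, ∃ z, IsUPair z x y
  union : ∀ x : M, ∃ u, ∀ z, z ε u ↔ ∃ y, y ε x ∧ z ε y
  powerset : ∀ x : M, ∃ p, ∀ z, z ε p ↔ Sub z x
  infinity : ∃ w : M, (∃ e, IsEmptySet e ∧ e ε w) ∧
    ∀ x, x ε w → ∃ s, IsSucc s x ∧ s ε w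
  separation : ∀ D : Set M, (Set.univ : Set M).Definable₁ setLang D →
    ∀ x : M, ∃ y, ∀ z, z ε y ↔ z ε x ∧ z ∈ D
  replacement : ∀ G : Set (M × M), (Set.univ : Set M).Definable₂ setLang G →
    ∀ x : M, (∀ a, a ε x → ∃! b, (a, b) ∈ G) →
      ∃ y, ∀ b, b ε y ↔ ∃ a, a ε x ∧ (a, b) ∈ G
  choice : ∀ x : M, (∀ y, y ε x → ∃ z, z ε y) →
    (∀ y y' z, y ε x → y' ε x → z ε y → z ε y' → y = y') →
    ∃ c, ∀ y, y ε x → ∃! z, z ε y ∧ z ε c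

/-- `x` is a transitive set. -/
def IsTrans (x : M) : Prop := ∀ y, y ε x → Sub y x

/-- `x` is an ordinal: a transitive set of transitive sets. -/
def IsOrd (x : M) : Prop := IsTrans x ∧ ∀ y, y ε x → IsTrans y

/-- `x` is `0` or a successor. -/
def IsZeroOrSucc (x : M) : Prop := IsEmptySet x ∨ ∃ y, IsSucc x y

/-- `x` is a natural number: an ordinal such that no `y ≤ x` is a limit ordinal. -/
def IsNat (x : M) : Prop := IsOrd x ∧ IsZeroOrSucc x ∧ ∀ y, y ε x → IsZeroOrSucc y

/-- `⟨x, y⟩ ∈ f`; for a function `f` this says `f(x) = y`. -/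
def App (f x y : M) : Prop := ∃ z, z ε f ∧ IsOPair z x y

/-- `f` is a function with domain `d`. -/
def IsFunOn (f d : M) : Prop :=
  (∀ z, z ε f → ∃ x y, x ε d ∧ IsOPair z x y) ∧ ∀ x, x ε d → ∃! y, App f x y

/-- `h = f ∘ g` -/
def IsComp (h f g : M) : Prop :=
  ∀ z, z ε h ↔ ∃ k y x, App g k y ∧ App f y x ∧ IsOPair z k x

/-- `w = V_α`: there is a function `f` on `α + 1` with `f(β) = ⋃ {P(f(γ)) : γ < β}` for all
`β ≤ α`, and `w = f(α)`. -/
def IsV (w α : M) : Prop :=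
  ∃ d f, IsSucc d α ∧ IsFunOn f d ∧ App f α w ∧
    ∀ b y, App f b y → ∀ z, z ε y ↔ ∃ c y', c ε b ∧ App f c y' ∧ Sub z y'

/-- `τ` is a type of relational structures: a function from a set to the natural numbers. -/
def IsType (τ : M) : Prop := (∃ d, IsFunOn τ d) ∧ ∀ i n, App τ i n → IsNat n

/-- `⟨a, r⟩` is a relational structure of type `τ`: `a` is a nonempty set, and `r` is a function
with the same domain as `τ` such that `r(i)` is a set of functions from `τ(i)` to `a`. -/
def IsStructureOn (τ a r : M) : Prop :=
  (∃ x, x ε a) ∧ (∃ d, IsFunOn τ d ∧ IsFunOn r d) ∧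
  ∀ i n X t, App τ i n → App r i X → t ε X → IsFunOn t n ∧ ∀ k x, App t k x → x ε a

/-- `s` is a relational structure of type `τ`. -/
def IsStructure (τ s : M) : Prop := ∃ a r, IsOPair s a r ∧ IsStructureOn τ a r

/-- `z` is the von Neumann numeral `k`. -/
def IsNumeral : ℕ → M → Prop
  | 0, z => IsEmptySet z
  | k + 1, z => ∃ y, IsNumeral k y ∧ IsSucc z y

/-- `c = ⟨k, q⟩` -/
def IsTagged (k : ℕ) (c q : M) : Prop := ∃ t, IsNumeral k t ∧ IsOPair c t q

/-- `c = ⟨k, ⟨x, y⟩⟩` -/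
def IsTaggedPair (k : ℕ) (c x y : M) : Prop := ∃ q, IsOPair q x y ∧ IsTagged k c q

/-- `c` codes the formula `v_m = v_n`. -/
def IsEqCode (c m n : M) : Prop := IsTaggedPair 0 c m n

/-- `c` codes the formula `R_i(v_{u(0)}, …, v_{u(τ(i)-1)})`. -/
def IsRelCode (c i u : M) : Prop := IsTaggedPair 1 c i u

/-- `c` codes the negation of the formula coded by `d`. -/
def IsNegCode (c d : M) : Prop := IsTagged 2 c d

/-- `c` codes the conjunction of the formulas coded by `d` and `e`. -/
def IsAndCode (c d e : M) : Prop := IsTaggedPair 3 c d e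

/-- `c` codes `∃ v_n ψ`, where `d` codes `ψ`. -/
def IsExCode (c n d : M) : Prop := IsTaggedPair 4 c n d

/-- `F` is a set of (codes of) first-order formulas of type `τ`, closed under immediate
subformulas. By the axiom of foundation all its elements are built up from atomic formulas. -/
def IsFormulaSet (τ F : M) : Prop :=
  ∀ c, c ε F →
    (∃ m n, IsNat m ∧ IsNat n ∧ IsEqCode c m n) ∨
    (∃ i n w, App τ i n ∧ IsFunOn w n ∧ (∀ k m, App w k m → IsNat m) ∧ IsRelCode c i w) ∨
    (∃ d, d ε F ∧ IsNegCode c d) ∨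
    (∃ d e, d ε F ∧ e ε F ∧ IsAndCode c d e) ∨
    (∃ n d, IsNat n ∧ d ε F ∧ IsExCode c n d)

/-- `s` is an assignment of elements of `a` to the variables `v_n`: a function from `ω` to `a`. -/
def IsAssignment (s a : M) : Prop :=
  (∃ w, (∀ n, n ε w ↔ IsNat n) ∧ IsFunOn s w) ∧ ∀ n x, App s n x → x ε a

/-- `T` is the satisfaction relation of `⟨a, r⟩` for the formulas in `F`: it obeys Tarski's
clauses, where `App T c s` says that the assignment `s` satisfies the formula `c`. -/
def IsSatisfaction (a r F T : M) : Prop :=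
  ∀ c s, c ε F → IsAssignment s a →
    (∀ m n, IsEqCode c m n → (App T c s ↔ ∃ x, App s m x ∧ App s n x)) ∧
    (∀ i w, IsRelCode c i w → (App T c s ↔ ∃ X t, App r i X ∧ IsComp t s w ∧ t ε X)) ∧
    (∀ d, IsNegCode c d → (App T c s ↔ ¬ App T d s)) ∧
    (∀ d e, IsAndCode c d e → (App T c s ↔ App T d s ∧ App T e s)) ∧
    (∀ n d, IsExCode c n d → (App T c s ↔
      ∃ s', IsAssignment s' a ∧ (∀ m x, m ≠ n → (App s' m x ↔ App s m x)) ∧ App T d s'))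

/-- `j` is an elementary embedding of the structure `s` into the structure `s'`, both of
type `τ`. -/
def IsElementaryEmbedding (τ j s s' : M) : Prop :=
  ∃ b q a r, IsOPair s b q ∧ IsOPair s' a r ∧
    IsFunOn j b ∧ (∀ x y, App j x y → y ε a) ∧
    ∀ F T T', IsFormulaSet τ F → IsSatisfaction b q F T → IsSatisfaction a r F T' →
      ∀ c h h', c ε F → IsAssignment h b → IsComp h' j h → (App T c h ↔ App T' c h')

variable (M) in
/-- `Σ₁`-SR (boldface) holds in `M`: for every class of relational structures of the same type that
is definable in `M` by a `Σ₁` formula with parameters, there is an ordinal of `M` that reflects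
the class. Variable `0` of the formula is the one that ranges over the class. -/
def SigmaOneSR : Prop :=
  ∀ (k : ℕ) (φ : setLang.Formula (Fin (k + 1))), IsSigmaOne φ →
  ∀ (p : Fin k → M) (τ : M), IsType τ →
    (∀ x : M, φ.Realize (Fin.cons x p : Fin (k + 1) → M) → IsStructure τ x) →
    ∃ α : M, IsOrd α ∧
      ∀ x : M, φ.Realize (Fin.cons x p : Fin (k + 1) → M) →
        ∃ y w j : M, φ.Realize (Fin.cons y p : Fin (k + 1) → M) ∧
          IsV w α ∧ y ε w ∧ IsElementaryEmbedding τ j y x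

end Internal

/-- `Σ₁`-SR is provable in `ZFC`: by the completeness theorem this says that every instance of the
schema holds in every model of `ZFC`. -/
def SigmaOneSRProvableInZFC : Prop :=
  ∀ (M : Type v) [setLang.Structure M], Internal.IsModelZFC M → Internal.SigmaOneSR M

universe w

section

/-! ### Renaming and normal forms for `Σ₀` and `Σ₁` formulas -/

section Formulas

open FirstOrder Language

variable {β γ : Type} {n N : ℕ}

/-! From Σ₀-reflection to `C^(1)`. To find witnesses of a true statement `∃ ys, ψ(a, ys)` with `ψ`
Σ₀, consider the structures of empty type, that is, bare nonempty sets, that contain such witnesses.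
This class is Σ₀ in the parameters `a`, and a member of it in the transitive set `V_α` supplies
witnesses in `V_α`; hence `V_α ≺_{Σ₁} V` (`WitnessesSR.sigmaOneElementary`). That `α` is a cardinal
then follows: if `|α| < α`, a well-order of type `α` could be coded by an element of `V_α`. Having a
transitive collapse is a Σ₁ property, so the collapse would be found in `V_α` as well, and a set in
`V_α` would contain all ordinals below `α` (`SigmaOneElementary.exists_collapse_mem`,
`mem_classCOne`).

From `C^(1)` to Σ₁-reflection: Löwenheim–Skolem followed by Mostowski. Let `A` be in the class.
Elementarity puts some member of the class into `V_α`, and this bounds the ranks of the indices of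
the type, so some `V_μ` with `μ < α` contains the indices and the parameters. Take a hull `X` of
`V_μ`, of `A` and of the witnesses of the Σ₁ formula, of size `|V_μ|`, closed under Skolem functions
of `A` and of the finitely many bounded quantifiers in the matrix. The collapse of `X` fixes `V_μ`
pointwise and preserves the matrix (`IsSigmaZero.exists_skolem`), so it sends `A` to some `B` in the
class, and its inverse is an elementary embedding of `B` into `A` by the Tarski–Vaught test. As `X`
is enumerated by `V_μ`, its collapse is that of a relation on `V_μ`, so `B` lies in `V_α`.

For provability in ZFC the same hull argument is carried out inside an arbitrary model `M`. In place
of `V_μ` stands the set `her Z` of sets hereditarily of size at most `Z`, where `Z` is chosen large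
enough for the type and the parameters. The hull is covered by `her Z`, so its collapse lies in `her
(her Z)`, whatever `A` was; the rank of that set is a reflecting ordinal (`Internal.sigmaOneSR`).
Since the schemata of `M` only concern definable classes, every predicate and function used must be
shown definable; the classes `Dfn` and `DF` leave this to instance search. -/

theorem sumElim_snoc_castSucc {M : Type w} (v : β → M) (xs : Fin n → M) (z : M) (q : β ⊕ Fin n) :
    Sum.elim v (Fin.snoc xs z : Fin (n + 1) → M) (Sum.map id Fin.castSucc q) =
      Sum.elim v xs q := by
  cases q <;> simp

variable {M : Type w} [setLang.Structure M]

theorem realize_congr_of_eq {φ : setLang.BoundedFormula β 0} {v v' : β → M} {xs xs' : Fin 0 → M}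
    (h : ∀ b, v b = v' b) : φ.Realize v xs ↔ φ.Realize v' xs' := by
  rw [funext h, Subsingleton.elim xs xs']

@[simp] theorem realize_memFormula (x y : β ⊕ Fin n) (v : β → M) (xs : Fin n → M) :
    (memFormula x y).Realize v xs ↔ Internal.Mem (Sum.elim v xs x) (Sum.elim v xs y) := by
  simp only [memFormula, Internal.Mem]
  exact BoundedFormula.realize_rel₂

@[simp] theorem realize_ball (y : β ⊕ Fin n) (φ : setLang.BoundedFormula β (n + 1))
    (v : β → M) (xs : Fin n → M) :
    ((memFormula (Sum.inr (Fin.last n)) (Sum.map id Fin.castSucc y)).imp φ).all.Realize v xs ↔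
      ∀ z, Internal.Mem z (Sum.elim v xs y) → φ.Realize v (Fin.snoc xs z) := by
  simp [sumElim_snoc_castSucc]

/-- The variables of a `Σ₀` formula can be renamed in an arbitrary way. -/
theorem IsSigmaZero.exists_rename {φ : setLang.BoundedFormula β n} (h : IsSigmaZero φ) :
    ∀ {γ : Type} {N : ℕ} (g : β ⊕ Fin n → γ ⊕ Fin N), ∃ φ' : setLang.BoundedFormula γ N,
      IsSigmaZero φ' ∧ ∀ (M : Type w) [setLang.Structure M] (v : γ → M) (xs : Fin N → M),
        φ'.Realize v xs ↔ φ.Realize (fun b => Sum.elim v xs (g (.inl b)))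
          (fun i => Sum.elim v xs (g (.inr i))) := by
  induction h with
  | falsum => exact fun g => ⟨⊥, .falsum, by simp⟩
  | eq x y =>
    refine fun g => ⟨_, .eq (g x) (g y), fun M _ v xs => ?_⟩
    cases x <;> cases y <;> simp
  | mem x y =>
    refine fun g => ⟨_, .mem (g x) (g y), fun M _ v xs => ?_⟩
    cases x <;> cases y <;> simp
  | imp _ _ ih₁ ih₂ =>
    intro γ N g
    obtain ⟨φ₁, h₁, e₁⟩ := ih₁ g
    obtain ⟨φ₂, h₂, e₂⟩ := ih₂ g
    exact ⟨φ₁.imp φ₂, h₁.imp h₂, fun M _ v xs => by simp [e₁, e₂]⟩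
  | @ball n y φ _ ih =>
    intro γ N g
    -- Under the quantifier the renaming sends the new bound variable to the new last variable and
    -- shifts all other images into the larger context.
    obtain ⟨φ', h', e'⟩ := ih (γ := γ) (N := N + 1) (fun q => q.elim
      (fun b => Sum.map id Fin.castSucc (g (.inl b)))
      (fun i => Fin.lastCases (motive := fun _ => γ ⊕ Fin (N + 1)) (.inr (Fin.last N))
        (fun i => Sum.map id Fin.castSucc (g (.inr i))) i))
    refine ⟨_, h'.ball (g y), fun M _ v xs => ?_⟩
    simp only [realize_ball, e']
    refine forall_congr' fun z => ?_
    have h1 : (Sum.elim v xs (g y)) = Sum.elim (fun b => Sum.elim v xs (g (.inl b)))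
        (fun i => Sum.elim v xs (g (.inr i))) y := by cases y <;> rfl
    rw [h1]
    refine imp_congr Iff.rfl ?_
    have h2 : (fun i : Fin (n + 1) => Sum.elim v (Fin.snoc xs z : Fin (N + 1) → M)
        ((Fin.lastCases (motive := fun _ => γ ⊕ Fin (N + 1)) (.inr (Fin.last N))
        (fun i => Sum.map id Fin.castSucc (g (.inr i))) i))) =
        Fin.snoc (fun i => Sum.elim v xs (g (.inr i))) z := by
      funext i
      refine Fin.lastCases ?_ (fun i => ?_) i
      · simp
      · simp [sumElim_snoc_castSucc]
    simp only [Sum.elim_inl, Sum.elim_inr, sumElim_snoc_castSucc]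
    rw [h2]

/-- Every `Σ₁` formula is equivalent to a `Σ₀` formula preceded by existential quantifiers. -/
theorem IsSigmaOne.exists_normalForm {φ : setLang.BoundedFormula β n} (h : IsSigmaOne φ) :
    ∃ (m : ℕ) (ψ : setLang.Formula ((β ⊕ Fin n) ⊕ Fin m)), IsSigmaZero ψ ∧
      ∀ (M : Type w) [setLang.Structure M] (v : β → M) (xs : Fin n → M),
        φ.Realize v xs ↔ ∃ ys : Fin m → M, ψ.Realize (Sum.elim (Sum.elim v xs) ys) := by
  induction h with
  | @of_sigmaZero n φ h =>
    obtain ⟨φ', h', e'⟩ := h.exists_rename.{w} (γ := (β ⊕ Fin n) ⊕ Fin 0) (N := 0)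
      (fun q => .inl (.inl q))
    refine ⟨0, φ', h', fun M _ v xs => ?_⟩
    simp [Formula.Realize, e']
  | @ex n φ h ih =>
    obtain ⟨m, ψ, hψ, e⟩ := ih
    -- The variable bound by the outer `∃` becomes entry `0` of the block of witnesses; the `m`
    -- inner witnesses move up by one.
    obtain ⟨φ', h', e'⟩ := hψ.exists_rename.{w} (γ := (β ⊕ Fin n) ⊕ Fin (m + 1)) (N := 0)
      (fun q => .inl (q.elim (Sum.elim (Sum.elim (fun b => .inl (.inl b))
        (fun i => Fin.lastCases (motive := fun _ => (β ⊕ Fin n) ⊕ Fin (m + 1))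
          (.inr 0) (fun i => .inl (.inr i)) i)) (fun j => .inr j.succ)) Fin.elim0))
    refine ⟨m + 1, φ', h', fun M _ v xs => ?_⟩
    simp only [BoundedFormula.realize_ex, e, Formula.Realize, e', Sum.elim_inl]
    rw [Fin.exists_fin_succ_pi]
    refine exists_congr fun z => exists_congr fun ys => ?_
    refine realize_congr_of_eq fun q => ?_
    rcases q with (b | i) | j
    · rfl
    · refine Fin.lastCases ?_ (fun i => ?_) i <;> simp
    · simp

theorem IsSigmaOne.exs {φ : setLang.BoundedFormula β n} (h : IsSigmaOne φ) :
    IsSigmaOne (φ.exs : setLang.Formula β) := by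
  induction n with
  | zero => exact h
  | succ n ih => exact ih h.ex

/-- Prefixing a `Σ₀` formula with existential quantifiers gives a `Σ₁` formula. -/
theorem IsSigmaZero.exists_exs {m : ℕ} {ψ : setLang.Formula (β ⊕ Fin m)} (h : IsSigmaZero ψ) :
    ∃ φ : setLang.Formula β, IsSigmaOne φ ∧
      ∀ (M : Type w) [setLang.Structure M] (v : β → M),
        φ.Realize v ↔ ∃ ys : Fin m → M, ψ.Realize (Sum.elim v ys) := by
  obtain ⟨φ', h', e'⟩ := h.exists_rename.{w} (γ := β) (N := m) (Sum.elim id Fin.elim0)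
  refine ⟨φ'.exs, (IsSigmaOne.of_sigmaZero h').exs, fun M _ v => ?_⟩
  simp only [BoundedFormula.realize_exs, e']
  refine exists_congr fun ys => ?_
  exact realize_congr_of_eq fun q => by cases q <;> rfl

end Formulas

/-! ### `Σ₀` predicates on the universe of sets -/

/-- The predicate `P` of a family of sets is defined by a `Σ₀` formula. -/
class SigmaZeroPred {Γ : Type} (P : (Γ → ZFSet.{u}) → Prop) : Prop where
  out : ∃ φ : setLang.Formula Γ, IsSigmaZero φ ∧ ∀ v, φ.Realize v ↔ P v

namespace SigmaZeroPred

open FirstOrder Language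

variable {Γ : Type} {P Q : (Γ → ZFSet.{u}) → Prop}

theorem congr (h : ∀ v, P v ↔ Q v) [hP : SigmaZeroPred P] : SigmaZeroPred Q := by
  obtain ⟨φ, h1, h2⟩ := hP.out
  exact ⟨φ, h1, fun v => (h2 v).trans (h v)⟩

instance falsum : SigmaZeroPred (fun _ : Γ → ZFSet.{u} => False) :=
  ⟨⊥, .falsum, fun _ => Iff.rfl⟩

instance mem (i j : Γ) : SigmaZeroPred (fun v : Γ → ZFSet.{u} => v i ∈ v j) :=
  ⟨_, .mem (.inl i) (.inl j), fun v => by rw [Formula.Realize, realize_memFormula]; rfl⟩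

instance eq (i j : Γ) : SigmaZeroPred (fun v : Γ → ZFSet.{u} => v i = v j) :=
  ⟨_, .eq (.inl i) (.inl j), fun v => by simp [Formula.Realize]⟩

instance imp [hP : SigmaZeroPred P] [hQ : SigmaZeroPred Q] :
    SigmaZeroPred (fun v => P v → Q v) := by
  obtain ⟨φ, h1, h2⟩ := hP.out
  obtain ⟨ψ, h3, h4⟩ := hQ.out
  refine ⟨φ.imp ψ, h1.imp h3, fun v => ?_⟩
  have a := h2 v
  have b := h4 v
  simp only [Formula.Realize] at a b
  simp [Formula.Realize, a, b]

instance not [SigmaZeroPred P] : SigmaZeroPred (fun v => ¬ P v) :=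
  imp (P := P) (Q := fun _ => False)

instance and [SigmaZeroPred P] [SigmaZeroPred Q] : SigmaZeroPred (fun v => P v ∧ Q v) :=
  congr (P := fun v => ¬ (P v → ¬ Q v)) fun _ => by tauto

instance or [SigmaZeroPred P] [SigmaZeroPred Q] : SigmaZeroPred (fun v => P v ∨ Q v) :=
  congr (P := fun v => ¬ P v → Q v) fun _ => by tauto

theorem rename {Δ : Type} (P : (Δ → ZFSet.{u}) → Prop) [hP : SigmaZeroPred P] (g : Δ → Γ) :
    SigmaZeroPred (fun v : Γ → ZFSet.{u} => P (fun i => v (g i))) := by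
  obtain ⟨φ, h1, h2⟩ := hP.out
  obtain ⟨φ', h', e'⟩ := h1.exists_rename.{u+1} (γ := Γ) (N := 0) (Sum.elim (fun i => .inl (g i)) Fin.elim0)
  refine ⟨φ', h', fun v => ?_⟩
  rw [Formula.Realize, e', ← h2]
  exact realize_congr_of_eq fun _ => rfl

/-- The bound variable is `none : Option Γ`. With this convention instance search can descend
through nested bounded quantifiers. -/
instance ball (i : Γ) {P : (Γ → ZFSet.{u}) → ZFSet.{u} → Prop}
    [hP : SigmaZeroPred (fun v : Option Γ → ZFSet.{u} => P (fun i => v (some i)) (v none))] :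
    SigmaZeroPred (fun v : Γ → ZFSet.{u} => ∀ z, z ∈ v i → P v z) := by
  obtain ⟨φ, h1, h2⟩ := hP.out
  obtain ⟨φ', h', e'⟩ := h1.exists_rename.{u+1} (γ := Γ) (N := 1)
    (Sum.elim (fun o => o.elim (.inr 0) .inl) Fin.elim0)
  refine ⟨_, h'.ball (.inl i), fun v => ?_⟩
  rw [Formula.Realize, realize_ball]
  refine forall_congr' fun z => imp_congr Iff.rfl ?_
  have := h2 (fun o => o.elim z v)
  refine (e' _ _ _).trans (Iff.trans ?_ this)
  exact realize_congr_of_eq fun o => by cases o <;> rfl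

instance bex (i : Γ) {P : (Γ → ZFSet.{u}) → ZFSet.{u} → Prop}
    [hP : SigmaZeroPred (fun v : Option Γ → ZFSet.{u} => P (fun i => v (some i)) (v none))] :
    SigmaZeroPred (fun v : Γ → ZFSet.{u} => ∃ z, z ∈ v i ∧ P v z) :=
  congr (P := fun v => ¬ ∀ z, z ∈ v i → ¬ P v z) fun _ => by push Not; rfl

end SigmaZeroPred

end

/-! ### Basic Σ₀ predicates, absoluteness, and Σ₁-elementarity of `V_κ`. -/

section

namespace SigmaZeroPred

variable {Γ : Type}

instance eq_upair (i j k : Γ) : SigmaZeroPred (fun v : Γ → ZFSet.{u} => v i = {v j, v k}) :=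
  congr (P := fun v => v j ∈ v i ∧ v k ∈ v i ∧ ∀ z, z ∈ v i → z = v j ∨ z = v k) fun v => by
    constructor
    · rintro ⟨h1, h2, h3⟩
      ext z
      simp only [ZFSet.mem_pair]
      exact ⟨h3 z, by rintro (rfl | rfl) <;> assumption⟩
    · intro h
      simp [h]

/-- The sets `{x}` and `{x, y}` are themselves elements of the Kuratowski pair, so both can be
quantified with the bound `v i`. -/
instance eq_pair (i j k : Γ) : SigmaZeroPred (fun v : Γ → ZFSet.{u} => v i = pair (v j) (v k)) :=
  congr (P := fun v => ∃ s, s ∈ v i ∧ (s = {v j, v j} ∧ ∃ d, d ∈ v i ∧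
      (d = {v j, v k} ∧ v i = {s, d}))) fun v => by
    constructor
    · rintro ⟨s, hs, rfl, d, hd, rfl, h⟩
      rw [h, pair, ZFSet.pair_eq_singleton]
    · intro h
      refine ⟨{v j, v j}, ?_, rfl, {v j, v k}, ?_, rfl, ?_⟩ <;> simp [h, pair]

instance pair_mem (i j k : Γ) : SigmaZeroPred (fun v : Γ → ZFSet.{u} => pair (v j) (v k) ∈ v i) :=
  congr (P := fun v => ∃ w, w ∈ v i ∧ w = pair (v j) (v k)) fun v => by simp

instance subset (i j : Γ) : SigmaZeroPred (fun v : Γ → ZFSet.{u} => v i ⊆ v j) :=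
  congr (P := fun v => ∀ z, z ∈ v i → z ∈ v j) fun _ => Iff.rfl

/-- A block of existential quantifiers bounded by the same set. -/
theorem bexs {Γ : Type} (i : Γ) {m : ℕ} {P : (Γ → ZFSet.{u}) → (Fin m → ZFSet.{u}) → Prop}
    (hP : SigmaZeroPred (fun v : Γ ⊕ Fin m → ZFSet.{u} =>
      P (fun j => v (.inl j)) (fun j => v (.inr j)))) :
    SigmaZeroPred (fun v : Γ → ZFSet.{u} => ∃ ys : Fin m → ZFSet.{u}, (∀ j, ys j ∈ v i) ∧ P v ys) := by
  induction m generalizing Γ with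
  | zero =>
    have := rename (Γ := Γ) (fun v : Γ ⊕ Fin 0 → ZFSet.{u} =>
      P (fun j => v (.inl j)) (fun j => v (.inr j))) (Sum.elim id Fin.elim0)
    refine this.congr fun v => ?_
    have hys : ∀ ys : Fin 0 → ZFSet.{u}, (fun j => v (Sum.elim id Fin.elim0 (.inr j))) = ys :=
      fun ys => Subsingleton.elim _ _
    constructor
    · intro h
      exact ⟨_, fun j => j.elim0, h⟩
    · rintro ⟨ys, -, h⟩
      rw [← hys ys] at h
      exact h
  | succ m ih =>
    have h1 := rename (Γ := Option Γ ⊕ Fin m) (fun v : Γ ⊕ Fin (m + 1) → ZFSet.{u} =>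
      P (fun j => v (.inl j)) (fun j => v (.inr j)))
      (Sum.elim (fun j => .inl (some j)) (Fin.cons (.inl none) (fun j => .inr j)))
    have h2 := ih (Γ := Option Γ) (some i)
      (P := fun v ys => P (fun j => v (some j)) (Fin.cons (v none) ys)) (h1.congr fun v => by
        simp only [Sum.elim_inl, Sum.elim_inr]
        have : (fun j : Fin (m + 1) => v (Fin.cons (α := fun _ => Option Γ ⊕ Fin m) (.inl none)
            (fun j => .inr j) j)) = Fin.cons (v (.inl none)) (fun j => v (.inr j)) := by
          funext j
          refine Fin.cases ?_ (fun j => ?_) j <;> simp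
        rw [this])
    have h3 := bex (Γ := Γ) i (P := fun v z => ∃ ys : Fin m → ZFSet.{u}, (∀ j, ys j ∈ v i) ∧
      P v (Fin.cons z ys))
    refine h3.congr fun v => ?_
    rw [Fin.exists_fin_succ_pi]
    refine exists_congr fun z => ?_
    simp [Fin.forall_fin_succ, and_assoc]

end SigmaZeroPred

open FirstOrder Language

/-- `Σ₀` formulas are absolute between a transitive set and the universe. -/
theorem IsSigmaZero.realize_iff {β : Type} {n : ℕ} {φ : setLang.BoundedFormula β n}
    (h : IsSigmaZero φ) {a : ZFSet.{u}} (ha : a.IsTransitive) (v : β → {x : ZFSet.{u} // x ∈ a})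
    (xs : Fin n → {x : ZFSet.{u} // x ∈ a}) :
    φ.Realize v xs ↔ φ.Realize (fun i => (v i : ZFSet.{u})) (fun i => (xs i : ZFSet.{u})) := by
  have key : ∀ {n : ℕ} (v : β → {x : ZFSet.{u} // x ∈ a}) (xs : Fin n → {x : ZFSet.{u} // x ∈ a})
      (y : β ⊕ Fin n), ((Sum.elim v xs y : {x : ZFSet.{u} // x ∈ a}) : ZFSet.{u}) =
      Sum.elim (fun i => (v i : ZFSet.{u})) (fun i => (xs i : ZFSet.{u})) y := by
    intro n v xs y
    cases y <;> rfl
  induction h with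
  | falsum => exact Iff.rfl
  | eq x y =>
    simp only [BoundedFormula.realize_bdEqual, Term.realize_var, ← key]
    exact Subtype.ext_iff
  | mem x y =>
    simp only [realize_memFormula, ← key]
    exact Iff.rfl
  | imp _ _ ih₁ ih₂ => simp [ih₁, ih₂]
  | @ball n y φ _ ih =>
    rw [realize_ball, realize_ball, ← key]
    have e : ∀ z : {x : ZFSet.{u} // x ∈ a},
        (fun i => ((Fin.snoc xs z : Fin (n + 1) → _) i : ZFSet.{u})) =
          Fin.snoc (fun i => (xs i : ZFSet.{u})) (z : ZFSet.{u}) := by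
      intro z
      funext i
      refine Fin.lastCases ?_ (fun i => ?_) i <;> simp
    constructor
    · intro h z hz
      -- The only use of transitivity: a bounded quantifier has the same range in `a` as in the
      -- universe.
      have hza : z ∈ a := ha.subset_of_mem (Sum.elim v xs y).2 hz
      have := (ih (Fin.snoc xs ⟨z, hza⟩)).1 (h ⟨z, hza⟩ hz)
      rwa [e] at this
    · intro h z hz
      refine (ih _).2 ?_
      rw [e]
      exact h z hz

/-- `V_κ` is a `Σ₁`-elementary substructure of the universe. -/
def SigmaOneElementary (κ : Ordinal.{u}) : Prop :=
  ∀ (k : ℕ) (φ : setLang.Formula (Fin k)), IsSigmaOne φ →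
    ∀ a : Fin k → {x : ZFSet.{u} // x ∈ V_ κ},
      φ.Realize a ↔ φ.Realize (fun i => (a i : ZFSet.{u}))

namespace SigmaOneElementary

variable {κ : Ordinal.{u}}

/-- A true Σ₁ statement holds in `V_κ`, and its Σ₀ matrix is absolute because `V_κ` is transitive,
so witnesses in the sense of `V_κ` are real witnesses. All later uses of elementarity go through
this form. -/
theorem exists_mem (h : SigmaOneElementary κ) {k m : ℕ}
    {P : (Fin k ⊕ Fin m → ZFSet.{u}) → Prop} (hP : SigmaZeroPred P) {a : Fin k → ZFSet.{u}}
    (ha : ∀ i, a i ∈ V_ κ) (hx : ∃ ys, P (Sum.elim a ys)) :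
    ∃ ys, (∀ i, ys i ∈ V_ κ) ∧ P (Sum.elim a ys) := by
  obtain ⟨ψ, h1, h2⟩ := hP.out
  obtain ⟨φ, h3, h4⟩ := h1.exists_exs.{u + 1}
  simp only [← h2] at hx
  rw [← h4] at hx
  obtain ⟨ys, hys⟩ := (h4 _ _).1 ((h k φ h3 fun i => ⟨a i, ha i⟩).2 hx)
  refine ⟨fun i => ys i, fun i => (ys i).2, ?_⟩
  rw [← h2]
  rw [Formula.Realize, h1.realize_iff (ZFSet.isTransitive_vonNeumann κ)] at hys
  refine (realize_congr_of_eq fun q => ?_).1 hys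
  cases q <;> rfl

/-- If all existential statements of `Σ₀` predicates are reflected, then `V_κ` is `Σ₁`-elementary. -/
theorem of_exists_mem (h : ∀ (k m : ℕ) (ψ : setLang.Formula (Fin k ⊕ Fin m)), IsSigmaZero ψ →
    ∀ a : Fin k → ZFSet.{u}, (∀ i, a i ∈ V_ κ) → (∃ ys, ψ.Realize (Sum.elim a ys)) →
      ∃ ys, (∀ i, ys i ∈ V_ κ) ∧ ψ.Realize (Sum.elim a ys)) : SigmaOneElementary κ := by
  intro k φ hφ a
  obtain ⟨m, ψ, h1, h2⟩ := hφ.exists_normalForm.{u + 1}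
  obtain ⟨ψ', h3, h4⟩ := h1.exists_rename.{u + 1} (γ := Fin k ⊕ Fin m) (N := 0)
    (Sum.elim (Sum.elim (Sum.elim (fun i => .inl (.inl i)) Fin.elim0) (fun i => .inl (.inr i)))
      Fin.elim0)
  have h5 : ∀ (M : Type (u + 1)) [setLang.Structure M] (a : Fin k → M),
      φ.Realize a ↔ ∃ ys : Fin m → M, ψ'.Realize (Sum.elim a ys) default := by
    intro M _ a
    rw [Formula.Realize, h2]
    refine exists_congr fun ys => ?_
    rw [h4]
    exact realize_congr_of_eq fun q => by
      rcases q with (q | q) | q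
      · rfl
      · exact q.elim0
      · rfl
  rw [h5, h5]
  constructor
  · rintro ⟨ys, hys⟩
    rw [h3.realize_iff (ZFSet.isTransitive_vonNeumann κ)] at hys
    refine ⟨fun i => ys i, (realize_congr_of_eq fun q => ?_).1 hys⟩
    cases q <;> rfl
  · intro hys
    obtain ⟨ys, h6, h7⟩ := h k m ψ' h3 _ (fun i => (a i).2) hys
    refine ⟨fun i => ⟨ys i, h6 i⟩, ?_⟩
    rw [h3.realize_iff (ZFSet.isTransitive_vonNeumann κ)]
    refine (realize_congr_of_eq fun q => ?_).1 h7
    cases q <;> rfl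

theorem exists_mem_of_mem (h : SigmaOneElementary κ) {a : ZFSet.{u}} (ha : a ∈ V_ κ) :
    ∃ b ∈ V_ κ, a ∈ b := by
  obtain ⟨ys, h1, h2⟩ := h.exists_mem (k := 1) (m := 1) (P := fun v => v (.inl 0) ∈ v (.inr 0))
    inferInstance (a := fun _ => a) (fun _ => ha) ⟨fun _ => {a}, by simp⟩
  exact ⟨ys 0, h1 0, h2⟩

/-- `V_o` belongs to some `b` in `V_κ`, and the rank of `b` is strictly between `o` and `κ`. -/
theorem isSuccPrelimit (h : SigmaOneElementary κ) {o : Ordinal.{u}} (ho : o < κ) :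
    Order.succ o < κ := by
  obtain ⟨b, hb, hab⟩ := h.exists_mem_of_mem (a := V_ o) (by simpa using ho)
  have := ZFSet.rank_lt_of_mem hab
  rw [ZFSet.rank_vonNeumann] at this
  exact (Order.succ_le_of_lt this).trans_lt (ZFSet.mem_vonNeumann.1 hb)

/-- A nonempty set each of whose elements belongs to another element has infinite rank; this
property is Σ₀, and `omega` has it. The conjunct `e = e` merely gives nonemptiness the shape of a
bounded quantifier. -/
theorem omega0_lt (h : SigmaOneElementary κ) : Ordinal.omega0 < κ := by
  obtain ⟨ys, h1, ⟨e, he⟩, h2⟩ := h.exists_mem (k := 0) (m := 1)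
    (P := fun v => (∃ e, e ∈ v (.inr 0) ∧ e = e) ∧
      ∀ y, y ∈ v (.inr 0) → ∃ s, s ∈ v (.inr 0) ∧ y ∈ s)
    (SigmaZeroPred.and) (a := Fin.elim0) (fun i => i.elim0) ⟨fun _ => omega, by
      refine ⟨⟨∅, ZFSet.omega_zero, rfl⟩, fun y hy => ⟨_, ZFSet.omega_succ hy, by simp⟩⟩⟩
  refine lt_of_le_of_lt ?_ (ZFSet.mem_vonNeumann.1 (h1 0))
  simp only [Sum.elim_inr] at he h2
  by_contra hlt
  rw [not_le, Ordinal.lt_omega0] at hlt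
  obtain ⟨n, hn⟩ := hlt
  have : ∀ i : ℕ, ∃ y ∈ ys 0, (i : Ordinal) ≤ y.rank := by
    intro i
    induction i with
    | zero => exact ⟨e, he.1, by simp⟩
    | succ i ih =>
      obtain ⟨y, hy, hi⟩ := ih
      obtain ⟨s, hs, hys⟩ := h2 y hy
      refine ⟨s, hs, ?_⟩
      have := hi.trans_lt (ZFSet.rank_lt_of_mem hys)
      push_cast
      exact Order.succ_le_of_lt this
  obtain ⟨y, hy, hny⟩ := this n
  have := ZFSet.rank_lt_of_mem hy
  rw [hn] at this
  exact absurd hny (not_le.2 this)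

/-- The transitive collapse of a well-founded relation in `V_κ` is an element of `V_κ`. -/
theorem exists_collapse_mem (h : SigmaOneElementary κ) {μ : Ordinal.{u}} (hμ : μ < κ)
    (r : ZFSet.{u} → ZFSet.{u} → Prop) (F : ZFSet.{u} → ZFSet.{u})
    (hF : ∀ k ∈ V_ μ, ∀ z, z ∈ F k ↔ ∃ l ∈ V_ μ, r l k ∧ z = F l) :
    ∃ t ∈ V_ κ, ∀ k ∈ V_ μ, F k ∈ t := by
  -- The relation becomes a parameter of a Σ₁ statement. Pairs of elements of `V_μ` lie in
  -- `V_{μ+2}`, which is an element of `V_κ` since `κ` is closed under successors.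
  have hE : (V_ μ).pairSep r (V_ μ) ∈ V_ κ := by
    have h1 : V_ (Order.succ (Order.succ μ)) ∈ V_ κ := by
      exact ZFSet.vonNeumann_mem_of_lt (h.isSuccPrelimit (h.isSuccPrelimit hμ))
    refine ZFSet.mem_vonNeumann_of_subset (fun z hz => ?_) h1
    obtain ⟨a, ha, b, hb, rfl, -⟩ := ZFSet.mem_pairSep.1 hz
    rw [ZFSet.mem_vonNeumann] at *
    have h1 : pair a b = {{a}, {a, b}} := rfl
    rw [h1, ZFSet.rank_pair, ZFSet.rank_pair, ZFSet.rank_singleton]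
    simp [ha, hb]
  have hr : ∀ l ∈ V_ μ, ∀ k ∈ V_ μ, (pair l k ∈ (V_ μ).pairSep r (V_ μ) ↔ r l k) := by
    intro l hl k hk
    simp [ZFSet.mem_pairSep, hl, hk]
  -- Uniqueness of the collapse, by ∈-induction on the value `F k`: by `hF`, `r l k` makes `F l` an
  -- element of `F k`, so well-foundedness of `r` is inherited from membership.
  have hwf : ∀ (u : ZFSet.{u}) (k : ZFSet.{u}), k ∈ V_ μ → F k = u → ∀ t c : ZFSet.{u}, t.IsTransitive →
      (∀ k, k ∈ V_ μ → ∀ u, u ∈ t → pair k u ∈ c →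
        (∀ z, z ∈ u → ∃ l, l ∈ V_ μ ∧ (pair l k ∈ (V_ μ).pairSep r (V_ μ) ∧ pair l z ∈ c)) ∧
        ∀ l, l ∈ V_ μ → pair l k ∈ (V_ μ).pairSep r (V_ μ) → ∃ z, z ∈ u ∧ pair l z ∈ c) →
      ∀ w ∈ t, pair k w ∈ c → w = F k := by
    intro u
    induction u using ZFSet.inductionOn with
    | _ u ih =>
    rintro k hk rfl t c ht hc w hw hkw
    obtain ⟨h1, h2⟩ := hc k hk w hw hkw
    have hl : ∀ l ∈ V_ μ, r l k → ∀ w ∈ t, pair l w ∈ c → w = F l := by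
      intro l hl hlk
      exact ih (F l) ((hF k hk _).2 ⟨l, hl, hlk, rfl⟩) l hl rfl t c ht hc
    ext z
    rw [hF k hk]
    constructor
    · intro hz
      obtain ⟨l, hl', h3, h4⟩ := h1 z hz
      rw [hr l hl' k hk] at h3
      exact ⟨l, hl', h3, hl l hl' h3 z (ht.subset_of_mem hw hz) h4⟩
    · rintro ⟨l, hl', h3, rfl⟩
      obtain ⟨z, hz, h4⟩ := h2 l hl' ((hr l hl' k hk).2 h3)
      rwa [← hl l hl' h3 z (ht.subset_of_mem hw hz) h4]
  -- The witnesses are a transitive set `t` and a graph `c` that relates every `k` to some element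
  -- of `t` and obeys the collapsing recursion. That `c` is a function need not be stated; `hwf`
  -- determines its values in `t`.
  obtain ⟨ys, h1, h2, h3, h4⟩ := h.exists_mem (k := 2) (m := 2)
    (P := fun v => (∀ x, x ∈ v (.inr 0) → x ⊆ v (.inr 0)) ∧
      (∀ k, k ∈ v (.inl 0) → ∃ u, u ∈ v (.inr 0) ∧ pair k u ∈ v (.inr 1)) ∧
      (∀ k, k ∈ v (.inl 0) → ∀ u, u ∈ v (.inr 0) → pair k u ∈ v (.inr 1) →
        (∀ z, z ∈ u → ∃ l, l ∈ v (.inl 0) ∧ (pair l k ∈ v (.inl 1) ∧ pair l z ∈ v (.inr 1))) ∧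
        ∀ l, l ∈ v (.inl 0) → pair l k ∈ v (.inl 1) → ∃ z, z ∈ u ∧ pair l z ∈ v (.inr 1)))
    inferInstance (a := ![V_ μ, (V_ μ).pairSep r (V_ μ)])
    (by simp [Fin.forall_fin_two, hμ, hE]) (by
      let t : ZFSet.{u} := ZFSet.range fun k : {x // x ∈ V_ μ} => F k
      let c : ZFSet.{u} := ZFSet.range fun k : {x // x ∈ V_ μ} => pair k (F k)
      have hc : ∀ k u, pair k u ∈ c ↔ k ∈ V_ μ ∧ u = F k := by
        intro k u
        simp only [c, ZFSet.mem_range, Subtype.exists, ZFSet.pair_inj]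
        constructor
        · rintro ⟨k, hk, rfl, rfl⟩
          exact ⟨hk, rfl⟩
        · rintro ⟨hk, rfl⟩
          exact ⟨k, hk, rfl, rfl⟩
      have ht : ∀ u, u ∈ t ↔ ∃ k ∈ V_ μ, F k = u := by
        intro u
        simp [t]
      refine ⟨![t, c], ?_⟩
      simp only [Sum.elim_inr, Sum.elim_inl, Matrix.cons_val_zero, Matrix.cons_val_one, hc]
      refine ⟨?_, ?_, ?_⟩
      · intro x hx z hz
        obtain ⟨k, hk, rfl⟩ := (ht _).1 hx
        obtain ⟨l, hl, -, rfl⟩ := (hF k hk z).1 hz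
        exact (ht _).2 ⟨l, hl, rfl⟩
      · intro k hk
        exact ⟨F k, (ht _).2 ⟨k, hk, rfl⟩, hk, rfl⟩
      · rintro k hk u hu ⟨-, rfl⟩
        constructor
        · intro z hz
          obtain ⟨l, hl, hlk, rfl⟩ := (hF k hk z).1 hz
          exact ⟨l, hl, (hr l hl k hk).2 hlk, hl, rfl⟩
        · intro l hl hlk
          exact ⟨F l, (hF k hk _).2 ⟨l, hl, (hr l hl k hk).1 hlk, rfl⟩, hl, rfl⟩)
  simp only [Sum.elim_inr, Sum.elim_inl, Matrix.cons_val_zero, Matrix.cons_val_one] at h2 h3 h4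
  refine ⟨ys 0, h1 0, fun k hk => ?_⟩
  obtain ⟨u, hu, hku⟩ := h3 k hk
  rwa [← hwf _ k hk rfl _ _ (fun x hx => h2 x hx) h4 u hu hku]

/-- If `μ = |κ|` were below `κ`, a bijection of `μ` with `κ` would define, through ranks, a relation
on `V_μ` whose collapse has exactly the ordinals below `κ` as values. Then some set in `V_κ` would
contain all of them. -/
theorem mem_classCOne (h : SigmaOneElementary κ) : κ ∈ classCOne := by
  refine ⟨⟨κ.card, ?_⟩, h⟩
  by_contra hne
  have hlt : κ.card.ord < κ := lt_of_le_of_ne (Cardinal.ord_card_le κ) (Ne.symm hne)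
  set μ := κ.card.ord with hμ
  have hcard : Cardinal.mk (Set.Iio κ) = Cardinal.mk (Set.Iio μ) := by
    rw [Cardinal.mk_Iio_ordinal, Cardinal.mk_Iio_ordinal, hμ, Cardinal.card_ord]
  obtain ⟨e⟩ := Cardinal.eq.1 hcard
  let f : Ordinal.{u} → Ordinal.{u} := fun o => if ho : o < μ then e.symm ⟨o, ho⟩ else 0
  have hfκ : ∀ o < μ, f o < κ := fun o ho => by
    simp only [f, ho, dif_pos]
    exact (e.symm ⟨o, ho⟩).2
  have hfs : ∀ a < κ, ∃ o < μ, f o = a := fun a ha => by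
    refine ⟨e ⟨a, ha⟩, (e ⟨a, ha⟩).2, ?_⟩
    have : (e ⟨a, ha⟩ : Ordinal) < μ := (e ⟨a, ha⟩).2
    simp only [f, this, dif_pos]
    exact congrArg Subtype.val (e.symm_apply_apply ⟨a, ha⟩)
  obtain ⟨t, ht, hF⟩ := h.exists_collapse_mem hlt (fun l k => f l.rank < f k.rank)
    (fun k => (f k.rank).toZFSet) (by
      intro k hk z
      rw [Ordinal.mem_toZFSet_iff]
      constructor
      · rintro ⟨a, ha, rfl⟩
        obtain ⟨o, ho, rfl⟩ := hfs a (ha.trans (hfκ _ (ZFSet.mem_vonNeumann.1 hk)))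
        exact ⟨V_ o, by simpa using ho, by simpa using ha, by simp⟩
      · rintro ⟨l, hl, hlk, rfl⟩
        exact ⟨_, hlk, rfl⟩)
  rw [ZFSet.mem_vonNeumann] at ht
  -- With `f o` the rank of `t` itself, the ordinal represented by `V_o` would be an element of `t`
  -- of the same rank as `t`.
  obtain ⟨o, ho, hft⟩ := hfs _ ht
  have := ZFSet.rank_lt_of_mem (hF (V_ o) (by simpa using ho))
  simp [hft] at this

end SigmaOneElementary

/-! ### From Σ₀-reflection to Σ₁-elementarity. -/

theorem relStr_empty_code (S : RelStr (∅ : ZFSet.{u})) : S.code = pair S.carrier ∅ := by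
  rw [RelStr.code]
  congr 1
  rw [ZFSet.eq_empty]
  intro z hz
  obtain ⟨i, n, X, h, -⟩ := S.rel_dom z hz
  exact ZFSet.notMem_empty _ h

/-- Reflect the class of codes `⟨b, ∅⟩` such that `b` contains witnesses of `ψ`. The carrier `b` is
reached from the code `x` by `b ∈ d ∈ x`, which keeps the definition Σ₀; transitivity of `V_α`
brings the witnesses in the reflected carrier into `V_α`. -/
theorem WitnessesSR.sigmaOneElementary {α : Ordinal.{u}}
    (h : WitnessesSR (fun _ φ => IsSigmaZero φ) α) : SigmaOneElementary α := by
  refine SigmaOneElementary.of_exists_mem fun k m ψ hψ a ha ⟨ys, hys⟩ => ?_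
  have hP : SigmaZeroPred (fun v : Fin (k + 1) → ZFSet.{u} => ∃ d, d ∈ v 0 ∧ (∃ b, b ∈ d ∧
      (∃ e, e ∈ d ∧ (v 0 = pair b e ∧ (∀ z, z ∈ e → False) ∧ (∃ y, y ∈ b ∧ y = y) ∧
        ∃ ys : Fin m → ZFSet.{u}, (∀ j, ys j ∈ b) ∧
          ψ.Realize (Sum.elim (fun i => v i.succ) ys))))) := by
    have h0 : SigmaZeroPred (fun v : Fin k ⊕ Fin m → ZFSet.{u} => ψ.Realize v) :=
      ⟨ψ, hψ, fun _ => Iff.rfl⟩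
    have h1 : SigmaZeroPred (fun v : Option (Option (Option (Fin (k + 1)))) → ZFSet.{u} =>
        ∃ ys : Fin m → ZFSet.{u}, (∀ j, ys j ∈ v (some none)) ∧
          ψ.Realize (Sum.elim (fun i : Fin k => v (some (some (some i.succ)))) ys)) := by
      refine SigmaZeroPred.bexs (some none) ((SigmaZeroPred.rename
        (fun v : Fin k ⊕ Fin m → ZFSet.{u} => ψ.Realize v)
        (Sum.map (fun i : Fin k => some (some (some i.succ))) id)).congr fun v => ?_)
      refine realize_congr_of_eq fun q => ?_
      cases q <;> rfl
    infer_instance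
  obtain ⟨χ, hχ, hχ'⟩ := hP.out
  have hstr : ∀ b : ZFSet.{u}, (∃ y, y ∈ b) → ∃ S : RelStr (∅ : ZFSet.{u}), S.carrier = b := by
    intro b hb
    exact ⟨⟨b, ∅, hb, by simp, by simp, by simp⟩, rfl⟩
  have href := h k χ hχ a ha ∅ ⟨∅, by simp [IsFunc]⟩ (by
    intro x hx
    rw [hχ'] at hx
    obtain ⟨d, hd, b, hb, e, he, h1, h2, ⟨y, h3, -⟩, -⟩ := hx
    obtain ⟨S, hS⟩ := hstr b ⟨y, h3⟩
    refine ⟨S, ?_⟩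
    simp only [Fin.cons_zero] at h1
    rw [relStr_empty_code, hS, h1, (ZFSet.eq_empty e).2 h2])
  -- The extra element `∅` keeps the carrier nonempty when there are no witnesses to collect, `m =
  -- 0`.
  let b : ZFSet.{u} := insert ∅ (ZFSet.range ys)
  obtain ⟨S, hS⟩ := hstr b ⟨∅, by simp [b]⟩
  obtain ⟨B, hB1, hB2, -⟩ := href S (by
    simp only [Set.mem_ofPred_eq, hχ', Fin.cons_zero, Fin.cons_succ]
    refine ⟨{b, ∅}, ?_, b, by simp, ∅, by simp, ?_, by simp, ⟨∅, by simp [b]⟩, ys, ?_, hys⟩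
    · rw [relStr_empty_code, hS, pair]
      simp
    · rw [relStr_empty_code, hS]
    · simp [b])
  simp only [Set.mem_ofPred_eq, hχ', Fin.cons_zero, Fin.cons_succ] at hB1
  obtain ⟨d, hd, b, hb, e, he, h1, -, -, ys', h2, h3⟩ := hB1
  have ht := ZFSet.isTransitive_vonNeumann α
  exact ⟨ys', fun j => ht.subset_of_mem (ht.subset_of_mem (ht.subset_of_mem hB2 hd) hb) (h2 j), h3⟩

end

section

open FirstOrder Language

/-! ### Preservation of `Σ₀` formulas under collapsing maps -/

section Skolem

variable {M : Type w} [setLang.Structure M] {β : Type}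

/-- `X` contains counterexamples to the bounded formulas `∀ z ∈ y, φ`, provided there are any. -/
def BoundedSkolem (X : Set M) {n : ℕ} (φ : setLang.BoundedFormula β (n + 1)) (y : β ⊕ Fin n) :
    Prop :=
  ∀ (v : β → M) (xs : Fin n → M), (∀ b, v b ∈ X) → (∀ i, xs i ∈ X) →
    (∃ z, Internal.Mem z (Sum.elim v xs y) ∧ ¬ φ.Realize v (Fin.snoc xs z)) →
    ∃ z ∈ X, Internal.Mem z (Sum.elim v xs y) ∧ ¬ φ.Realize v (Fin.snoc xs z)

/-- `π` is an injective collapsing map on `X`. -/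
structure IsCollapseOn (π : M → M) (X : Set M) : Prop where
  mem_iff : ∀ u ∈ X, ∀ z, Internal.Mem z (π u) ↔ ∃ w ∈ X, Internal.Mem w u ∧ z = π w
  injOn : Set.InjOn π X

theorem IsCollapseOn.map_mem_iff {π : M → M} {X : Set M} (h : IsCollapseOn π X) {u w : M}
    (hu : u ∈ X) (hw : w ∈ X) : Internal.Mem (π w) (π u) ↔ Internal.Mem w u := by
  rw [h.mem_iff u hu]
  constructor
  · rintro ⟨w', hw', h1, h2⟩
    rwa [h.injOn hw hw' h2]
  · exact fun h1 => ⟨w, hw, h1, rfl⟩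

/-- A `Σ₀` formula is preserved by collapsing maps on sets that are closed under Skolem functions
for finitely many formulas. -/
theorem IsSigmaZero.exists_skolem {n : ℕ} {φ : setLang.BoundedFormula β n} (h : IsSigmaZero φ) :
    ∃ L : List (Σ n, setLang.BoundedFormula β (n + 1) × (β ⊕ Fin n)),
      ∀ (M : Type w) [setLang.Structure M] (X : Set M) (π : M → M), IsCollapseOn π X →
        (∀ e ∈ L, BoundedSkolem X e.2.1 e.2.2) →
        ∀ (v : β → M) (xs : Fin n → M), (∀ b, v b ∈ X) → (∀ i, xs i ∈ X) →
          (φ.Realize v xs ↔ φ.Realize (fun b => π (v b)) (fun i => π (xs i))) := by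
  have hmem : ∀ {M : Type w} {X : Set M} {n : ℕ} (v : β → M) (xs : Fin n → M), (∀ b, v b ∈ X) →
      (∀ i, xs i ∈ X) → ∀ q, Sum.elim v xs q ∈ X := by
    intro M X n v xs hv hxs q
    cases q
    · exact hv _
    · exact hxs _
  have key : ∀ {M : Type w} {n : ℕ} (π : M → M) (v : β → M) (xs : Fin n → M) q,
      Sum.elim (fun b => π (v b)) (fun i => π (xs i)) q = π (Sum.elim v xs q) := by
    intro M n π v xs q
    cases q <;> rfl
  induction h with
  | falsum => exact ⟨[], fun _ _ _ _ _ _ _ _ _ _ => Iff.rfl⟩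
  | eq x y =>
    refine ⟨[], fun M _ X π hπ _ v xs hv hxs => ?_⟩
    simp only [BoundedFormula.realize_bdEqual, Term.realize_var, key]
    exact (hπ.injOn.eq_iff (hmem v xs hv hxs x) (hmem v xs hv hxs y)).symm
  | mem x y =>
    refine ⟨[], fun M _ X π hπ _ v xs hv hxs => ?_⟩
    simp only [realize_memFormula, key]
    exact (hπ.map_mem_iff (hmem v xs hv hxs y) (hmem v xs hv hxs x)).symm
  | imp _ _ ih₁ ih₂ =>
    obtain ⟨L₁, h₁⟩ := ih₁
    obtain ⟨L₂, h₂⟩ := ih₂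
    refine ⟨L₁ ++ L₂, fun M _ X π hπ hL v xs hv hxs => ?_⟩
    rw [BoundedFormula.realize_imp, BoundedFormula.realize_imp,
      h₁ M X π hπ (fun e he => hL e (List.mem_append_left _ he)) v xs hv hxs,
      h₂ M X π hπ (fun e he => hL e (List.mem_append_right _ he)) v xs hv hxs]
  | @ball n y φ _ ih =>
    obtain ⟨L, hL⟩ := ih
    refine ⟨⟨n, φ, y⟩ :: L, fun M _ X π hπ hL' v xs hv hxs => ?_⟩
    rw [realize_ball, realize_ball, key]
    have hX := hmem v xs hv hxs y
    have hφ : ∀ z ∈ X, (φ.Realize v (Fin.snoc xs z) ↔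
        φ.Realize (fun b => π (v b)) (Fin.snoc (fun i => π (xs i)) (π z))) := by
      intro z hz
      rw [hL M X π hπ (fun e he => hL' e (List.mem_cons_of_mem _ he)) v (Fin.snoc xs z) hv (by
        intro i
        refine Fin.lastCases ?_ (fun i => ?_) i
        · simpa using hz
        · simpa using hxs i)]
      have : (fun i => π ((Fin.snoc xs z : Fin (n + 1) → M) i)) =
          (Fin.snoc (fun i => π (xs i)) (π z) : Fin (n + 1) → M) := by
        funext i
        refine Fin.lastCases ?_ (fun i => ?_) i <;> simp
      rw [this]
    -- Elements of `π y` are images of elements of `y` in `X`, which settles one direction. For the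
    -- other, a counterexample in the universe has to be replaced by one in `X`; hence the new entry
    -- of the list.
    constructor
    · intro h z hz
      obtain ⟨w, hw, hwy, rfl⟩ := (hπ.mem_iff _ hX z).1 hz
      exact (hφ w hw).1 (h w hwy)
    · intro h
      by_contra hc
      push Not at hc
      obtain ⟨z, hz, h1, h2⟩ := hL' ⟨n, φ, y⟩ List.mem_cons_self v xs hv hxs hc
      exact h2 ((hφ z hz).2 (h _ ((hπ.map_mem_iff hX hz).2 h1)))

end Skolem

/-! ### Hulls and collapses in the universe of sets -/

/-- The closure of a set under a family of finitary functions. -/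
theorem exists_finitary_hull {N J : Type w} (f : J → List N → N) (S : Set N) :
    ∃ X : Set N, S ⊆ X ∧ (∀ j l, (∀ x ∈ l, x ∈ X) → f j l ∈ X) ∧
      Cardinal.mk X ≤ max Cardinal.aleph0 (Cardinal.mk S + Cardinal.mk J) := by
  -- Each `j` serves as a function symbol of every arity, so the hull is a generated substructure
  -- and inherits its cardinality bound.
  let L : FirstOrder.Language.{w, 0} := ⟨fun _ => J, fun _ => Empty⟩
  let _ : L.Structure N := ⟨fun j x => f j (List.ofFn x), fun r => r.elim⟩
  refine ⟨Substructure.closure L S, Substructure.subset_closure, fun j l hl => ?_, ?_⟩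
  · have := (Substructure.closure L S).fun_mem (n := l.length) (show L.Functions _ from j)
      (fun i => l.get i) (fun i => hl _ (l.get_mem i))
    have h2 : Structure.funMap (L := L) (M := N) (n := l.length) (show L.Functions _ from j)
        (fun i => l.get i) = f j l := by
      change f j (List.ofFn fun i => l.get i) = _
      simp
    rwa [h2] at this
  · have h1 := Substructure.lift_card_closure_le (L := L) (M := N) (s := S)
    simp only [Cardinal.lift_id] at h1
    refine h1.trans ?_
    have h2 : Cardinal.mk (Σ i, L.Functions i) = Cardinal.aleph0 * Cardinal.mk J := by
      have : Cardinal.mk (Σ _ : ℕ, J) = Cardinal.aleph0 * Cardinal.mk J := by simp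
      exact this
    rw [h2]
    refine max_le (le_max_left _ _) ?_
    refine Cardinal.add_le_of_le (le_max_left _ _) ?_ ?_
    · exact le_max_of_le_right (self_le_add_right _ _)
    · refine (Cardinal.mul_le_max _ _).trans ?_
      refine max_le (max_le (le_max_left _ _) ?_) (le_max_left _ _)
      exact le_max_of_le_right (self_le_add_left _ _)

/-- The collapse of `x` with respect to `X`: the set of the collapses of the elements of `x ∩ X`. -/
noncomputable def collapse (X : Set ZFSet.{u}) (x : ZFSet.{u}) : ZFSet.{u} :=
  ZFSet.range (fun z : {z // z ∈ x.sep (· ∈ X)} => collapse X z.1)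
termination_by x
decreasing_by exact (ZFSet.mem_sep.1 z.2).1

section Collapse

variable {X : Set ZFSet.{u}}

theorem mem_collapse {x z : ZFSet.{u}} : z ∈ collapse X x ↔ ∃ w ∈ X, w ∈ x ∧ z = collapse X w := by
  rw [collapse, ZFSet.mem_range]
  constructor
  · rintro ⟨⟨w, hw⟩, rfl⟩
    rw [ZFSet.mem_sep] at hw
    exact ⟨w, hw.2, hw.1, rfl⟩
  · rintro ⟨w, h1, h2, rfl⟩
    exact ⟨⟨w, ZFSet.mem_sep.2 ⟨h2, h1⟩⟩, rfl⟩

theorem collapse_mem_collapse {x w : ZFSet.{u}} (hw : w ∈ X) (h : w ∈ x) :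
    collapse X w ∈ collapse X x := mem_collapse.2 ⟨w, hw, h, rfl⟩

/-- Mostowski's argument: if `u ≠ v`, the hypothesis gives an element of `X` in exactly one of them.
Its collapse is also the collapse of an element of the other, and the induction hypothesis
identifies the two elements. -/
theorem isCollapseOn_collapse
    (hX : ∀ u ∈ X, ∀ v ∈ X, (∃ w, w ∈ u ∧ w ∉ v) → ∃ w ∈ X, w ∈ u ∧ w ∉ v) :
    IsCollapseOn (collapse X) X := by
  refine ⟨fun u _ z => mem_collapse, ?_⟩
  intro u
  induction u using ZFSet.inductionOn with
  | _ u ih =>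
  intro hu v hv huv
  by_contra hne
  have : (∃ w, w ∈ u ∧ w ∉ v) ∨ ∃ w, w ∈ v ∧ w ∉ u := by
    by_contra hc
    push Not at hc
    exact hne (ZFSet.ext fun z => ⟨hc.1 z, hc.2 z⟩)
  rcases this with h | h
  · obtain ⟨w, hw, h1, h2⟩ := hX u hu v hv h
    have := collapse_mem_collapse hw h1
    rw [huv, mem_collapse] at this
    obtain ⟨w', hw', h3, h4⟩ := this
    exact h2 (ih w h1 hw hw' h4 ▸ h3)
  · obtain ⟨w, hw, h1, h2⟩ := hX v hv u hu h
    have := collapse_mem_collapse hw h1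
    rw [← huv, mem_collapse] at this
    obtain ⟨w', hw', h3, h4⟩ := this
    exact h2 (ih w' h3 hw' hw h4.symm ▸ h3)

theorem collapse_eq_self {t : ZFSet.{u}} (ht : t.IsTransitive) (h : ∀ z ∈ t, z ∈ X) :
    ∀ x ∈ t, collapse X x = x := by
  intro x
  induction x using ZFSet.inductionOn with
  | _ x ih =>
  intro hx
  ext z
  rw [mem_collapse]
  constructor
  · rintro ⟨w, -, hw, rfl⟩
    rwa [ih w hw (ht.subset_of_mem hx hw)]
  · intro hz
    have := ht.subset_of_mem hx hz
    exact ⟨z, h z this, hz, (ih z hz this).symm⟩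

theorem collapse_range {ι : Type} [Small.{u} ι] (g : ι → ZFSet.{u}) (hg : ∀ i, g i ∈ X) :
    collapse X (ZFSet.range g) = ZFSet.range fun i => collapse X (g i) := by
  ext z
  simp only [mem_collapse, ZFSet.mem_range]
  constructor
  · rintro ⟨_, -, ⟨i, rfl⟩, rfl⟩
    exact ⟨i, rfl⟩
  · rintro ⟨i, rfl⟩
    exact ⟨g i, hg i, ⟨i, rfl⟩, rfl⟩

theorem collapse_upair {a b : ZFSet.{u}} (ha : a ∈ X) (hb : b ∈ X) :
    collapse X {a, b} = {collapse X a, collapse X b} := by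
  ext z
  simp only [mem_collapse, ZFSet.mem_pair]
  constructor
  · rintro ⟨w, -, rfl | rfl, rfl⟩ <;> simp
  · rintro (rfl | rfl)
    · exact ⟨a, ha, .inl rfl, rfl⟩
    · exact ⟨b, hb, .inr rfl, rfl⟩

theorem collapse_pair {a b : ZFSet.{u}} (ha : a ∈ X) (hb : b ∈ X) (h1 : ({a} : ZFSet.{u}) ∈ X)
    (h2 : ({a, b} : ZFSet.{u}) ∈ X) :
    collapse X (pair a b) = pair (collapse X a) (collapse X b) := by
  rw [pair, collapse_upair h1 h2, collapse_upair ha hb, ← ZFSet.pair_eq_singleton a,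
    collapse_upair ha ha, pair, ZFSet.pair_eq_singleton]

end Collapse

/-! ### Numerals and tuples as sets. -/

theorem numeral_eq_toZFSet (n : ℕ) : numeral.{u} n = (n : Ordinal.{u}).toZFSet := by
  induction n with
  | zero => simp [numeral]
  | succ n ih => rw [numeral, ih, Nat.cast_succ, Ordinal.toZFSet_add_one]

theorem numeral_injective : Function.Injective numeral.{u} := by
  intro m n h
  rw [numeral_eq_toZFSet, numeral_eq_toZFSet] at h
  exact_mod_cast Ordinal.toZFSet_injective h

theorem tuple_injective {n : ℕ} : Function.Injective (tuple.{u} (n := n)) := by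
  intro x y h
  funext i
  have : pair (numeral i) (x i) ∈ tuple y := by
    rw [← h]
    exact ZFSet.mem_range.2 ⟨i, rfl⟩
  obtain ⟨j, hj⟩ := ZFSet.mem_range.1 this
  obtain ⟨h1, h2⟩ := ZFSet.pair_inj.1 hj
  rw [← h2, Fin.ext (numeral_injective h1)]

end

/-! ### Hulls that reflect a structure. -/

section

open FirstOrder Language

/-- The closure properties of the set `X` that make its collapse reflect the structure `A`. -/
structure IsReflectingHull {τ : ZFSet.{u}} (A : RelStr τ) (μ : Ordinal.{u}) (X : Set ZFSet.{u}) :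
    Prop where
  vonNeumann_subset : ∀ x ∈ V_ μ, x ∈ X
  insert_mem : ∀ a ∈ X, ∀ b ∈ X, insert a b ∈ X
  ext : ∀ u ∈ X, ∀ v ∈ X, (∃ w, w ∈ u ∧ w ∉ v) → ∃ w ∈ X, w ∈ u ∧ w ∉ v
  -- Applied to pairs, tuples and the family of relations of `A`: their components then lie in `X`,
  -- so that collapsing commutes with forming them.
  mem_of_card_le : ∀ u ∈ X, Cardinal.mk {x // x ∈ u} ≤ Cardinal.mk {x // x ∈ V_ μ} → ∀ y ∈ u, y ∈ X
  skolem : ∀ (n : ℕ) (φ : (relLang τ).BoundedFormula Empty (n + 1)) (x : Fin n → A.Carrier)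
    (a : A.Carrier), (∀ i, (x i).1 ∈ X) → φ.Realize default (Fin.snoc x a) →
      ∃ b : A.Carrier, b.1 ∈ X ∧ φ.Realize default (Fin.snoc x b)

/-- A relation symbol amounts to an arity and an index in `V_μ`. As `V_μ` is infinite, it bounds the
number of symbols and hence of formulas, so adding Skolem functions for all of them keeps the hull
at size `|V_μ|`. -/
theorem card_relLang_formulas_le {τ : ZFSet.{u}} {μ : Ordinal.{u}} (hμ : Ordinal.omega0 ≤ μ)
    (hτ : ∀ i n, pair i n ∈ τ → i ∈ V_ μ) :
    Cardinal.mk (Σ n, (relLang τ).BoundedFormula Empty (n + 1)) ≤ Cardinal.mk {x // x ∈ V_ μ} ∧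
      Cardinal.aleph0 ≤ Cardinal.mk {x // x ∈ V_ μ} := by
  have hinf : Cardinal.aleph0 ≤ Cardinal.mk {x // x ∈ V_ μ} := by
    rw [Cardinal.aleph0_le_mk_iff]
    refine Infinite.of_injective (fun n : ℕ => (⟨numeral n, ?_⟩ : {x // x ∈ V_ μ})) ?_
    · rw [ZFSet.mem_vonNeumann, numeral_eq_toZFSet, Ordinal.rank_toZFSet]
      exact (Ordinal.natCast_lt_omega0 n).trans_le hμ
    · intro m n h
      exact numeral_injective (Subtype.ext_iff.1 h)
  refine ⟨?_, hinf⟩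
  have h1 : Cardinal.mk (Σ n, (relLang τ).BoundedFormula Empty (n + 1)) ≤
      Cardinal.mk (Σ n, (relLang τ).BoundedFormula Empty n) :=
    Cardinal.mk_le_of_injective (f := fun p => (⟨p.1 + 1, p.2⟩ : Σ n, _)) (by
      rintro ⟨m, φ⟩ ⟨n, ψ⟩ h
      simp only [Sigma.mk.injEq, Nat.add_right_cancel_iff] at h
      obtain ⟨rfl, h⟩ := h
      rw [eq_of_heq h])
  refine h1.trans (BoundedFormula.card_le.trans (max_le (by simpa using hinf) ?_))
  have h2 : (relLang τ).card ≤ Cardinal.aleph0 * Cardinal.mk {x // x ∈ V_ μ} := by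
    rw [FirstOrder.Language.card, FirstOrder.Language.Symbols, Cardinal.mk_sum]
    have e1 : Cardinal.mk (Σ l, (relLang τ).Functions l) = 0 := by
      rw [Cardinal.mk_eq_zero_iff]
      exact ⟨fun p => (p.2 : Empty).elim⟩
    have e2 : Cardinal.mk (Σ l, (relLang τ).Relations l) ≤
        Cardinal.aleph0 * Cardinal.mk {x // x ∈ V_ μ} := by
      rw [show Cardinal.aleph0 * Cardinal.mk {x // x ∈ V_ μ} =
        Cardinal.mk (ℕ × {x // x ∈ V_ μ}) by simp]
      refine Cardinal.mk_le_of_injective (f := fun p => (p.1, ⟨p.2.1, hτ _ _ p.2.2⟩)) ?_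
      rintro ⟨m, i, hi⟩ ⟨n, j, hj⟩ h
      simp only [Prod.mk.injEq, Subtype.mk.injEq] at h
      obtain ⟨rfl, rfl⟩ := h
      rfl
    rw [e1]
    simpa only [Cardinal.lift_zero, zero_add, Cardinal.lift_uzero] using e2
  have h3 : Cardinal.aleph0 * Cardinal.mk {x // x ∈ V_ μ} = Cardinal.mk {x // x ∈ V_ μ} :=
    Cardinal.aleph0_mul_eq hinf
  simpa using h2.trans h3.le

open Classical in
theorem exists_isReflectingHull {τ : ZFSet.{u}} (A : RelStr τ) {μ : Ordinal.{u}}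
    (hμ : Ordinal.omega0 ≤ μ) (hτ : ∀ i n, pair i n ∈ τ → i ∈ V_ μ) {β : Type} [Finite β]
    (L : List (Σ n, setLang.BoundedFormula β (n + 1) × (β ⊕ Fin n))) (S : Set ZFSet.{u})
    (hS : S.Finite) :
    ∃ X : Set ZFSet.{u}, S ⊆ X ∧ IsReflectingHull A μ X ∧
      (∀ e ∈ L, BoundedSkolem X e.2.1 e.2.2) ∧
      ∃ G : ZFSet.{u} → ZFSet.{u}, ∀ x, x ∈ X ↔ ∃ k ∈ V_ μ, G k = x := by
  obtain ⟨hJ, hinf⟩ := card_relLang_formulas_le hμ hτ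
  obtain ⟨K, ⟨eβ⟩⟩ := Finite.exists_equiv_fin β
  -- An injection of `u` into `V_μ` whenever `u` is small enough, and a constant map otherwise.
  let ιf : ∀ u : ZFSet.{u}, {x // x ∈ u} → {x // x ∈ V_ μ} := fun u =>
    if h : Cardinal.mk {x // x ∈ u} ≤ Cardinal.mk {x // x ∈ V_ μ} then
      ((Cardinal.le_def _ _).1 h).some else fun _ => ⟨∅, by
        rw [ZFSet.mem_vonNeumann, ZFSet.rank_empty]
        exact Ordinal.omega0_pos.trans_le hμ⟩
  -- The closing functions: `f₁` and `f₂` are Skolem functions for the formulas in `L` and for `A`;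
  -- `f₃ k` picks the element of a set with label `k` under `ιf`, so all labels together exhaust a
  -- small set; `f₄` inserts; `f₅` separates two sets. In `f₁` the first `K` list entries are the
  -- free variables and the others the bound ones; missing entries count as `∅`.
  let f₁ : Fin L.length → List ZFSet.{u} → ZFSet.{u} := fun j l =>
    let v : β → ZFSet.{u} := fun b => l.getD (eβ b) ∅
    let xs : Fin (L.get j).1 → ZFSet.{u} := fun i => l.getD (K + i) ∅
    epsilon fun z => Internal.Mem z (Sum.elim v xs (L.get j).2.2) ∧
      ¬ (L.get j).2.1.Realize v (Fin.snoc xs z)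
  let f₂ : (Σ n, (relLang τ).BoundedFormula Empty (n + 1)) → List ZFSet.{u} → ZFSet.{u} :=
    fun j l => epsilon fun z => ∃ b : A.Carrier, b.1 = z ∧ ∃ x : Fin j.1 → A.Carrier,
      l = List.ofFn (fun i => (x i).1) ∧ j.2.Realize default (Fin.snoc x b)
  let f₃ : {x // x ∈ V_ μ} → List ZFSet.{u} → ZFSet.{u} := fun k l =>
    epsilon fun z => ∃ h : z ∈ l.headD ∅, ιf _ ⟨z, h⟩ = k
  let f₄ : List ZFSet.{u} → ZFSet.{u} := fun l => insert (l.getD 0 ∅) (l.getD 1 ∅)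
  let f₅ : List ZFSet.{u} → ZFSet.{u} := fun l =>
    epsilon fun w => w ∈ l.getD 0 ∅ ∧ w ∉ l.getD 1 ∅
  let J := ULift.{u + 1} (Fin L.length) ⊕ (Σ n, (relLang τ).BoundedFormula Empty (n + 1)) ⊕
    {x // x ∈ V_ μ} ⊕ ULift.{u + 1} Bool
  let f : J → List ZFSet.{u} → ZFSet.{u} := Sum.elim (fun j => f₁ j.down) (Sum.elim f₂
    (Sum.elim f₃ (fun b => if b.down then f₄ else f₅)))
  obtain ⟨X, hSX, hf, hcard⟩ := exists_finitary_hull f (S ∪ {x | x ∈ V_ μ})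
  have hf₁ := fun j => hf (.inl ⟨j⟩)
  have hf₂ := fun j => hf (.inr (.inl j))
  have hf₃ := fun j => hf (.inr (.inr (.inl j)))
  have hf₄ := hf (.inr (.inr (.inr ⟨true⟩)))
  have hf₅ := hf (.inr (.inr (.inr ⟨false⟩)))
  simp only [f, Sum.elim_inl, Sum.elim_inr, if_true, Bool.false_eq_true, if_false]
    at hf₁ hf₂ hf₃ hf₄ hf₅
  have hXcard : Cardinal.mk X ≤ Cardinal.mk {x // x ∈ V_ μ} := by
    refine hcard.trans (max_le hinf (Cardinal.add_le_of_le hinf ?_ ?_))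
    · refine (Cardinal.mk_union_le _ _).trans (Cardinal.add_le_of_le hinf ?_ le_rfl)
      exact (Cardinal.lt_aleph0_iff_set_finite.2 hS).le.trans hinf
    · simp only [J, Cardinal.mk_sum, Cardinal.lift_id, Cardinal.mk_uLift]
      refine Cardinal.add_le_of_le hinf ?_ (Cardinal.add_le_of_le hinf hJ
        (Cardinal.add_le_of_le hinf le_rfl ?_))
      · refine le_trans ?_ hinf
        simp
      · refine le_trans ?_ hinf
        simp
  have hVX : ∀ x ∈ V_ μ, x ∈ X := fun x hx => hSX (.inr hx)
  refine ⟨X, fun x hx => hSX (.inl hx), ⟨hVX, ?_, ?_, ?_, ?_⟩, ?_, ?_⟩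
  · intro a ha b hb
    exact hf₄ [a, b] (by simp [ha, hb])
  · intro a ha b hb h
    exact ⟨_, hf₅ [a, b] (by simp [ha, hb]), epsilon_spec h⟩
  · intro a ha hle y hy
    obtain ⟨h1, h2⟩ := epsilon_spec (p := fun z => ∃ h : z ∈ a, ιf a ⟨z, h⟩ = ιf a ⟨y, hy⟩)
      ⟨y, hy, rfl⟩
    have hinj : Function.Injective (ιf a) := by
      simp only [ιf, dif_pos hle]
      exact ((Cardinal.le_def _ _).1 hle).some.injective
    have h3 : (epsilon fun z => ∃ h : z ∈ a, ιf a ⟨z, h⟩ = ιf a ⟨y, hy⟩) = y :=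
      Subtype.ext_iff.1 (hinj h2)
    rw [← h3]
    exact hf₃ (ιf a ⟨y, hy⟩) [a] (by simp [ha])
  · intro n φ x a hx ha
    have := hf₂ ⟨n, φ⟩ (List.ofFn (fun i => (x i).1)) (by
      intro y hy
      rw [List.mem_ofFn] at hy
      obtain ⟨i, rfl⟩ := hy
      exact hx i)
    obtain ⟨b, hb, x', h1, h2⟩ := epsilon_spec (p := fun z => ∃ b : A.Carrier, b.1 = z ∧
      ∃ x' : Fin n → A.Carrier, List.ofFn (fun i => (x i).1) = List.ofFn (fun i => (x' i).1) ∧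
        φ.Realize default (Fin.snoc x' b)) ⟨a.1, a, rfl, x, rfl, ha⟩
    have hxx : x = x' := by
      funext i
      exact Subtype.ext (congrFun (List.ofFn_injective h1) i)
    subst hxx
    exact ⟨b, hb ▸ this, h2⟩
  · intro e he
    obtain ⟨j, hj, rfl⟩ := List.mem_iff_getElem.1 he
    intro v xs hv hxs hex
    have := hf₁ ⟨j, hj⟩ (List.ofFn (fun i => v (eβ.symm i)) ++ List.ofFn xs) (by
      intro y hy
      rw [List.mem_append, List.mem_ofFn, List.mem_ofFn] at hy
      rcases hy with ⟨i, rfl⟩ | ⟨i, rfl⟩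
      · exact hv _
      · exact hxs _)
    have e1 : (fun b => (List.ofFn (fun i => v (eβ.symm i)) ++ List.ofFn xs).getD (eβ b) ∅) = v := by
      funext b
      rw [List.getD_append _ _ _ _ (by simp)]
      simp
    have e2 : (fun i : Fin L[j].1 =>
        (List.ofFn (fun i => v (eβ.symm i)) ++ List.ofFn xs).getD (K + i) ∅) = xs := by
      funext i
      rw [List.getD_append_right _ _ _ _ (by simp)]
      simp
    change epsilon (fun z => Internal.Mem z (Sum.elim
      (fun b => (List.ofFn (fun i => v (eβ.symm i)) ++ List.ofFn xs).getD (eβ b) ∅)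
      (fun i : Fin L[j].1 => (List.ofFn (fun i => v (eβ.symm i)) ++ List.ofFn xs).getD (K + i) ∅)
      L[j].2.2) ∧ ¬ L[j].2.1.Realize
      (fun b => (List.ofFn (fun i => v (eβ.symm i)) ++ List.ofFn xs).getD (eβ b) ∅) (Fin.snoc
      (fun i : Fin L[j].1 => (List.ofFn (fun i => v (eβ.symm i)) ++ List.ofFn xs).getD (K + i) ∅)
      z)) ∈ X at this
    rw [e1, e2] at this
    exact ⟨_, this, epsilon_spec hex⟩
  · have hne : Nonempty {x // x ∈ X} :=
      ⟨⟨∅, hVX ∅ (by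
        rw [ZFSet.mem_vonNeumann, ZFSet.rank_empty]
        exact Ordinal.omega0_pos.trans_le hμ)⟩⟩
    obtain ⟨ι⟩ := (Cardinal.le_def _ _).1 hXcard
    let g : {x // x ∈ V_ μ} → {x // x ∈ X} := Function.invFun ι
    have hg : Function.Surjective g := Function.invFun_surjective ι.injective
    refine ⟨fun k => if h : k ∈ V_ μ then (g ⟨k, h⟩).1 else ∅, fun x => ⟨fun hx => ?_, ?_⟩⟩
    · obtain ⟨k, hk⟩ := hg ⟨x, hx⟩
      exact ⟨k.1, k.2, (dif_pos k.2).trans (congrArg Subtype.val hk)⟩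
    · rintro ⟨k, hk, rfl⟩
      simp only [dif_pos hk]
      exact (g ⟨k, hk⟩).2

end

/-! ### Collapsing a reflecting hull, and the equivalence in `V`. -/

section

open FirstOrder Language

namespace IsReflectingHull

variable {τ : ZFSet.{u}} {A : RelStr τ} {μ : Ordinal.{u}} {X : Set ZFSet.{u}}

theorem isCollapseOn (h : IsReflectingHull A μ X) : IsCollapseOn (collapse X) X :=
  isCollapseOn_collapse h.ext

theorem collapse_of_mem (h : IsReflectingHull A μ X) {x : ZFSet.{u}} (hx : x ∈ V_ μ) :
    collapse X x = x :=
  collapse_eq_self (ZFSet.isTransitive_vonNeumann μ) h.vonNeumann_subset x hx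

theorem numeral_mem_vonNeumann (hμ : Ordinal.omega0 ≤ μ) (n : ℕ) : numeral n ∈ V_ μ := by
  rw [ZFSet.mem_vonNeumann, numeral_eq_toZFSet, Ordinal.rank_toZFSet]
  exact (Ordinal.natCast_lt_omega0 n).trans_le hμ

theorem aleph0_le (hμ : Ordinal.omega0 ≤ μ) : Cardinal.aleph0 ≤ Cardinal.mk {x // x ∈ V_ μ} := by
  rw [Cardinal.aleph0_le_mk_iff]
  refine Infinite.of_injective (fun n : ℕ =>
    (⟨numeral n, numeral_mem_vonNeumann hμ n⟩ : {x // x ∈ V_ μ})) ?_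
  intro m n h
  exact numeral_injective (Subtype.ext_iff.1 h)

theorem empty_mem (hμ : Ordinal.omega0 ≤ μ)
    (h : IsReflectingHull A μ X) : ∅ ∈ X :=
  h.vonNeumann_subset _ (numeral_mem_vonNeumann hμ 0)

theorem range_mem (hμ : Ordinal.omega0 ≤ μ)
    (h : IsReflectingHull A μ X) {n : ℕ} (g : Fin n → ZFSet.{u})
    (hg : ∀ i, g i ∈ X) : ZFSet.range g ∈ X := by
  induction n with
  | zero =>
    have : ZFSet.range g = ∅ := by
      rw [ZFSet.eq_empty]
      simp
    rw [this]
    exact h.empty_mem hμ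
  | succ n ih =>
    have : ZFSet.range g = insert (g 0) (ZFSet.range fun i : Fin n => g i.succ) := by
      ext z
      simp [Fin.exists_fin_succ, eq_comm]
    rw [this]
    exact h.insert_mem _ (hg 0) _ (ih _ fun i => hg _)

theorem mem_of_mem_range (hμ : Ordinal.omega0 ≤ μ)
    (h : IsReflectingHull A μ X) {n : ℕ} {g : Fin n → ZFSet.{u}}
    (hg : ZFSet.range g ∈ X) (i : Fin n) : g i ∈ X := by
  refine h.mem_of_card_le _ hg ?_ _ (ZFSet.mem_range.2 ⟨i, rfl⟩)
  refine le_trans ?_ (aleph0_le hμ)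
  rw [Cardinal.mk_le_aleph0_iff]
  refine (Set.countable_range g).mono ?_
  intro z hz
  exact ZFSet.mem_range.1 hz

theorem upair_mem_iff (hμ : Ordinal.omega0 ≤ μ)
    (h : IsReflectingHull A μ X) {a b : ZFSet.{u}} :
    ({a, b} : ZFSet.{u}) ∈ X ↔ a ∈ X ∧ b ∈ X := by
  have e : ({a, b} : ZFSet.{u}) = ZFSet.range ![a, b] := by
    ext z
    simp [Fin.exists_fin_two, eq_comm]
  rw [e]
  refine ⟨fun hab => ⟨?_, ?_⟩, fun hab => h.range_mem hμ _ (by simp [Fin.forall_fin_two, hab])⟩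
  · simpa using h.mem_of_mem_range hμ hab 0
  · simpa using h.mem_of_mem_range hμ hab 1

theorem pair_mem_iff (hμ : Ordinal.omega0 ≤ μ)
    (h : IsReflectingHull A μ X) {a b : ZFSet.{u}} :
    pair a b ∈ X ↔ a ∈ X ∧ b ∈ X := by
  rw [pair, h.upair_mem_iff hμ, h.upair_mem_iff hμ, ← ZFSet.pair_eq_singleton, h.upair_mem_iff hμ]
  tauto

theorem collapse_pair (hμ : Ordinal.omega0 ≤ μ)
    (h : IsReflectingHull A μ X) {a b : ZFSet.{u}} (ha : a ∈ X) (hb : b ∈ X) :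
    collapse X (pair a b) = pair (collapse X a) (collapse X b) := by
  refine _root_.collapse_pair ha hb ?_ ((h.upair_mem_iff hμ).2 ⟨ha, hb⟩)
  rw [← ZFSet.pair_eq_singleton]
  exact (h.upair_mem_iff hμ).2 ⟨ha, ha⟩

theorem tuple_mem_iff (hμ : Ordinal.omega0 ≤ μ)
    (h : IsReflectingHull A μ X) {n : ℕ} {x : Fin n → ZFSet.{u}} :
    tuple x ∈ X ↔ ∀ i, x i ∈ X := by
  constructor
  · intro hx i
    exact ((h.pair_mem_iff hμ).1 (h.mem_of_mem_range hμ hx i)).2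
  · intro hx
    exact h.range_mem hμ _ fun i => (h.pair_mem_iff hμ).2
      ⟨h.vonNeumann_subset _ (numeral_mem_vonNeumann hμ i), hx i⟩

theorem collapse_tuple (hμ : Ordinal.omega0 ≤ μ)
    (h : IsReflectingHull A μ X) {n : ℕ} {x : Fin n → ZFSet.{u}}
    (hx : ∀ i, x i ∈ X) : collapse X (tuple x) = tuple fun i => collapse X (x i) := by
  have hn : ∀ i : Fin n, numeral (i : ℕ) ∈ X := fun i =>
    h.vonNeumann_subset _ (numeral_mem_vonNeumann hμ i)
  rw [tuple, collapse_range _ fun i => (h.pair_mem_iff hμ).2 ⟨hn i, hx i⟩, tuple]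
  congr 1
  funext i
  rw [h.collapse_pair hμ (hn i) (hx i), h.collapse_of_mem (numeral_mem_vonNeumann hμ i)]

/-- A structure whose code is the collapse of the code of `A` embeds elementarily into `A`. -/
theorem nonempty_elementaryEmbedding (hμ : Ordinal.omega0 ≤ μ)
    (h : IsReflectingHull A μ X)
    (hτ : ∀ i n, pair i n ∈ τ → i ∈ V_ μ) (hA : A.code ∈ X) (B : RelStr τ)
    (hB : B.code = collapse X A.code) : Nonempty (B.Carrier ↪ₑ[relLang τ] A.Carrier) := by
  obtain ⟨hA1, hA2⟩ := (h.pair_mem_iff hμ).1 hA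
  rw [RelStr.code, RelStr.code, h.collapse_pair hμ hA1 hA2, ZFSet.pair_inj] at hB
  obtain ⟨hB1, hB2⟩ := hB
  have hinj := h.isCollapseOn.injOn
  -- `A.rel` has one element per index and all indices lie in `V_μ`, so it is small enough to be a
  -- subset of `X`.
  have hrel : ∀ z ∈ A.rel, z ∈ X := by
    refine h.mem_of_card_le _ hA2 ?_
    choose i n R h1 h2 using A.rel_dom
    refine Cardinal.mk_le_of_injective
      (f := fun z => (⟨i z.1 z.2, hτ _ _ (h1 z.1 z.2)⟩ : {x // x ∈ V_ μ})) ?_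
    rintro ⟨z, hz⟩ ⟨z', hz'⟩ hzz
    simp only [Subtype.mk.injEq] at hzz
    obtain ⟨Y, -, hY⟩ := A.rel_fun _ _ (h1 z hz)
    have e1 := hY (R z hz) (by simpa only [← h2 z hz] using hz)
    have e2 := hY (R z' hz') (by
      simp only [hzz]
      simpa only [← h2 z' hz'] using hz')
    refine Subtype.ext ?_
    change z = z'
    rw [h2 z hz, h2 z' hz', hzz, e1, e2]
  have hBX : ∀ b : B.Carrier, ∃ w ∈ X, w ∈ A.carrier ∧ b.1 = collapse X w := fun b =>
    mem_collapse.1 (by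
      rw [← hB1]
      exact b.2)
  choose ρ hρX hρ hρB using hBX
  let f : B.Carrier → A.Carrier := fun b => ⟨ρ b, hρ b⟩
  -- Indices are fixed by the collapse, so `⟨i, R⟩` goes to `⟨i, collapse X R⟩`, and tuples collapse
  -- coordinatewise; injectivity on `X` recovers the original tuple from its collapse.
  have hBrel : ∀ (n : ℕ) (i : (relLang τ).Relations n) (x : Fin n → B.Carrier),
      Structure.RelMap i (f ∘ x) ↔ Structure.RelMap i x := by
    intro n i x
    have hρ' : ∀ R, tuple (fun k => ρ (x k)) ∈ R →
        tuple (fun k => (x k).1) ∈ collapse X R := by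
      intro R hR
      refine mem_collapse.2 ⟨_, (h.tuple_mem_iff hμ).2 fun k => hρX (x k), hR, ?_⟩
      rw [h.collapse_tuple hμ fun k => hρX (x k)]
      congr 1
      funext k
      exact hρB (x k)
    constructor
    · rintro ⟨R, hR, hx⟩
      obtain ⟨hi, hRX⟩ := (h.pair_mem_iff hμ).1 (hrel _ hR)
      refine ⟨collapse X R, ?_, hρ' R hx⟩
      rw [hB2, mem_collapse]
      exact ⟨_, hrel _ hR, hR, by rw [h.collapse_pair hμ hi hRX, h.collapse_of_mem (hτ _ _ i.2)]⟩
    · rintro ⟨R, hR, hx⟩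
      rw [hB2, mem_collapse] at hR
      obtain ⟨w, hwX, hw, hRw⟩ := hR
      obtain ⟨i', n', R', h1, rfl⟩ := A.rel_dom w hw
      obtain ⟨hi, hRX⟩ := (h.pair_mem_iff hμ).1 hwX
      rw [h.collapse_pair hμ hi hRX, ZFSet.pair_inj, h.collapse_of_mem (hτ _ _ h1)] at hRw
      obtain ⟨rfl, rfl⟩ := hRw
      refine ⟨R', hw, ?_⟩
      obtain ⟨t, htX, htR, ht⟩ := mem_collapse.1 hx
      obtain ⟨y, hy, rfl⟩ := A.rel_sub _ _ _ i.2 hw t htR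
      have hyX := (h.tuple_mem_iff hμ).1 htX
      rw [h.collapse_tuple hμ hyX] at ht
      have hxy : (fun k => ρ (x k)) = y := by
        funext k
        refine hinj (hρX _) (hyX k) ?_
        rw [← hρB]
        exact congrFun (tuple_injective ht) k
      change tuple (fun k => ρ (x k)) ∈ R'
      rwa [hxy]
  let e : B.Carrier ↪[relLang τ] A.Carrier :=
    { toFun := f
      inj' := fun a b hab => by
        have : ρ a = ρ b := congrArg Subtype.val hab
        exact Subtype.ext (by rw [hρB a, hρB b, this])
      map_fun' := fun g => (g : Empty).elim
      map_rel' := fun i x => hBrel _ i x }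
  -- Tarski–Vaught test: Skolem closure moves a witness into `X`, where it is the image of its own
  -- collapse.
  refine ⟨e.toElementaryEmbedding fun n φ x a ha => ?_⟩
  obtain ⟨b, hbX, hb⟩ := h.skolem n φ (e ∘ x) a (fun i => hρX _) ha
  have hbB : collapse X b.1 ∈ B.carrier := by
    rw [hB1]
    exact collapse_mem_collapse hbX b.2
  refine ⟨⟨_, hbB⟩, ?_⟩
  have : e ⟨_, hbB⟩ = b := Subtype.ext (hinj (hρX _) hbX (hρB ⟨_, hbB⟩).symm)
  rwa [this]

end IsReflectingHull

/-- The reflecting structure is the collapse of `A` along a hull of size `|V_μ|` for some `μ < α`.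
Elementarity enters twice: to bound the index set of the type and to place the collapse in `V_α`. -/
theorem witnessesSR_of_mem_classCOne {α : Ordinal.{u}} (hα : α ∈ classCOne) :
    WitnessesSR (fun _ φ => IsSigmaOne φ) α := by
  have he : SigmaOneElementary α := hα.2
  intro k φ hφ p hp τ hτ hC A hA
  obtain ⟨m, ψ, hψ, hφψ⟩ := hφ.exists_normalForm.{u + 1}
  have hφψ' : ∀ x, φ.Realize (Fin.cons x p : Fin (k + 1) → ZFSet.{u}) ↔ ∃ ys : Fin m → ZFSet.{u},
      ψ.Realize (Sum.elim (Sum.elim (Fin.cons x p : Fin (k + 1) → ZFSet.{u}) default) ys) :=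
    fun x => (realize_congr_of_eq fun _ => rfl).trans (hφψ ZFSet.{u} (Fin.cons x p) default)
  have h0 : SigmaZeroPred (fun v : (Fin (k + 1) ⊕ Fin 0) ⊕ Fin m → ZFSet.{u} => ψ.Realize v) :=
    ⟨ψ, hψ, fun _ => Iff.rfl⟩
  -- some structure in the class lies in `V_α`, which bounds the index set of the type
  have hB₀ : ∃ x ∈ V_ α, φ.Realize (Fin.cons x p : Fin (k + 1) → ZFSet.{u}) := by
    have key : ∀ ys : Fin (m + 1) → ZFSet.{u},
        ψ.Realize (fun q => (Sum.elim p ys) (Sum.elim (Sum.elim (Fin.cons (α := fun _ =>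
          Fin k ⊕ Fin (m + 1)) (.inr 0) fun i => .inl i) Fin.elim0) (fun j => .inr j.succ) q)) ↔
        ψ.Realize (Sum.elim (Sum.elim (Fin.cons (ys 0) p : Fin (k + 1) → ZFSet.{u}) default)
          fun j => ys j.succ) := by
      intro ys
      refine realize_congr_of_eq fun q => ?_
      rcases q with (i | i) | j
      · refine Fin.cases ?_ (fun i => ?_) i <;> simp
      · exact i.elim0
      · rfl
    obtain ⟨ys, h1, h2⟩ := he.exists_mem (SigmaZeroPred.rename
      (fun v : (Fin (k + 1) ⊕ Fin 0) ⊕ Fin m → ZFSet.{u} => ψ.Realize v)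
      (Sum.elim (Sum.elim (Fin.cons (α := fun _ => Fin k ⊕ Fin (m + 1)) (.inr 0)
        fun i => .inl i) Fin.elim0) (fun j => .inr j.succ))) hp (by
        obtain ⟨ys, hys⟩ := (hφψ' _).1 hA
        exact ⟨Fin.cons A.code ys, (key _).2 (by simpa using hys)⟩)
    exact ⟨ys 0, h1 0, (hφψ' _).2 ⟨_, (key ys).1 h2⟩⟩
  obtain ⟨x₀, hx₀, hφ₀⟩ := hB₀
  obtain ⟨B₀, rfl⟩ := hC x₀ hφ₀
  have hμ : ∃ μ < α, Ordinal.omega0 ≤ μ ∧ B₀.code.rank ≤ μ ∧ ∀ i, p i ∈ V_ μ := by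
    have : Nonempty (Set.Iio α) := ⟨⟨Ordinal.omega0, he.omega0_lt⟩⟩
    obtain ⟨⟨μ₀, hμ₀⟩, h1⟩ := Finite.exists_le (fun i => (⟨Order.succ (p i).rank,
      he.isSuccPrelimit (ZFSet.mem_vonNeumann.1 (hp i))⟩ : Set.Iio α))
    refine ⟨max (max Ordinal.omega0 B₀.code.rank) μ₀, max_lt (max_lt he.omega0_lt
      (ZFSet.mem_vonNeumann.1 hx₀)) hμ₀, le_max_of_le_left (le_max_left _ _),
      le_max_of_le_left (le_max_right _ _), fun i => ?_⟩
    rw [ZFSet.mem_vonNeumann]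
    exact lt_max_of_lt_right (Order.succ_le_iff.1 (Subtype.mk_le_mk.1 (h1 i)))
  obtain ⟨μ, hμα, hωμ, hB₀μ, hpμ⟩ := hμ
  -- The type `τ` is not given as an element of `V_α`; its indices are the first components of
  -- members of `B₀.rel`, and so have rank below that of `B₀`.
  have hτμ : ∀ i n, pair i n ∈ τ → i ∈ V_ μ := by
    intro i n hin
    obtain ⟨R, hR, -⟩ := B₀.rel_fun i n hin
    rw [ZFSet.mem_vonNeumann]
    refine lt_of_lt_of_le ?_ hB₀μ
    refine (ZFSet.rank_lt_of_mem (y := i) (x := {i}) (by simp)).trans ?_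
    refine (ZFSet.rank_lt_of_mem (x := pair i R) (by simp [pair])).trans ?_
    refine (ZFSet.rank_lt_of_mem hR).trans ?_
    refine (ZFSet.rank_lt_of_mem (x := {B₀.carrier, B₀.rel}) (by simp)).trans ?_
    exact ZFSet.rank_lt_of_mem (by simp [RelStr.code, pair])
  obtain ⟨ys, hys⟩ := (hφψ' _).1 hA
  obtain ⟨L, hL⟩ := hψ.exists_skolem.{u + 1}
  obtain ⟨X, hSX, hX, hLX, G, hG⟩ := exists_isReflectingHull A hωμ hτμ L
    (insert A.code (Set.range ys)) ((Set.finite_range ys).insert _)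
  have hAX : A.code ∈ X := hSX (Set.mem_insert _ _)
  have hysX : ∀ j, ys j ∈ X := fun j => hSX (Set.mem_insert_of_mem _ ⟨j, rfl⟩)
  have hpX : ∀ i, p i ∈ X := fun i => hX.vonNeumann_subset _ (hpμ i)
  have hφB : φ.Realize (Fin.cons (collapse X A.code) p : Fin (k + 1) → ZFSet.{u}) := by
    rw [hφψ']
    refine ⟨fun j => collapse X (ys j), ?_⟩
    have := (hL ZFSet.{u} X (collapse X) hX.isCollapseOn hLX
      (Sum.elim (Sum.elim (Fin.cons A.code p : Fin (k + 1) → ZFSet.{u}) default) ys) default (fun q => by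
      rcases q with (i | i) | j
      · refine Fin.cases ?_ (fun i => ?_) i
        · exact hAX
        · exact hpX i
      · exact i.elim0
      · exact hysX j) (fun i => i.elim0)).1
      ((realize_congr_of_eq fun _ => rfl).1 hys)
    refine (realize_congr_of_eq fun q => ?_).1 this
    rcases q with (i | i) | j
    · refine Fin.cases ?_ (fun i => ?_) i
      · rfl
      · exact hX.collapse_of_mem (hpμ i)
    · exact i.elim0
    · rfl
  obtain ⟨B, hB⟩ := hC _ hφB
  refine ⟨B, by rw [hB]; exact hφB, ?_, hX.nonempty_elementaryEmbedding hωμ hτμ hAX B hB⟩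
  -- The elements of `X` may have arbitrarily large rank, but pulled back along `G` membership is a
  -- relation on `V_μ`, and its collapse is `collapse X ∘ G`.
  obtain ⟨t, ht, hGt⟩ := he.exists_collapse_mem hμα (fun l k => G l ∈ G k)
    (fun k => collapse X (G k)) (by
      intro k hk z
      rw [mem_collapse]
      constructor
      · rintro ⟨w, hw, h1, rfl⟩
        obtain ⟨l, hl, rfl⟩ := (hG w).1 hw
        exact ⟨l, hl, h1, rfl⟩
      · rintro ⟨l, hl, h1, rfl⟩
        exact ⟨G l, (hG _).2 ⟨l, hl, rfl⟩, h1, rfl⟩)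
  obtain ⟨l, hl, hlA⟩ := (hG _).1 hAX
  rw [hB, ← hlA]
  exact (ZFSet.isTransitive_vonNeumann α).subset_of_mem ht (hGt l hl)

/-- `Σ₀`-SR and `Σ₁`-SR are witnessed exactly by the elements of `C^(1)`. -/
theorem witnessesSR_tfae (α : Ordinal.{u}) :
    List.TFAE
      [WitnessesSR (fun _ φ => IsSigmaZero φ) α,
       WitnessesSR (fun _ φ => IsSigmaOne φ) α,
       α ∈ classCOne] := by
  tfae_have 2 → 1 := fun h k φ hφ => h k φ (.of_sigmaZero hφ)
  tfae_have 1 → 3 := fun h => (WitnessesSR.sigmaOneElementary h).mem_classCOne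
  tfae_have 3 → 2 := witnessesSR_of_mem_classCOne
  tfae_finish

end

section

open FirstOrder Language

/-! ### Definable predicates and functions on a `{∈}`-structure -/

namespace Internal

local infix:50 " ε " => Mem

variable {M : Type v} [setLang.Structure M]

/-- The predicate `P` is definable with parameters. -/
class Dfn {Γ : Type} (P : (Γ → M) → Prop) : Prop where
  out : (Set.univ : Set M).Definable setLang {v | P v}

/-- The function `t` is definable with parameters. -/
class DF {Γ : Type} (t : (Γ → M) → M) : Prop where
  out : Dfn (fun v : Option Γ → M => v none = t (fun i => v (some i)))

namespace Dfn

variable {Γ : Type} {P Q : (Γ → M) → Prop}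

theorem congr (h : ∀ v, P v ↔ Q v) [hP : Dfn P] : Dfn Q :=
  ⟨by convert hP.out using 3; exact (h _).symm⟩

instance not [hP : Dfn P] : Dfn (fun v => ¬ P v) := ⟨hP.out.compl⟩

instance and [hP : Dfn P] [hQ : Dfn Q] : Dfn (fun v => P v ∧ Q v) := ⟨hP.out.inter hQ.out⟩

instance or [hP : Dfn P] [hQ : Dfn Q] : Dfn (fun v => P v ∨ Q v) := ⟨hP.out.union hQ.out⟩

instance imp [Dfn P] [Dfn Q] : Dfn (fun v => P v → Q v) :=
  congr (P := fun v => ¬ P v ∨ Q v) fun _ => by tauto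

instance iff [Dfn P] [Dfn Q] : Dfn (fun v => P v ↔ Q v) :=
  congr (P := fun v => (P v → Q v) ∧ (Q v → P v)) fun _ => by tauto

instance const (p : Prop) : Dfn (fun _ : Γ → M => p) := by
  by_cases hp : p
  · exact ⟨by simp [hp]⟩
  · exact ⟨by simp [hp]⟩

theorem rename {Δ : Type} {P : (Δ → M) → Prop} (hP : Dfn P) (g : Δ → Γ) :
    Dfn (fun v : Γ → M => P (fun i => v (g i))) :=
  ⟨hP.out.preimage_comp g⟩

theorem exs {Δ : Type} [Finite Γ] [Finite Δ] {P : (Γ ⊕ Δ → M) → Prop} (hP : Dfn P) :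
    Dfn (fun v : Γ → M => ∃ x : Δ → M, P (Sum.elim v x)) := by
  refine ⟨?_⟩
  convert hP.out.image_comp (Sum.inl : Γ → Γ ⊕ Δ) using 1
  ext v
  constructor
  · rintro ⟨x, hx⟩
    exact ⟨_, hx, rfl⟩
  · rintro ⟨y, hy, rfl⟩
    refine ⟨y ∘ Sum.inr, ?_⟩
    rw [Sum.elim_comp_inl_inr]
    exact hy

instance ex [Finite Γ] {P : (Γ → M) → M → Prop}
    [hP : Dfn (fun v : Option Γ → M => P (fun i => v (some i)) (v none))] :
    Dfn (fun v : Γ → M => ∃ x, P v x) := by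
  have := exs (Γ := Γ) (Δ := Unit) (hP.rename (fun o : Option Γ => o.elim (.inr ()) .inl))
  refine this.congr fun v => ?_
  constructor
  · rintro ⟨x, hx⟩
    exact ⟨x (), hx⟩
  · rintro ⟨x, hx⟩
    exact ⟨fun _ => x, hx⟩

instance all [Finite Γ] {P : (Γ → M) → M → Prop}
    [hP : Dfn (fun v : Option Γ → M => P (fun i => v (some i)) (v none))] :
    Dfn (fun v : Γ → M => ∀ x, P v x) :=
  congr (P := fun v => ¬ ∃ x, ¬ P v x) fun v => by push Not; rfl

theorem realizeFormula {Δ : Type} (φ : setLang.Formula Δ) : Dfn (fun v : Δ → M => φ.Realize v) :=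
  ⟨(Set.empty_definable_iff.2 ⟨φ, rfl⟩).mono (Set.empty_subset _)⟩

theorem eq_var (i j : Γ) : Dfn (fun v : Γ → M => v i = v j) :=
  (realizeFormula ((Term.var i).equal (Term.var j))).congr fun v => by simp

theorem mem_var (i j : Γ) : Dfn (fun v : Γ → M => v i ε v j) :=
  (realizeFormula (memFormula (.inl i) (.inl j))).congr fun v => by
    rw [Formula.Realize, realize_memFormula]
    rfl

theorem eq_const (i : Γ) (c : M) : Dfn (fun v : Γ → M => v i = c) := by
  have h : Dfn (fun v : Unit → M => v () = c) := ⟨by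
    refine ⟨((Term.var ()).equal (Constants.term
      (setLang.con (⟨c, trivial⟩ : (Set.univ : Set M))))), ?_⟩
    ext v
    simp⟩
  exact h.rename fun _ => i

end Dfn

namespace DF

variable {Γ : Type}

instance var (i : Γ) : DF (fun v : Γ → M => v i) := ⟨Dfn.eq_var _ _⟩

instance const (c : M) : DF (fun _ : Γ → M => c) := ⟨Dfn.eq_const _ _⟩

instance (priority := low) rename {Δ : Type} {t : (Δ → M) → M} [ht : DF t] (g : Δ → Γ) :
    DF (fun v : Γ → M => t (fun i => v (g i))) :=
  ⟨ht.out.rename (Option.map g)⟩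

theorem eq_iff {t : (Γ → M) → M} (ht : DF t) {Δ : Type} (g : Γ → Δ) (j : Δ) :
    Dfn (fun v : Δ → M => v j = t (fun i => v (g i))) :=
  ht.out.rename (fun o : Option Γ => o.elim j g)

end DF

namespace Dfn

variable {Γ : Type}

/-- Substitution of definable functions into a definable predicate. -/
theorem subst [Finite Γ] {Δ : Type} [Finite Δ] {P : (Δ → M) → Prop} (hP : Dfn P)
    {t : Δ → (Γ → M) → M} (ht : ∀ i, DF (t i)) : Dfn (fun v : Γ → M => P (fun i => t i v)) := by
  -- `P (t v)` is expressed as `∃ x, x = t v ∧ P x`.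
  have h1 : Dfn (fun v : Γ ⊕ Δ → M => (∀ i, v (.inr i) = t i (fun j => v (.inl j))) ∧
      P (fun i => v (.inr i))) := by
    have h2 : Dfn (fun v : Γ ⊕ Δ → M => ∀ i, v (.inr i) = t i (fun j => v (.inl j))) := by
      refine ⟨?_⟩
      convert Set.definable_iInter_of_finite
        (fun i => ((ht i).eq_iff (Sum.inl : Γ → Γ ⊕ Δ) (.inr i)).out) using 1
      ext v
      simp
    have := hP.rename (Sum.inr : Δ → Γ ⊕ Δ)
    infer_instance
  refine h1.exs.congr fun v => ?_
  constructor
  · rintro ⟨x, hx, h⟩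
    simp only [Sum.elim_inr, Sum.elim_inl] at hx h
    rwa [funext hx] at h
  · intro h
    exact ⟨fun i => t i v, fun _ => rfl, h⟩

instance mem [Finite Γ] {s t : (Γ → M) → M} [hs : DF s] [ht : DF t] :
    Dfn (fun v => s v ε t v) :=
  (mem_var (0 : Fin 2) 1).subst (t := ![s, t]) (by simp [Fin.forall_fin_two, hs, ht])

instance eq [Finite Γ] {s t : (Γ → M) → M} [hs : DF s] [ht : DF t] :
    Dfn (fun v => s v = t v) :=
  (eq_var (0 : Fin 2) 1).subst (t := ![s, t]) (by simp [Fin.forall_fin_two, hs, ht])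

instance ne [Finite Γ] {s t : (Γ → M) → M} [hs : DF s] [ht : DF t] :
    Dfn (fun v => s v ≠ t v) := not (P := fun v => s v = t v)

instance realize [Finite Γ] {Δ : Type} [Finite Δ] {φ : setLang.Formula Δ} {t : Δ → (Γ → M) → M}
    [ht : ∀ i, DF (t i)] : Dfn (fun v : Γ → M => φ.Realize (fun i => t i v)) :=
  (realizeFormula φ).subst ht

end Dfn

/-! ### Definability of the notions of set theory -/

/-- Here `k` is a natural number outside `M`; there is one formula for each `k`, found by external
induction. -/
theorem Dfn.isNumeral (k : ℕ) : ∀ {Γ : Type} [Finite Γ] {a : (Γ → M) → M} [DF a],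
    Dfn (fun v => IsNumeral k (a v)) := by
  induction k with
  | zero => intros; unfold IsNumeral IsEmptySet; infer_instance
  | succ k ih => intros; unfold IsNumeral IsSucc; infer_instance

section Instances

variable {Γ : Type} [Finite Γ] {a b c d e f : (Γ → M) → M}
  [DF a] [DF b] [DF c] [DF d] [DF e] [DF f]

instance : Dfn (fun v => Sub (a v) (b v)) := by unfold Sub; infer_instance
instance : Dfn (fun v => IsEmptySet (a v)) := by unfold IsEmptySet; infer_instance
instance : Dfn (fun v => IsSucc (a v) (b v)) := by unfold IsSucc; infer_instance

instance : Dfn (fun v => IsUPair (a v) (b v) (c v)) := by unfold IsUPair; infer_instance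
instance : Dfn (fun v => IsOPair (a v) (b v) (c v)) := by unfold IsOPair; infer_instance
instance : Dfn (fun v => IsTrans (a v)) := by unfold IsTrans; infer_instance
instance : Dfn (fun v => IsOrd (a v)) := by unfold IsOrd; infer_instance
instance : Dfn (fun v => IsZeroOrSucc (a v)) := by unfold IsZeroOrSucc; infer_instance
instance : Dfn (fun v => IsNat (a v)) := by unfold IsNat; infer_instance
instance : Dfn (fun v => App (a v) (b v) (c v)) := by unfold App; infer_instance
instance : Dfn (fun v => IsFunOn (a v) (b v)) := by unfold IsFunOn ExistsUnique; infer_instance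
instance : Dfn (fun v => IsComp (a v) (b v) (c v)) := by unfold IsComp; infer_instance
instance (k : ℕ) : Dfn (fun v => IsNumeral k (a v)) := Dfn.isNumeral k
instance (k : ℕ) : Dfn (fun v => IsTagged k (a v) (b v)) := by unfold IsTagged; infer_instance
instance (k : ℕ) : Dfn (fun v => IsTaggedPair k (a v) (b v) (c v)) := by
  unfold IsTaggedPair; infer_instance
instance : Dfn (fun v => IsEqCode (a v) (b v) (c v)) := by unfold IsEqCode; infer_instance
instance : Dfn (fun v => IsRelCode (a v) (b v) (c v)) := by unfold IsRelCode; infer_instance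
instance : Dfn (fun v => IsNegCode (a v) (b v)) := by unfold IsNegCode; infer_instance
instance : Dfn (fun v => IsAndCode (a v) (b v) (c v)) := by unfold IsAndCode; infer_instance
instance : Dfn (fun v => IsExCode (a v) (b v) (c v)) := by unfold IsExCode; infer_instance
set_option synthInstance.maxSize 2000 in
set_option synthInstance.maxHeartbeats 200000 in
instance : Dfn (fun v => IsFormulaSet (a v) (b v)) := by unfold IsFormulaSet; infer_instance
instance : Dfn (fun v => IsAssignment (a v) (b v)) := by unfold IsAssignment; infer_instance
set_option synthInstance.maxSize 2000 in
set_option synthInstance.maxHeartbeats 200000 in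
instance : Dfn (fun v => IsSatisfaction (a v) (b v) (c v) (d v)) := by
  unfold IsSatisfaction; infer_instance

end Instances

end Internal

end

section

open FirstOrder Language

/-! ### Elementary set theory in a model of `ZFC` -/

set_option linter.unusedSectionVars false

namespace Internal

local infix:50 " ε " => Mem

/-- `M` is a model of `ZFC`, as a type class. -/
class ModelZFC (M : Type v) [setLang.Structure M] : Prop where
  isModel : IsModelZFC M

variable {M : Type v} [setLang.Structure M] [hM : ModelZFC M]

instance : Nonempty M := ⟨hM.isModel.infinity.choose⟩

/-- Definable predicates of one variable. -/
class Def1 (P : M → Prop) : Prop where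
  out : Dfn (fun v : Fin 1 → M => P (v 0))

/-- Definable binary relations. -/
class Def2 (P : M → M → Prop) : Prop where
  out : Dfn (fun v : Fin 2 → M => P (v 0) (v 1))

/-- Definable ternary relations. -/
class Def3 (P : M → M → M → Prop) : Prop where
  out : Dfn (fun v : Fin 3 → M => P (v 0) (v 1) (v 2))

/-- Definable functions of one variable. -/
class Fun1 (F : M → M) : Prop where
  out : DF (fun v : Fin 1 → M => F (v 0))

section

variable {Γ : Type} [Finite Γ] {a b c : (Γ → M) → M} [ha : DF a] [hb : DF b] [hc : DF c]

instance {P : M → Prop} [h : Dfn (fun v : Fin 1 → M => P (v 0))] : Def1 P := ⟨h⟩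
instance {P : M → M → Prop} [h : Dfn (fun v : Fin 2 → M => P (v 0) (v 1))] : Def2 P := ⟨h⟩
instance {P : M → M → M → Prop} [h : Dfn (fun v : Fin 3 → M => P (v 0) (v 1) (v 2))] :
    Def3 P := ⟨h⟩
instance {F : M → M} [h : DF (fun v : Fin 1 → M => F (v 0))] : Fun1 F := ⟨h⟩

instance (priority := low) Def1.comp {P : M → Prop} [h : Def1 P] : Dfn (fun v => P (a v)) :=
  h.out.subst (t := ![a]) (by simpa using ha)

instance (priority := low) Def2.comp {P : M → M → Prop} [h : Def2 P] :
    Dfn (fun v => P (a v) (b v)) :=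
  h.out.subst (t := ![a, b]) (by simp [Fin.forall_fin_two, ha, hb])

instance (priority := low) Def3.comp {P : M → M → M → Prop} [h : Def3 P] :
    Dfn (fun v => P (a v) (b v) (c v)) :=
  h.out.subst (t := ![a, b, c]) (by
    simp [Fin.forall_fin_succ, ha, hb, hc])

instance (priority := low) Fun1.comp {F : M → M} [h : Fun1 F] : DF (fun v => F (a v)) := by
  refine ⟨?_⟩
  have h1 : Dfn (fun v : Fin 2 → M => v 0 = F (v 1)) := h.out.eq_iff (fun _ => 1) 0
  exact h1.subst (t := ![fun v : Option Γ → M => v none, fun v => a fun i => v (some i)])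
    (by
      rw [Fin.forall_fin_two]
      exact ⟨DF.var _, ha.rename _⟩)

end

open Classical in
/-- The unique `y` with `P y`, provided it exists. -/
noncomputable def the (P : M → Prop) : M :=
  if h : ∃! y, P y then h.choose else Classical.arbitrary M

theorem the_spec {P : M → Prop} (h : ∃! y, P y) : P (the P) := by
  rw [the, dif_pos h]
  exact h.choose_spec.1

theorem the_eq {P : M → Prop} {y : M} (hy : P y) (h : ∀ z, P z → z = y) : the P = y :=
  h _ (the_spec ⟨y, hy, h⟩)

/-- The right-hand side is first-order in `y`, with the default value as a parameter. It is the
reason why definable descriptions are definable functions. -/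
theorem the_eq_iff {P : M → Prop} {y : M} :
    y = the P ↔ (P y ∧ ∀ z, P z → z = y) ∨
      (¬ ∃ y, P y ∧ ∀ z, P z → z = y) ∧ y = Classical.arbitrary M := by
  by_cases h : ∃! y, P y
  · have h' : ∃ y, P y ∧ ∀ z, P z → z = y := h
    constructor
    · rintro rfl
      exact .inl ⟨the_spec h, fun z hz => h.unique hz (the_spec h)⟩
    · rintro (⟨h1, h2⟩ | ⟨h1, -⟩)
      · exact (the_eq h1 h2).symm
      · exact absurd h' h1
  · have h' : ¬ ∃ y, P y ∧ ∀ z, P z → z = y := h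
    rw [the, dif_neg h]
    constructor
    · intro hy
      exact .inr ⟨h', hy⟩
    · rintro (⟨h1, h2⟩ | ⟨-, h1⟩)
      · exact absurd ⟨y, h1, h2⟩ h'
      · exact h1

/-- The set of all `z` with `P z`, provided it exists. -/
noncomputable def cmp (P : M → Prop) : M := the fun y => ∀ z, z ε y ↔ P z

theorem ext {x y : M} (h : ∀ z, z ε x ↔ z ε y) : x = y := hM.isModel.extensionality x y h

theorem mem_cmp {P : M → Prop} (h : ∃ y, ∀ z, z ε y ↔ P z) {z : M} : z ε cmp P ↔ P z := by
  obtain ⟨y, hy⟩ := h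
  exact the_spec (P := fun y => ∀ z, z ε y ↔ P z)
    ⟨y, hy, fun y' hy' => ext fun z => (hy' z).trans (hy z).symm⟩ z

section

variable {Γ : Type} [Finite Γ]

instance DF.the {P : (Γ → M) → M → Prop}
    [hP : Dfn (fun v : Option Γ → M => P (fun i => v (some i)) (v none))] :
    DF (fun v => the (P v)) := by
  refine ⟨?_⟩
  have h1 : Dfn (fun v : Option (Option Γ) → M => P (fun i => v (some (some i))) (v none)) :=
    hP.rename (fun o : Option Γ => o.elim none (fun i => some (some i)))
  have h2 : Dfn (fun v : Option (Option (Option Γ)) → M =>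
      P (fun i => v (some (some (some i)))) (v none)) :=
    hP.rename (fun o : Option Γ => o.elim none (fun i => some (some (some i))))
  have h3 : Dfn (fun v : Option (Option Γ) → M => (P (fun i => v (some (some i))) (v none) ∧
      ∀ z, P (fun i => v (some (some i))) z → z = v none)) := by infer_instance
  have h4 : Dfn (fun v : Option Γ → M => (P (fun i => v (some i)) (v none) ∧
      ∀ z, P (fun i => v (some i)) z → z = v none) ∨
      (¬ ∃ y, P (fun i => v (some i)) y ∧ ∀ z, P (fun i => v (some i)) z → z = y) ∧
        v none = Classical.arbitrary M) := by infer_instance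
  exact h4.congr fun v => the_eq_iff.symm

instance DF.cmp {P : (Γ → M) → M → Prop}
    [hP : Dfn (fun v : Option Γ → M => P (fun i => v (some i)) (v none))] :
    DF (fun v => cmp (P v)) := by
  have h1 : Dfn (fun v : Option (Option Γ) → M => P (fun i => v (some (some i))) (v none)) :=
    hP.rename (fun o : Option Γ => o.elim none (fun i => some (some i)))
  unfold Internal.cmp
  infer_instance

open Classical in
instance DF.ite {P : (Γ → M) → Prop} {a b : (Γ → M) → M} [hP : Dfn P] [DF a] [DF b] :
    DF (fun v => if P v then a v else b v) := by
  refine ⟨?_⟩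
  have h1 : Dfn (fun v : Option Γ → M => P (fun i => v (some i))) := hP.rename _
  have h2 : Dfn (fun v : Option Γ → M => (P (fun i => v (some i)) ∧ v none = a fun i => v (some i)) ∨
    (¬ P (fun i => v (some i)) ∧ v none = b fun i => v (some i))) := by infer_instance
  refine h2.congr fun v => ?_
  split_ifs with h <;> simp [h]

end

theorem exists_sep (x : M) (P : M → Prop) [hP : Def1 P] :
    ∃ y, ∀ z, z ε y ↔ z ε x ∧ P z :=
  hM.isModel.separation {z | P z} hP.out.out x

theorem mem_cmp_of_sub (x : M) {P : M → Prop} (h : ∀ z, P z → z ε x)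
    [hP : Def1 P] {z : M} : z ε cmp P ↔ P z := by
  obtain ⟨y, hy⟩ := exists_sep x P
  exact mem_cmp ⟨y, fun z => (hy z).trans ⟨fun h => h.2, fun hz => ⟨h z hz, hz⟩⟩⟩

/-- Replacement for partial functions: separation first cuts `x` down to the domain of `R`. -/
theorem exists_image_rel (x : M) (R : M → M → Prop)
    (h : ∀ a, a ε x → ∀ b b', R a b → R a b' → b = b')
    [hR : Def2 R] :
    ∃ y, ∀ b, b ε y ↔ ∃ a, a ε x ∧ R a b := by
  obtain ⟨x', hx'⟩ := exists_sep x (fun a => ∃ b, R a b)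
  obtain ⟨y, hy⟩ := hM.isModel.replacement {p | R p.1 p.2}
    hR.out.out x' (by
      intro a ha
      obtain ⟨h1, b, hb⟩ := (hx' a).1 ha
      exact ⟨b, hb, fun b' hb' => h a h1 b' b hb' hb⟩)
  refine ⟨y, fun b => (hy b).trans (exists_congr fun a => ?_)⟩
  rw [hx']
  exact ⟨fun h => ⟨h.1.1, h.2⟩, fun h => ⟨⟨h.1, _, h.2⟩, h.2⟩⟩

theorem exists_image (x : M) (F : M → M) [hF : Fun1 F] :
    ∃ y, ∀ b, b ε y ↔ ∃ a, a ε x ∧ b = F a :=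
  exists_image_rel x (fun a b => b = F a) fun _ _ _ _ h h' => h.trans h'.symm

/-- The empty set. -/
noncomputable def emp : M := cmp fun _ => False
/-- `{x, y}` -/
noncomputable def upair (x y : M) : M := cmp fun z => z = x ∨ z = y
/-- `⟨x, y⟩` -/
noncomputable def opair (x y : M) : M := upair (upair x x) (upair x y)
/-- `⋃ x` -/
noncomputable def sUn (x : M) : M := cmp fun z => ∃ y, y ε x ∧ z ε y
/-- The power set. -/
noncomputable def pow (x : M) : M := cmp fun z => Sub z x
/-- `x ∪ y` -/
noncomputable def un (x y : M) : M := cmp fun z => z ε x ∨ z ε y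
/-- `x ∪ {x}` -/
noncomputable def succ (x : M) : M := cmp fun z => z ε x ∨ z = x
/-- `{z ∈ x | P z}` -/
noncomputable def sep (x : M) (P : M → Prop) : M := cmp fun z => z ε x ∧ P z
/-- `{F z | z ∈ x}` -/
noncomputable def img (F : M → M) (x : M) : M := cmp fun z => ∃ y, y ε x ∧ z = F y
/-- The function `F` restricted to `d`, as a set of pairs. -/
noncomputable def lam (d : M) (F : M → M) : M := img (fun x => opair x (F x)) d
/-- `x × y` -/
noncomputable def prod (x y : M) : M := sUn (img (fun a => img (fun b => opair a b) y) x)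
/-- The value of the function `f` at `x`. -/
noncomputable def app (f x : M) : M := the fun y => opair x y ε f

section

variable {Γ : Type} [Finite Γ] {a b c : (Γ → M) → M} [DF a] [DF b] [DF c]
  {P : (Γ → M) → M → Prop} [Dfn (fun v : Option Γ → M => P (fun i => v (some i)) (v none))]
  {F : (Γ → M) → M → M} [hF : DF (fun v : Option Γ → M => F (fun i => v (some i)) (v none))]

instance : DF (fun v => upair (a v) (b v)) := by unfold upair; infer_instance
instance : DF (fun v => opair (a v) (b v)) := by unfold opair; infer_instance
instance : DF (fun v => sUn (a v)) := by unfold sUn; infer_instance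
instance : DF (fun v => pow (a v)) := by unfold pow; infer_instance
instance : DF (fun v => un (a v) (b v)) := by unfold un; infer_instance
instance : DF (fun v => succ (a v)) := by unfold succ; infer_instance
instance : DF (fun v => sep (a v) (P v)) := by unfold sep; infer_instance
instance : DF (fun v => img (F v) (a v)) := by
  have h1 : DF (fun v : Option (Option Γ) → M => F (fun i => v (some (some i))) (v none)) :=
    hF.rename (fun o : Option Γ => o.elim none (fun i => some (some i)))
  unfold img; infer_instance
instance : DF (fun v => lam (a v) (F v)) := by unfold lam; infer_instance
instance : DF (fun v => prod (a v) (b v)) := by unfold prod; infer_instance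
instance : DF (fun v => app (a v) (b v)) := by unfold app; infer_instance

end

@[simp] theorem not_mem_emp {z : M} : ¬ z ε (emp : M) := by
  obtain ⟨e, he⟩ := exists_sep (Classical.arbitrary M) (fun _ => False)
  rw [emp, mem_cmp ⟨e, fun z => (he z).trans (by simp)⟩]
  exact id

@[simp] theorem mem_upair {x y z : M} : z ε upair x y ↔ z = x ∨ z = y :=
  mem_cmp (hM.isModel.pairing x y)

@[simp] theorem mem_sUn {x z : M} : z ε sUn x ↔ ∃ y, y ε x ∧ z ε y :=
  mem_cmp (hM.isModel.union x)

@[simp] theorem mem_pow {x z : M} : z ε pow x ↔ Sub z x :=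
  mem_cmp (hM.isModel.powerset x)

@[simp] theorem mem_un {x y z : M} : z ε un x y ↔ z ε x ∨ z ε y :=
  mem_cmp_of_sub (sUn (upair x y)) (by
    rintro z (h | h)
    · exact mem_sUn.2 ⟨x, by simp, h⟩
    · exact mem_sUn.2 ⟨y, by simp, h⟩)

@[simp] theorem mem_succ {x z : M} : z ε succ x ↔ z ε x ∨ z = x :=
  mem_cmp_of_sub (un x (upair x x)) (by
    rintro z (h | h) <;> simp [h])

theorem mem_sep {x z : M} {P : M → Prop} [hP : Def1 P] :
    z ε sep x P ↔ z ε x ∧ P z :=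
  mem_cmp (exists_sep x P)

theorem mem_img {x z : M} {F : M → M} [hF : Fun1 F] :
    z ε img F x ↔ ∃ y, y ε x ∧ z = F y :=
  mem_cmp (exists_image x F)

theorem mem_lam {d z : M} {F : M → M} [hF : Fun1 F] :
    z ε lam d F ↔ ∃ x, x ε d ∧ z = opair x (F x) := mem_img

theorem mem_prod {x y z : M} : z ε prod x y ↔ ∃ a b, a ε x ∧ b ε y ∧ z = opair a b := by
  rw [prod, mem_sUn]
  constructor
  · rintro ⟨w, hw, hz⟩
    obtain ⟨a, ha, rfl⟩ := mem_img.1 hw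
    obtain ⟨b, hb, rfl⟩ := mem_img.1 hz
    exact ⟨a, b, ha, hb, rfl⟩
  · rintro ⟨a, b, ha, hb, rfl⟩
    exact ⟨_, mem_img.2 ⟨a, ha, rfl⟩, mem_img.2 ⟨b, hb, rfl⟩⟩

theorem upair_inj_left {x y z : M} (h : upair x y = upair x z) : y = z := by
  have h1 : y ε upair x z := by rw [← h]; simp
  have h2 : z ε upair x y := by rw [h]; simp
  rw [mem_upair] at h1 h2
  rcases h1 with h1 | h1
  · rcases h2 with h2 | h2
    · rw [h1, h2]
    · exact h2.symm
  · exact h1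

@[simp] theorem opair_inj {x y x' y' : M} : opair x y = opair x' y' ↔ x = x' ∧ y = y' := by
  refine ⟨fun h => ?_, fun h => by rw [h.1, h.2]⟩
  have hx : x = x' := by
    have h1 : upair x x ε opair x' y' := by rw [← h]; simp [opair]
    rw [opair, mem_upair] at h1
    have h2 : x' ε upair x x := by
      rcases h1 with h1 | h1 <;> rw [h1] <;> simp
    rcases mem_upair.1 h2 with h3 | h3 <;> exact h3.symm
  subst hx
  exact ⟨rfl, upair_inj_left (upair_inj_left h)⟩

theorem isUPair_iff {z x y : M} : IsUPair z x y ↔ z = upair x y :=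
  ⟨fun h => ext fun w => (h w).trans mem_upair.symm, by rintro rfl w; exact mem_upair⟩

@[simp] theorem isOPair_iff {z x y : M} : IsOPair z x y ↔ z = opair x y := by
  simp [IsOPair, isUPair_iff, opair]

theorem isSucc_iff {s x : M} : IsSucc s x ↔ s = succ x :=
  ⟨fun h => ext fun w => (h w).trans mem_succ.symm, by rintro rfl w; exact mem_succ⟩

theorem isEmptySet_iff {x : M} : IsEmptySet x ↔ x = emp :=
  ⟨fun h => ext fun w => iff_of_false (h w) not_mem_emp, by rintro rfl w; exact not_mem_emp⟩

@[simp] theorem app_iff {f x y : M} : App f x y ↔ opair x y ε f := by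
  simp [App]

theorem app_eq {f x y : M} (h : opair x y ε f) (h' : ∀ y', opair x y' ε f → y' = y) :
    app f x = y := the_eq h h'

theorem app_lam {d x : M} {F : M → M} (hx : x ε d)
    [hF : Fun1 F] : app (lam d F) x = F x := by
  refine app_eq (mem_lam.2 ⟨x, hx, rfl⟩) fun y hy => ?_
  obtain ⟨x', -, h⟩ := mem_lam.1 hy
  rw [opair_inj] at h
  rw [h.2, h.1]

theorem isFunOn_lam {d : M} {F : M → M} [hF : Fun1 F] :
    IsFunOn (lam d F) d := by
  refine ⟨fun z hz => ?_, fun x hx => ⟨F x, app_iff.2 (mem_lam.2 ⟨x, hx, rfl⟩), fun y hy => ?_⟩⟩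
  · obtain ⟨x, hx, rfl⟩ := mem_lam.1 hz
    exact ⟨x, F x, hx, by simp⟩
  · obtain ⟨x', -, h⟩ := mem_lam.1 (app_iff.1 hy)
    rw [opair_inj] at h
    rw [h.2, h.1]

namespace IsFunOn

variable {f g d x y : M}

theorem opair_mem (h : IsFunOn f d) (hx : x ε d) : opair x (app f x) ε f := by
  obtain ⟨y, hy, h'⟩ := h.2 x hx
  rw [app_iff] at hy
  rwa [app_eq hy fun y' hy' => h' y' (app_iff.2 hy')]

theorem mem_dom (h : IsFunOn f d) (hxy : opair x y ε f) : x ε d := by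
  obtain ⟨x', y', h1, h2⟩ := h.1 _ hxy
  rw [isOPair_iff, opair_inj] at h2
  rwa [h2.1]

theorem opair_mem_iff (h : IsFunOn f d) : opair x y ε f ↔ x ε d ∧ y = app f x := by
  constructor
  · intro hxy
    have hx := h.mem_dom hxy
    exact ⟨hx, (h.2 x hx).unique (app_iff.2 hxy) (app_iff.2 (h.opair_mem hx))⟩
  · rintro ⟨hx, rfl⟩
    exact h.opair_mem hx

theorem mem_iff (h : IsFunOn f d) {z : M} : z ε f ↔ ∃ x, x ε d ∧ z = opair x (app f x) := by
  constructor
  · intro hz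
    obtain ⟨x, y, hx, hxy⟩ := h.1 z hz
    rw [isOPair_iff] at hxy
    subst hxy
    exact ⟨x, hx, by rw [(h.opair_mem_iff.1 hz).2]⟩
  · rintro ⟨x, hx, rfl⟩
    exact h.opair_mem hx

theorem ext (hf : IsFunOn f d) (hg : IsFunOn g d) (h : ∀ x, x ε d → app f x = app g x) :
    f = g := by
  refine Internal.ext fun z => ?_
  rw [hf.mem_iff, hg.mem_iff]
  refine exists_congr fun x => and_congr_right fun hx => ?_
  rw [h x hx]

end IsFunOn

end Internal

end

section

open FirstOrder Language

/-! ### Induction and recursion along membership -/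

set_option linter.unusedSectionVars false

namespace Internal

local infix:50 " ε " => Mem

variable {M : Type v} [setLang.Structure M] [hM : ModelZFC M]

theorem img_congr {F F' : M → M} {x : M} (h : ∀ y, y ε x → F y = F' y) : img F x = img F' x := by
  unfold img
  congr 1
  funext z
  refine propext (exists_congr fun y => and_congr_right fun hy => ?_)
  rw [h y hy]

/-- `x` is an element of a transitive set. -/
def InTr (x : M) : Prop := ∃ t, IsTrans t ∧ x ε t

/-- `z` is in the transitive closure of `x`. -/
def Below (z x : M) : Prop := ∀ t, IsTrans t → Sub x t → z ε t

section

variable {Γ : Type} [Finite Γ] {a b : (Γ → M) → M} [DF a] [DF b]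

instance : Dfn (fun v => Below (a v) (b v)) := by unfold Below; infer_instance

end

theorem Below.of_mem {x z : M} (h : z ε x) : Below z x := fun _ _ hs => hs z h

theorem Below.trans {x y z : M} (h : Below z y) (h' : Below y x) : Below z x :=
  fun t ht hs => h t ht fun _ hw => ht y (h' t ht hs) _ hw

theorem Below.mem_of_isTrans {x z t : M} (h : Below z x) (ht : IsTrans t) (hx : x ε t) : z ε t :=
  h t ht (ht x hx)

/-- Foundation gives a minimal counterexample in a transitive set around `x`. The assumption `InTr
x` is needed at this stage because transitive closures are only built later (`inTr`), by a recursion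
that rests on this induction for ordinals. -/
theorem InTr.induction {P : M → Prop} [Def1 P]
    (h : ∀ x, InTr x → (∀ y, y ε x → P y) → P x) {x : M} (hx : InTr x) : P x := by
  by_contra hc
  obtain ⟨t, ht, hxt⟩ := hx
  obtain ⟨y, hy, hmin⟩ := hM.isModel.foundation (sep t fun z => ¬ P z)
    ⟨x, mem_sep.2 ⟨hxt, hc⟩⟩
  rw [mem_sep] at hy
  refine hy.2 (h y ⟨t, ht, hy.1⟩ fun z hz => ?_)
  by_contra hPz
  exact hmin z hz (mem_sep.2 ⟨ht y hy.1 z hz, hPz⟩)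

/-- The sets that satisfy the conclusion form, within a transitive set around `x`, a transitive set
that includes `x`. -/
theorem Below.cases {x z : M} (hx : InTr x) (h : Below z x) :
    z ε x ∨ ∃ y, y ε x ∧ Below z y := by
  obtain ⟨t, ht, hxt⟩ := hx
  have := h (sep t fun z => z ε x ∨ ∃ y, y ε x ∧ Below z y) (by
    intro w hw z hz
    rw [mem_sep] at hw ⊢
    refine ⟨ht w hw.1 z hz, .inr ?_⟩
    rcases hw.2 with h1 | ⟨y, hy, h1⟩
    · exact ⟨w, h1, .of_mem hz⟩
    · exact ⟨y, hy, (Below.of_mem hz).trans h1⟩) (by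
    intro w hw
    exact mem_sep.2 ⟨ht x hxt w hw, .inl hw⟩)
  exact (mem_sep.1 this).2

theorem InTr.strongInduction {P : M → Prop} [Def1 P]
    (h : ∀ x, InTr x → (∀ y, Below y x → P y) → P x) {x : M} (hx : InTr x) : P x := by
  have : (∀ y, Below y x → P y) ∧ P x := by
    refine InTr.induction (P := fun x => (∀ y, Below y x → P y) ∧ P x) (fun x hx ih => ?_) hx
    have h1 : ∀ y, Below y x → P y := by
      intro y hy
      rcases hy.cases hx with h1 | ⟨w, hw, h1⟩
      · exact (ih y h1).2
      · exact (ih w hw).1 y h1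
    exact ⟨h1, h x hx h1⟩
  exact this.2

/-- `f` is a solution with transitive domain `d` of the recursion given by `H`. -/
def Attempt (H : M → (M → M) → M) (f d : M) : Prop :=
  IsTrans d ∧ IsFunOn f d ∧ ∀ x, x ε d → app f x = H x (app f)

/-- The function defined by recursion along membership from `H`. -/
noncomputable def recur (H : M → (M → M) → M) (x : M) : M :=
  the fun y => ∃ f d, Attempt H f d ∧ x ε d ∧ y = app f x

/-- `H x F` depends only on the values of `F` at elements of the transitive closure of `x`. -/
def IsLocal (H : M → (M → M) → M) : Prop :=
  ∀ x F F', (∀ z, Below z x → F z = F' z) → H x F = H x F'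

/-- The recursion step `H` is definable. -/
class DefRec (H : M → (M → M) → M) : Prop where
  out : DF (fun v : Fin 2 → M => H (v 0) (app (v 1)))

instance {H : M → (M → M) → M} [h : DF (fun v : Fin 2 → M => H (v 0) (app (v 1)))] : DefRec H := ⟨h⟩

section

variable {H : M → (M → M) → M} [hH : DefRec H] {Γ : Type} [Finite Γ] {a b : (Γ → M) → M}
  [ha : DF a] [hb : DF b]

theorem DefRec.comp : DF (fun v => H (a v) (app (b v))) := by
  refine ⟨?_⟩
  have h1 : Dfn (fun v : Fin 3 → M => v 0 = H (v 1) (app (v 2))) := hH.out.eq_iff (fun i => i.succ) 0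
  refine h1.subst (t := ![fun v : Option Γ → M => v none, fun v => a fun i => v (some i),
    fun v => b fun i => v (some i)]) ?_
  simp only [Fin.forall_fin_succ]
  exact ⟨DF.var _, ha.rename _, hb.rename _, fun i => i.elim0⟩

instance : Dfn (fun v => Attempt H (a v) (b v)) := by
  have : DF (fun v : Option Γ → M => H (v none) (app (a fun i => v (some i)))) := DefRec.comp
  unfold Attempt
  infer_instance

instance : DF (fun v => recur H (a v)) := by unfold recur; infer_instance

theorem Attempt.unique (hloc : IsLocal H) {f d f' d' x : M} (h : Attempt H f d)
    (h' : Attempt H f' d') (hx : x ε d) (hx' : x ε d') : app f x = app f' x := by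
  refine InTr.strongInduction (P := fun x => x ε d → x ε d' → app f x = app f' x)
    (fun x _ ih hx hx' => ?_) ⟨d, h.1, hx⟩ hx hx'
  rw [h.2.2 x hx, h'.2.2 x hx']
  exact hloc _ _ _ fun z hz => ih z hz (hz.mem_of_isTrans h.1 hx) (hz.mem_of_isTrans h'.1 hx')

theorem Attempt.recur_eq (hloc : IsLocal H) {f d x : M} (h : Attempt H f d) (hx : x ε d) :
    recur H x = app f x :=
  the_eq ⟨f, d, h, hx, rfl⟩ fun _ ⟨_, _, h', hx', e⟩ => e.trans (h'.unique hloc h hx' hx)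

/-- By induction `recur H` already has the right values below `x`. Replacement makes a table of
them, and one more application of `H` adds the value at `x`. -/
theorem exists_attempt (hloc : IsLocal H) {x : M} (hx : InTr x) :
    ∃ f d, Attempt H f d ∧ x ε d := by
  refine InTr.strongInduction (P := fun x => ∃ f d, Attempt H f d ∧ x ε d) (fun x hx ih => ?_) hx
  obtain ⟨t, ht, hxt⟩ := hx
  have hd : ∀ z, z ε sep t (fun z => Below z x ∨ z = x) ↔ Below z x ∨ z = x := by
    intro z
    rw [mem_sep]
    refine ⟨fun h => h.2, fun h => ⟨?_, h⟩⟩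
    rcases h with h | rfl
    · exact h.mem_of_isTrans ht hxt
    · exact hxt
  generalize sep t (fun z => Below z x ∨ z = x) = d at hd
  have hbd : ∀ z w, z ε d → Below w z → Below w x := by
    intro z w hz hw
    rcases (hd z).1 hz with h | rfl
    · exact hw.trans h
    · exact hw
  have hf₀ : ∀ z w, z ε d → Below w z → app (lam d (recur H)) w = recur H w := by
    intro z w hz hw
    exact app_lam ((hd w).2 (.inl (hbd z w hz hw)))
  have : DF (fun v : Fin 1 → M => H (v 0) (app (lam d (recur H)))) := DefRec.comp
  have hrec : ∀ w, Below w x → recur H w = H w (app (lam d (recur H))) := by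
    intro w hw
    obtain ⟨f, e, hfe, hwe⟩ := ih w hw
    rw [hfe.recur_eq hloc hwe, hfe.2.2 w hwe]
    refine hloc _ _ _ fun z hz => ?_
    rw [hf₀ w z ((hd w).2 (.inl hw)) hz, hfe.recur_eq hloc (hz.mem_of_isTrans hfe.1 hwe)]
  -- At `x` itself the table `lam d (recur H)` is not yet known to be right, but locality makes `H`
  -- look only at entries strictly below.
  refine ⟨lam d (fun z => H z (app (lam d (recur H)))), d, ⟨?_, isFunOn_lam, fun z hz => ?_⟩,
    (hd x).2 (.inr rfl)⟩
  · intro z hz w hw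
    exact (hd w).2 (.inl (hbd z w hz (.of_mem hw)))
  · rw [app_lam hz]
    refine hloc _ _ _ fun w hw => ?_
    have hwx := hbd z w hz hw
    rw [hf₀ z w hz hw, app_lam ((hd w).2 (.inl hwx)), hrec w hwx]

theorem InTr.recur_eq (hloc : IsLocal H) {x : M} (hx : InTr x) :
    recur H x = H x (recur H) := by
  obtain ⟨f, d, h, hxd⟩ := exists_attempt hloc hx
  rw [h.recur_eq hloc hxd, h.2.2 x hxd]
  exact hloc _ _ _ fun z hz => (h.recur_eq hloc (hz.mem_of_isTrans h.1 hxd)).symm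

end

/-! ### Natural numbers -/

theorem IsOrd.mem {x y : M} (hx : IsOrd x) (hy : y ε x) : IsOrd y :=
  ⟨hx.2 y hy, fun z hz => hx.2 z (hx.1 y hy z hz)⟩

theorem IsOrd.succ {x : M} (hx : IsOrd x) : IsOrd (succ x) := by
  constructor
  · intro y hy z hz
    rw [mem_succ] at hy ⊢
    rcases hy with h | rfl
    · exact .inl (hx.1 y h z hz)
    · exact .inl hz
  · intro y hy
    rw [mem_succ] at hy
    rcases hy with h | rfl
    · exact hx.2 y h
    · exact hx.1

theorem mem_succ_self (x : M) : x ε succ x := mem_succ.2 (.inr rfl)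

theorem IsOrd.inTr {x : M} (hx : IsOrd x) : InTr x := ⟨Internal.succ x, hx.succ.1, mem_succ_self x⟩

theorem isOrd_emp : IsOrd (emp : M) :=
  ⟨fun _ h => absurd h not_mem_emp, fun _ h => absurd h not_mem_emp⟩

theorem isZeroOrSucc_iff {x : M} : IsZeroOrSucc x ↔ x = emp ∨ ∃ y, x = succ y := by
  simp [IsZeroOrSucc, isEmptySet_iff, isSucc_iff]

theorem isNat_emp : IsNat (emp : M) :=
  ⟨isOrd_emp, isZeroOrSucc_iff.2 (.inl rfl), fun _ h => absurd h not_mem_emp⟩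

theorem IsNat.succ {x : M} (hx : IsNat x) : IsNat (succ x) := by
  refine ⟨hx.1.succ, isZeroOrSucc_iff.2 (.inr ⟨x, rfl⟩), fun y hy => ?_⟩
  rcases mem_succ.1 hy with h | rfl
  · exact hx.2.2 y h
  · exact hx.2.1

theorem IsNat.mem {x y : M} (hx : IsNat x) (hy : y ε x) : IsNat y :=
  ⟨hx.1.mem hy, hx.2.2 y hy, fun z hz => hx.2.2 z (hx.1.1 y hy z hz)⟩

theorem IsNat.induction {P : M → Prop} [Def1 P] (h0 : P emp)
    (hs : ∀ n, IsNat n → P n → P (Internal.succ n)) {n : M} (hn : IsNat n) : P n := by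
  refine InTr.induction (P := fun n => IsNat n → P n) (fun n _ ih hn => ?_) hn.1.inTr hn
  rcases isZeroOrSucc_iff.1 hn.2.1 with rfl | ⟨y, rfl⟩
  · exact h0
  · have := hn.mem (mem_succ_self y)
    exact hs y this (ih y (mem_succ_self y) this)

/-- The set of natural numbers. -/
noncomputable def om : M := cmp IsNat

@[simp] theorem mem_om {n : M} : n ε (om : M) ↔ IsNat n := by
  obtain ⟨w, ⟨e, he, hew⟩, hs⟩ := hM.isModel.infinity
  rw [isEmptySet_iff] at he
  refine mem_cmp_of_sub w fun n hn => ?_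
  refine IsNat.induction (P := fun n => n ε w) (he ▸ hew) (fun n _ h => ?_) hn
  obtain ⟨s, h1, h2⟩ := hs n h
  rwa [isSucc_iff.1 h1] at h2

/-- Every set is an element of a transitive set. -/
theorem inTr (x : M) : InTr x := by
  -- The stages are `u_n = x ∪ ⋃ ⋃ {u_m : m ∈ n}`; their union together with `x` itself is the
  -- required transitive set. Recursion is only needed on natural numbers, which are ordinals and
  -- hence lie in transitive sets.
  let H : M → (M → M) → M := fun n F => un x (sUn (sUn (img F n)))
  have hH : DefRec H := inferInstance
  have hloc : IsLocal H := by
    intro n F F' h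
    have : img F n = img F' n := img_congr fun y hy => h y (.of_mem hy)
    simp only [H, this]
  have hu : ∀ n, IsNat n → ∀ z, z ε recur H n ↔
      z ε x ∨ ∃ m y, m ε n ∧ y ε recur H m ∧ z ε y := by
    intro n hn z
    rw [hn.1.inTr.recur_eq hloc]
    simp only [H, mem_un, mem_sUn, mem_img]
    refine or_congr_right ⟨?_, ?_⟩
    · rintro ⟨y, ⟨w, ⟨m, hm, rfl⟩, hy⟩, hz⟩
      exact ⟨m, y, hm, hy, hz⟩
    · rintro ⟨m, y, hm, hy, hz⟩
      exact ⟨y, ⟨_, ⟨m, hm, rfl⟩, hy⟩, hz⟩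
  refine ⟨un (sUn (img (recur H) om)) (upair x x), ?_, by simp⟩
  intro y hy z hz
  rw [mem_un] at hy ⊢
  left
  rw [mem_sUn]
  rcases hy with hy | hy
  · obtain ⟨_, hw, hy⟩ := mem_sUn.1 hy
    obtain ⟨n, hn, rfl⟩ := mem_img.1 hw
    rw [mem_om] at hn
    exact ⟨_, mem_img.2 ⟨succ n, mem_om.2 hn.succ, rfl⟩,
      (hu _ hn.succ z).2 (.inr ⟨n, y, mem_succ_self n, hy, hz⟩)⟩
  · have : y = x := by simpa using hy
    subst this
    exact ⟨_, mem_img.2 ⟨emp, mem_om.2 isNat_emp, rfl⟩, (hu _ isNat_emp z).2 (.inl hz)⟩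

theorem mem_induction {P : M → Prop} [Def1 P] (h : ∀ x, (∀ y, y ε x → P y) → P x) (x : M) : P x :=
  (inTr x).induction fun x _ => h x

theorem below_induction {P : M → Prop} [Def1 P] (h : ∀ x, (∀ y, Below y x → P y) → P x) (x : M) :
    P x :=
  (inTr x).strongInduction fun x _ => h x

theorem recur_eq {H : M → (M → M) → M} [DefRec H] (hloc : IsLocal H) (x : M) :
    recur H x = H x (recur H) :=
  (inTr x).recur_eq hloc

theorem not_mem_self (x : M) : ¬ x ε x :=
  mem_induction (P := fun x => ¬ x ε x) (fun x ih hx => ih x hx hx) x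

end Internal

end

section

open FirstOrder Language

/-! ### Ordinals, the cumulative hierarchy, collection and choice -/

set_option linter.unusedSectionVars false

namespace Internal

local infix:50 " ε " => Mem

variable {M : Type v} [setLang.Structure M] [hM : ModelZFC M]

/-- Double ∈-induction: if neither ordinal belongs to the other, comparing their elements shows that
they have the same elements. -/
theorem IsOrd.trichotomy {a b : M} (ha : IsOrd a) (hb : IsOrd b) : a ε b ∨ a = b ∨ b ε a := by
  refine mem_induction (P := fun a => IsOrd a → ∀ b, IsOrd b → a ε b ∨ a = b ∨ b ε a)
    (fun a iha ha => ?_) a ha b hb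
  refine mem_induction (P := fun b => IsOrd b → a ε b ∨ a = b ∨ b ε a) fun b ihb hb => ?_
  by_contra! hc
  obtain ⟨h1, h2, h3⟩ := hc
  refine h2 (ext fun z => ⟨fun hz => ?_, fun hz => ?_⟩)
  · rcases iha z hz (ha.mem hz) b hb with h | h | h
    · exact h
    · exact absurd (h ▸ hz) h3
    · exact absurd (ha.1 z hz b h) h3
  · rcases ihb z hz (hb.mem hz) with h | h | h
    · exact absurd (hb.1 z hz a h) h1
    · exact absurd (h ▸ hz) h1
    · exact h

/-- The recursion step of the cumulative hierarchy. -/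
noncomputable def cumulStep (x : M) (F : M → M) : M := sUn (img (fun y => pow (F y)) x)

/-- The cumulative hierarchy; for an ordinal `x` this is `V_x`. -/
noncomputable def cumul (x : M) : M := recur cumulStep x

/-- The recursion step of the rank function. -/
noncomputable def rankStep (x : M) (F : M → M) : M := sUn (img (fun y => succ (F y)) x)

/-- The rank of a set. -/
noncomputable def rank (x : M) : M := recur rankStep x

instance : DefRec (cumulStep (M := M)) := by
  have : DF (fun v : Fin 2 → M => cumulStep (v 0) (app (v 1))) := by
    unfold cumulStep; infer_instance
  infer_instance

instance : DefRec (rankStep (M := M)) := by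
  have : DF (fun v : Fin 2 → M => rankStep (v 0) (app (v 1))) := by
    unfold rankStep; infer_instance
  infer_instance

section

variable {Γ : Type} [Finite Γ] {a b : (Γ → M) → M} [DF a] [DF b]

instance : DF (fun v => cumul (a v)) := by unfold cumul; infer_instance
instance : DF (fun v => rank (a v)) := by unfold rank; infer_instance

end

theorem mem_cumul {x z : M} : z ε cumul x ↔ ∃ y, y ε x ∧ Sub z (cumul y) := by
  rw [cumul, recur_eq fun x F F' h => ?_]
  · simp only [cumulStep, mem_sUn, mem_img]
    constructor
    · rintro ⟨_, ⟨y, hy, rfl⟩, h⟩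
      exact ⟨y, hy, mem_pow.1 h⟩
    · rintro ⟨y, hy, h⟩
      exact ⟨_, ⟨y, hy, rfl⟩, mem_pow.2 h⟩
  · exact congrArg sUn (img_congr fun y hy => by rw [h y (.of_mem hy)])

theorem mem_rank {x z : M} : z ε rank x ↔ ∃ y, y ε x ∧ (z ε rank y ∨ z = rank y) := by
  rw [rank, recur_eq fun x F F' h => ?_]
  · simp only [rankStep, mem_sUn, mem_img]
    constructor
    · rintro ⟨_, ⟨y, hy, rfl⟩, h⟩
      exact ⟨y, hy, mem_succ.1 h⟩
    · rintro ⟨y, hy, h⟩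
      exact ⟨_, ⟨y, hy, rfl⟩, mem_succ.2 h⟩
  · exact congrArg sUn (img_congr fun y hy => by rw [h y (.of_mem hy)])

theorem isOrd_rank (x : M) : IsOrd (rank x) := by
  refine mem_induction (P := fun x => IsOrd (rank x)) (fun x ih => ⟨fun z hz w hw => ?_,
    fun z hz => ?_⟩) x
  · obtain ⟨y, hy, h⟩ := mem_rank.1 hz
    refine mem_rank.2 ⟨y, hy, .inl ?_⟩
    rcases h with h | rfl
    · exact (ih y hy).1 z h w hw
    · exact hw
  · obtain ⟨y, hy, h⟩ := mem_rank.1 hz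
    rcases h with h | rfl
    · exact (ih y hy).2 z h
    · exact (ih y hy).1

theorem sub_cumul_rank (x : M) : Sub x (cumul (rank x)) := by
  refine mem_induction (P := fun x => Sub x (cumul (rank x))) (fun x ih z hz => ?_) x
  exact mem_cumul.2 ⟨rank z, mem_rank.2 ⟨z, hz, .inr rfl⟩, ih z hz⟩

theorem IsOrd.isV_cumul {α : M} (hα : IsOrd α) : IsV (cumul α) α := by
  refine ⟨Internal.succ α, lam (Internal.succ α) cumul, isSucc_iff.2 rfl, isFunOn_lam,
    app_iff.2 (mem_lam.2 ⟨α, mem_succ_self α, rfl⟩), fun b y hby z => ?_⟩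
  obtain ⟨b', hb, h⟩ := mem_lam.1 (app_iff.1 hby)
  rw [opair_inj] at h
  obtain ⟨rfl, rfl⟩ := h
  rw [mem_cumul]
  constructor
  · rintro ⟨c, hc, h⟩
    exact ⟨c, _, hc, app_iff.2 (mem_lam.2 ⟨c, hα.succ.1 b hb c hc, rfl⟩), h⟩
  · rintro ⟨c, y, hc, h1, h2⟩
    obtain ⟨c', -, h⟩ := mem_lam.1 (app_iff.1 h1)
    rw [opair_inj] at h
    obtain ⟨rfl, rfl⟩ := h
    exact ⟨c, hc, h2⟩

/-- Collection for definable relations. -/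
theorem exists_collection (U : M) (R : M → M → Prop) [Def2 R] :
    ∃ N, ∀ u, u ε U → (∃ z, R u z) → ∃ z, z ε N ∧ R u z := by
  -- Scott's trick: `ρ u` is the least ordinal whose level of the hierarchy contains a witness for
  -- `u`.
  let ρ : M → M := fun u => the fun α => (IsOrd α ∧ ∃ z, z ε cumul α ∧ R u z) ∧
    ∀ β, β ε α → ¬ ∃ z, z ε cumul β ∧ R u z
  have hρ : Fun1 ρ := inferInstance
  refine ⟨sUn (img (fun u => cumul (ρ u)) U), fun u hu ⟨z, hz⟩ => ?_⟩
  have h1 : ∃! α, (IsOrd α ∧ ∃ z, z ε cumul α ∧ R u z) ∧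
      ∀ β, β ε α → ¬ ∃ z, z ε cumul β ∧ R u z := by
    refine existsUnique_of_exists_of_unique ?_ ?_
    · by_contra hc
      refine mem_induction (P := fun α => ¬ (IsOrd α ∧ ∃ z, z ε cumul α ∧ R u z))
        (fun α ih h => hc ⟨α, h, fun β hβ hz => ih β hβ ⟨h.1.mem hβ, hz⟩⟩) (rank (succ z))
        ⟨isOrd_rank _, z, sub_cumul_rank _ z (mem_succ_self z), hz⟩
    · rintro α β ⟨⟨h1, h2⟩, h3⟩ ⟨⟨h4, h5⟩, h6⟩
      rcases h1.trichotomy h4 with h | h | h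
      · exact absurd h2 (h6 α h)
      · exact h
      · exact absurd h5 (h3 β h)
  obtain ⟨⟨-, z', hz', hR⟩, -⟩ := the_spec h1
  exact ⟨z', mem_sUn.2 ⟨_, mem_img.2 ⟨u, hu, rfl⟩, hz'⟩, hR⟩

/-- Choice for definable relations. -/
theorem exists_choice (U : M) (R : M → M → Prop) [Def2 R] :
    ∃ f, IsFunOn f U ∧ ∀ u, u ε U → (∃ z, R u z) → R u (app f u) := by
  obtain ⟨N, hN⟩ := exists_collection U R
  have hF : Fun1 (fun u : M => img (fun z => opair u z) (sep N (fun z => R u z))) := inferInstance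
  have hmem : ∀ u e, e ε img (fun z => opair u z) (sep N (fun z => R u z)) ↔
      ∃ z, (z ε N ∧ R u z) ∧ e = opair u z := by
    intro u e
    simp only [mem_img, mem_sep]
  -- The axiom provides transversals of disjoint families, so the witnesses for `u` are tagged with
  -- `u`.
  obtain ⟨c, hc⟩ := hM.isModel.choice
    (img (fun u => img (fun z => opair u z) (sep N (fun z => R u z)))
      (sep U fun u => ∃ z, R u z)) (by
      intro y hy
      obtain ⟨u, hu, rfl⟩ := mem_img.1 hy
      rw [mem_sep] at hu
      obtain ⟨z, hz⟩ := hN u hu.1 hu.2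
      exact ⟨_, (hmem _ _).2 ⟨z, hz, rfl⟩⟩) (by
      intro y y' e hy hy' he he'
      obtain ⟨u, hu, rfl⟩ := mem_img.1 hy
      obtain ⟨u', hu', rfl⟩ := mem_img.1 hy'
      obtain ⟨z, -, rfl⟩ := (hmem _ _).1 he
      obtain ⟨z', -, h⟩ := (hmem _ _).1 he'
      rw [opair_inj] at h
      rw [h.1])
  refine ⟨lam U fun u => the fun z => (z ε N ∧ R u z) ∧ opair u z ε c, isFunOn_lam,
    fun u hu hz => ?_⟩
  rw [app_lam hu]
  obtain ⟨e, ⟨he, hec⟩, huniq⟩ := hc _ (mem_img.2 ⟨u, mem_sep.2 ⟨hu, hz⟩, rfl⟩)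
  obtain ⟨z, hz, rfl⟩ := (hmem _ _).1 he
  have : ∃! z, (z ε N ∧ R u z) ∧ opair u z ε c :=
    ⟨z, ⟨hz, hec⟩, fun z' hz' =>
      (opair_inj.1 (huniq (opair u z') ⟨(hmem _ _).2 ⟨z', hz'.1, rfl⟩, hz'.2⟩)).2⟩
  exact (the_spec this).1.2

end Internal

end

section

open FirstOrder Language

/-! ### Sets covered by a given set -/

set_option linter.unusedSectionVars false

namespace Internal

local infix:50 " ε " => Mem

variable {M : Type v} [setLang.Structure M] [hM : ModelZFC M]

/-- The first component of an ordered pair. -/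
noncomputable def fst (p : M) : M := the fun x => ∃ y, p = opair x y

/-- The second component of an ordered pair. -/
noncomputable def snd (p : M) : M := the fun y => ∃ x, p = opair x y

/-- There is a function on `Z` whose range includes `t`. -/
def Cov (Z t : M) : Prop := ∃ f, ∀ y, y ε t → ∃ z, z ε Z ∧ app f z = y

section

variable {Γ : Type} [Finite Γ] {a b : (Γ → M) → M} [DF a] [DF b]

instance : DF (fun v => fst (a v)) := by unfold fst; infer_instance
instance : DF (fun v => snd (a v)) := by unfold snd; infer_instance
instance : Dfn (fun v => Cov (a v) (b v)) := by unfold Cov; infer_instance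

end

@[simp] theorem fst_opair (x y : M) : fst (opair x y) = x :=
  the_eq ⟨y, rfl⟩ fun _ ⟨_, h⟩ => (opair_inj.1 h).1.symm

@[simp] theorem snd_opair (x y : M) : snd (opair x y) = y :=
  the_eq ⟨x, rfl⟩ fun _ ⟨_, h⟩ => (opair_inj.1 h).2.symm

namespace Cov

variable {Z s t : M}

theorem of_fun (F : M → M) [Fun1 F] (h : ∀ y, y ε t → ∃ z, z ε Z ∧ F z = y) : Cov Z t :=
  ⟨lam Z F, fun y hy => by
    obtain ⟨z, hz, e⟩ := h y hy
    exact ⟨z, hz, by rwa [app_lam hz]⟩⟩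

theorem of_sub (h : Sub t Z) : Cov Z t := of_fun (fun z => z) fun y hy => ⟨y, h y hy, rfl⟩

theorem mono (h : Cov Z t) (hs : Sub s t) : Cov Z s := h.imp fun _ hf y hy => hf y (hs y hy)

theorem trans (h : Cov Z t) (h' : Cov t s) : Cov Z s := by
  obtain ⟨f, hf⟩ := h
  obtain ⟨g, hg⟩ := h'
  refine of_fun (fun z => app g (app f z)) fun y hy => ?_
  obtain ⟨w, hw, rfl⟩ := hg y hy
  obtain ⟨z, hz, rfl⟩ := hf w hw
  exact ⟨z, hz, rfl⟩

theorem img (h : Cov Z t) (F : M → M) [Fun1 F] : Cov Z (img F t) := by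
  refine h.trans (of_fun F fun y hy => ?_)
  obtain ⟨z, hz, rfl⟩ := mem_img.1 hy
  exact ⟨z, hz, rfl⟩

theorem of_isFunOn {f d : M} (hf : IsFunOn f d) (h : Cov Z d) : Cov Z f := by
  refine (h.img fun x => opair x (app f x)).mono fun z hz => mem_img.2 ?_
  exact hf.mem_iff.1 hz

end Cov

/-- `Z` contains the natural numbers and is closed under ordered pairs. -/
structure Ample (Z : M) : Prop where
  nat : ∀ n, IsNat n → n ε Z
  opair : ∀ a b, a ε Z → b ε Z → opair a b ε Z

namespace Ample

variable {Z s t : M}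

theorem cov_upair (hZ : Ample Z) (a b : M) : Cov Z (upair a b) := by
  classical
  refine .of_fun (fun z => if z = emp then a else b) fun y hy => ?_
  rcases mem_upair.1 hy with rfl | rfl
  · exact ⟨emp, hZ.nat _ isNat_emp, if_pos rfl⟩
  · refine ⟨succ emp, hZ.nat _ isNat_emp.succ, if_neg fun h => ?_⟩
    exact not_mem_emp (h ▸ mem_succ_self (emp : M))

/-- Choose a covering of every `y` in `x` at once; an element of the union is then labelled by a
pair of elements of `Z`, which is again in `Z`. -/
theorem cov_sUn (hZ : Ample Z) {x : M} (hx : Cov Z x) (h : ∀ y, y ε x → Cov Z y) :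
    Cov Z (sUn x) := by
  obtain ⟨f, hf⟩ := hx
  obtain ⟨g, -, hg⟩ := exists_choice x (fun y g => ∀ w, w ε y → ∃ z, z ε Z ∧ app g z = w)
  refine .of_fun (fun z => app (app g (app f (fst z))) (snd z)) fun w hw => ?_
  obtain ⟨y, hy, hw⟩ := mem_sUn.1 hw
  obtain ⟨z₁, h1, h2⟩ := hf y hy
  obtain ⟨z₂, h3, h4⟩ := hg y hy (h y hy) w hw
  refine ⟨_, hZ.opair z₁ z₂ h1 h3, ?_⟩
  simp only [fst_opair, snd_opair, h2, h4]

theorem cov_un (hZ : Ample Z) (hs : Cov Z s) (ht : Cov Z t) : Cov Z (un s t) := by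
  refine (hZ.cov_sUn (hZ.cov_upair s t) fun y hy => ?_).mono fun z hz => ?_
  · rcases mem_upair.1 hy with rfl | rfl
    · exact hs
    · exact ht
  · rcases mem_un.1 hz with h | h
    · exact mem_sUn.2 ⟨s, by simp, h⟩
    · exact mem_sUn.2 ⟨t, by simp, h⟩

theorem cov_om (hZ : Ample Z) : Cov Z om := .of_sub fun n hn => hZ.nat n (mem_om.1 hn)

end Ample

/-- `t` is a transitive set, `f` maps `Z` onto `t`, and `E` is the preimage of membership. -/
def Presents (Z E t : M) : Prop :=
  IsTrans t ∧ ∃ f, (∀ y, y ε t → ∃ z, z ε Z ∧ app f z = y) ∧ (∀ z, z ε Z → app f z ε t) ∧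
    ∀ z w, z ε Z → w ε Z → (opair z w ε E ↔ app f z ε app f w)

instance {Γ : Type} [Finite Γ] {a b c : (Γ → M) → M} [DF a] [DF b] [DF c] :
    Dfn (fun v => Presents (a v) (b v) (c v)) := by
  unfold Presents; infer_instance

/-- Two transitive sets with the same pattern of membership on `Z` are equal: by ∈-induction on the
values, the two coverings agree on `Z`. -/
theorem Presents.unique {Z E t t' : M} (h : Presents Z E t) (h' : Presents Z E t') : t = t' := by
  obtain ⟨ht, f, h1, h2, h3⟩ := h
  obtain ⟨ht', f', h1', h2', h3'⟩ := h'
  have key : ∀ y, ∀ z, z ε Z → app f z = y → app f' z = y := by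
    refine mem_induction (P := fun y => ∀ z, z ε Z → app f z = y → app f' z = y) ?_
    rintro _ ih z hz rfl
    refine ext fun w => ⟨fun hw => ?_, fun hw => ?_⟩
    · obtain ⟨z₁, hz₁, rfl⟩ := h1' w (ht' _ (h2' z hz) w hw)
      have := (h3 z₁ z hz₁ hz).1 ((h3' z₁ z hz₁ hz).2 hw)
      rwa [ih _ this z₁ hz₁ rfl]
    · obtain ⟨z₁, hz₁, rfl⟩ := h1 w (ht _ (h2 z hz) w hw)
      rw [← ih _ hw z₁ hz₁ rfl]
      exact (h3' z₁ z hz₁ hz).1 ((h3 z₁ z hz₁ hz).2 hw)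
  refine ext fun y => ⟨fun hy => ?_, fun hy => ?_⟩
  · obtain ⟨z, hz, rfl⟩ := h1 y hy
    rw [← key _ z hz rfl]
    exact h2' z hz
  · obtain ⟨z, hz, rfl⟩ := h1' y hy
    rw [key _ z hz rfl]
    exact h2 z hz

theorem Cov.presents {Z t y : M} (ht : IsTrans t) (h : Cov Z t) (hy : y ε t) :
    ∃ E, Sub E (prod Z Z) ∧ Presents Z E t := by
  classical
  obtain ⟨f, hf⟩ := h
  -- Values of the covering outside `t` are redirected to `y`, which makes it a map onto `t`.
  have hF : ∀ z, z ε Z → app (lam Z fun z => if app f z ε t then app f z else y) z =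
      if app f z ε t then app f z else y := fun z hz => app_lam hz
  generalize lam Z (fun z => if app f z ε t then app f z else y) = g at hF
  refine ⟨sep (prod Z Z) fun e => app g (fst e) ε app g (snd e), fun z hz => (mem_sep.1 hz).1, ht,
    g, fun w hw => ?_, fun z hz => ?_, fun z w hz hw => ?_⟩
  · obtain ⟨z, hz, rfl⟩ := hf w hw
    exact ⟨z, hz, by rw [hF z hz, if_pos hw]⟩
  · rw [hF z hz]
    split_ifs with h
    exacts [h, hy]
  · rw [mem_sep, fst_opair, snd_opair, mem_prod]
    exact ⟨fun h => h.2, fun h => ⟨⟨z, w, hz, hw, rfl⟩, h⟩⟩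

/-- The set of all elements of transitive sets covered by `Z`: the sets that are hereditarily of
size at most the size of `Z`. -/
noncomputable def her (Z : M) : M := cmp fun y => ∃ t, IsTrans t ∧ Cov Z t ∧ y ε t

/-- A transitive set covered by `Z` is determined by a relation on `Z`, so replacement on the power
set of `Z × Z` shows that these transitive sets form a set. -/
theorem mem_her {Z y : M} : y ε her Z ↔ ∃ t, IsTrans t ∧ Cov Z t ∧ y ε t := by
  obtain ⟨T, hT⟩ := exists_image_rel (pow (prod Z Z)) (fun E t => Presents Z E t)
    fun _ _ _ _ => Presents.unique
  refine mem_cmp_of_sub (sUn T) fun y ⟨t, h1, h2, h3⟩ => mem_sUn.2 ⟨t, ?_, h3⟩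
  obtain ⟨E, h4, h5⟩ := h2.presents h1 h3
  exact (hT t).2 ⟨E, mem_pow.2 h4, h5⟩

theorem isTrans_her (Z : M) : IsTrans (her Z) := by
  intro y hy z hz
  obtain ⟨t, h1, h2, h3⟩ := mem_her.1 hy
  exact mem_her.2 ⟨t, h1, h2, h1 y h3 z hz⟩

namespace Ample

variable {Z : M}

/-- Choose small transitive sets around the elements of `x`; their union, with `x` added, is
transitive and still small. -/
theorem mem_her (hZ : Ample Z) {x : M} (hx : Cov Z x) (h : Sub x (her Z)) : x ε her Z := by
  obtain ⟨g, -, hg⟩ := exists_choice x (fun y t => IsTrans t ∧ Cov Z t ∧ y ε t)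
  have hg' := fun y hy => hg y hy (Internal.mem_her.1 (h y hy))
  refine Internal.mem_her.2 ⟨un (sUn (img (app g) x)) (upair x x), ?_, ?_, by simp⟩
  · intro y hy z hz
    refine mem_un.2 (.inl (mem_sUn.2 ?_))
    rcases mem_un.1 hy with hy | hy
    · obtain ⟨_, ht, hy⟩ := mem_sUn.1 hy
      obtain ⟨w, hw, rfl⟩ := mem_img.1 ht
      exact ⟨_, ht, (hg' w hw).1 y hy z hz⟩
    · have : y = x := by simpa using hy
      subst this
      exact ⟨_, mem_img.2 ⟨z, hz, rfl⟩, (hg' z hz).2.2⟩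
  · refine hZ.cov_un (hZ.cov_sUn (hx.img _) fun t ht => ?_) (hZ.cov_upair _ _)
    obtain ⟨w, hw, rfl⟩ := mem_img.1 ht
    exact (hg' w hw).2.1

theorem upair_mem_her (hZ : Ample Z) {a b : M} (ha : a ε her Z) (hb : b ε her Z) :
    upair a b ε her Z :=
  hZ.mem_her (hZ.cov_upair a b) fun y hy => by
    rcases mem_upair.1 hy with rfl | rfl
    exacts [ha, hb]

theorem her (hZ : Ample Z) : Ample (her Z) where
  nat _ hn := Internal.mem_her.2 ⟨om, fun _ hn _ hm => mem_om.2 ((mem_om.1 hn).mem hm), hZ.cov_om,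
    mem_om.2 hn⟩
  opair _ _ ha hb := hZ.upair_mem_her (hZ.upair_mem_her ha ha) (hZ.upair_mem_her ha hb)

theorem isFunOn_mem_her (hZ : Ample Z) {f d : M} (hf : IsFunOn f d) (hd : Cov Z d)
    (hd' : Sub d (Internal.her Z)) (h : ∀ x, x ε d → app f x ε Internal.her Z) :
    f ε Internal.her Z :=
  hZ.mem_her (.of_isFunOn hf hd) fun z hz => by
    obtain ⟨x, hx, rfl⟩ := hf.mem_iff.1 hz
    exact hZ.her.opair _ _ (hd' x hx) (h x hx)

end Ample

/-- The recursion step of the closure of a set under ordered pairs. -/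
noncomputable def pairStep (S n : M) (F : M → M) : M :=
  un S (sUn (img (fun m => prod (F m) (F m)) n))

instance (S : M) : DefRec (pairStep S) := by
  have : DF (fun v : Fin 2 → M => pairStep S (v 0) (app (v 1))) := by
    unfold pairStep; infer_instance
  infer_instance

/-- Close `S ∪ ω` under pairs in `ω` stages. The stages increase, so any two elements occur at a
common one. -/
theorem exists_ample (S : M) : ∃ Z, Ample Z ∧ Sub S Z := by
  have hu : ∀ n z, z ε recur (pairStep (un S om)) n ↔
      z ε un S om ∨ ∃ m, m ε n ∧ z ε prod (recur (pairStep (un S om)) m)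
        (recur (pairStep (un S om)) m) := by
    intro n z
    rw [recur_eq fun x F F' h => ?_]
    · simp only [pairStep, mem_un (x := un S om), mem_sUn, mem_img]
      refine or_congr_right ⟨?_, ?_⟩
      · rintro ⟨_, ⟨m, hm, rfl⟩, h⟩
        exact ⟨m, hm, h⟩
      · rintro ⟨m, hm, h⟩
        exact ⟨_, ⟨m, hm, rfl⟩, h⟩
    · exact congrArg (fun t => un _ (sUn t)) (img_congr fun y hy => by rw [h y (.of_mem hy)])
  have hF : Fun1 (recur (pairStep (un S om))) := inferInstance
  generalize recur (pairStep (un S om)) = u at hu hF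
  have hmono : ∀ m n, Sub m n → Sub (u m) (u n) := by
    intro m n h z hz
    rw [hu] at hz ⊢
    exact hz.imp_right fun ⟨k, hk, h1⟩ => ⟨k, h k hk, h1⟩
  have hS : Sub (un S om) (sUn (img u om)) := fun z hz =>
    mem_sUn.2 ⟨u emp, mem_img.2 ⟨emp, mem_om.2 isNat_emp, rfl⟩, (hu _ _).2 (.inl hz)⟩
  refine ⟨sUn (img u om), ⟨fun n hn => hS n (mem_un.2 (.inr (mem_om.2 hn))), ?_⟩,
    fun z hz => hS z (mem_un.2 (.inl hz))⟩
  intro a b ha hb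
  obtain ⟨_, hm', ha⟩ := mem_sUn.1 ha
  obtain ⟨m, hm, rfl⟩ := mem_img.1 hm'
  obtain ⟨_, hn', hb⟩ := mem_sUn.1 hb
  obtain ⟨n, hn, rfl⟩ := mem_img.1 hn'
  rw [mem_om] at hm hn
  obtain ⟨k, hk, h1, h2⟩ : ∃ k, IsNat k ∧ Sub m k ∧ Sub n k := by
    rcases hm.1.trichotomy hn.1 with h | rfl | h
    · exact ⟨n, hn, hn.1.1 m h, fun _ h => h⟩
    · exact ⟨m, hm, fun _ h => h, fun _ h => h⟩
    · exact ⟨m, hm, fun _ h => h, hm.1.1 n h⟩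
  exact mem_sUn.2 ⟨_, mem_img.2 ⟨succ k, mem_om.2 hk.succ, rfl⟩, (hu _ _).2 (.inr ⟨k, mem_succ_self k,
    mem_prod.2 ⟨a, b, hmono _ _ h1 a ha, hmono _ _ h2 b hb, rfl⟩⟩)⟩

end Internal

end

section

open FirstOrder Language

/-! ### Sequences and hulls -/

set_option linter.unusedSectionVars false

namespace Internal

local infix:50 " ε " => Mem

variable {M : Type v} [setLang.Structure M] [hM : ModelZFC M]

/-- The von Neumann numerals of `M`. -/
noncomputable def num : ℕ → M
  | 0 => emp
  | k + 1 => succ (num k)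

@[simp] theorem isNumeral_iff {k : ℕ} {z : M} : IsNumeral k z ↔ z = num k := by
  induction k generalizing z with
  | zero => exact isEmptySet_iff
  | succ k ih => simp [IsNumeral, ih, isSucc_iff, num]

theorem isNat_num (k : ℕ) : IsNat (num k : M) := by
  induction k with
  | zero => exact isNat_emp
  | succ k ih => exact ih.succ

theorem num_mem_num {i j : ℕ} (h : i < j) : (num i : M) ε num j := by
  induction j, h using Nat.le_induction with
  | base => exact mem_succ_self _
  | succ j _ ih => exact mem_succ.2 (.inl ih)

@[simp] theorem num_inj {i j : ℕ} : (num i : M) = num j ↔ i = j := by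
  refine ⟨fun h => ?_, fun h => by rw [h]⟩
  by_contra hne
  rcases Nat.lt_or_gt_of_ne hne with h1 | h1
  · exact not_mem_self (num j : M) (by simpa [h] using num_mem_num (M := M) h1)
  · exact not_mem_self (num j : M) (by simpa [h] using num_mem_num (M := M) h1)

open Classical in
/-- The sequence `s` with the value at `n` replaced by `z`. -/
noncomputable def upd (s n z : M) : M := lam om fun m => if m = n then z else app s m

instance {Γ : Type} [Finite Γ] {a b c : (Γ → M) → M} [DF a] [DF b] [DF c] :
    DF (fun v => upd (a v) (b v) (c v)) := by
  unfold upd; infer_instance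

theorem isFunOn_upd {s n z : M} : IsFunOn (upd s n z) om := by
  classical
  exact isFunOn_lam

theorem app_upd_self {s n z : M} (hn : IsNat n) : app (upd s n z) n = z := by
  classical
  rw [upd, app_lam (mem_om.2 hn), if_pos rfl]

theorem app_upd_of_ne {s n z m : M} (hm : IsNat m) (h : m ≠ n) : app (upd s n z) m = app s m := by
  classical
  rw [upd, app_lam (mem_om.2 hm), if_neg h]

theorem isAssignment_iff {s a : M} :
    IsAssignment s a ↔ IsFunOn s om ∧ ∀ n, IsNat n → app s n ε a := by
  constructor
  · rintro ⟨⟨w, hw, hs⟩, h⟩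
    obtain rfl : w = om := ext fun n => (hw n).trans mem_om.symm
    exact ⟨hs, fun n hn => h n _ (app_iff.2 (hs.opair_mem (mem_om.2 hn)))⟩
  · rintro ⟨hs, h⟩
    refine ⟨⟨om, fun n => mem_om, hs⟩, fun n x hx => ?_⟩
    rw [app_iff, hs.opair_mem_iff] at hx
    rw [hx.2]
    exact h n (mem_om.1 hx.1)

theorem IsAssignment.upd {s a n z : M} (hs : IsAssignment s a) (hz : z ε a) :
    IsAssignment (upd s n z) a := by
  refine isAssignment_iff.2 ⟨isFunOn_upd, fun m hm => ?_⟩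
  by_cases h : m = n
  · subst h
    rwa [app_upd_self hm]
  · rw [app_upd_of_ne hm h]
    exact (isAssignment_iff.1 hs).2 m hm

theorem exists_isAssignment {X e : M} (he : e ε X) {m : ℕ} (f : Fin m → M) (hf : ∀ i, f i ε X) :
    ∃ s, IsAssignment s X ∧ ∀ i : Fin m, app s (num i) = f i := by
  induction m with
  | zero =>
    exact ⟨lam om fun _ => e, isAssignment_iff.2 ⟨isFunOn_lam, fun n hn => by
      rwa [app_lam (mem_om.2 hn)]⟩, fun i => i.elim0⟩
  | succ m ih =>
    obtain ⟨s, h1, h2⟩ := ih (fun i => f i.castSucc) fun i => hf _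
    refine ⟨Internal.upd s (num m) (f (Fin.last m)), h1.upd (hf _), fun i => ?_⟩
    refine Fin.lastCases ?_ (fun i => ?_) i
    · exact app_upd_self (isNat_num _)
    · rw [app_upd_of_ne (isNat_num _) (by simpa using i.2.ne)]
      exact h2 i

theorem exists_forall_mem {m : ℕ} (f : Fin m → M) : ∃ u, ∀ i, f i ε u := by
  induction m with
  | zero => exact ⟨emp, fun i => i.elim0⟩
  | succ m ih =>
    obtain ⟨u, hu⟩ := ih fun i => f i.castSucc
    refine ⟨un u (upair (f (Fin.last m)) (f (Fin.last m))), fun i => ?_⟩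
    refine Fin.lastCases ?_ (fun i => ?_) i
    · simp
    · exact mem_un.2 (.inl (hu i))

/-- The recursion step of the hull construction. -/
noncomputable def hullStep (g e x : M) (F : M → M) : M :=
  open Classical in
  -- The empty set codes `e`, and `⟨c, σ⟩` codes the value of `g` at `c` and the sequence coded by
  -- `σ`. The test `Below` makes the step local at every `x`; it always succeeds when `σ` is a
  -- function on `ω`.
  if x = emp then e else app g (opair (fst x) (lam om fun n =>
    if Below (app (snd x) n) x then F (app (snd x) n) else emp))

instance (g e : M) : DefRec (hullStep g e) := by
  classical
  have : DF (fun v : Fin 2 → M => hullStep g e (v 0) (app (v 1))) := by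
    unfold hullStep; infer_instance
  infer_instance

theorem below_opair_left (x y : M) : Below x (opair x y) :=
  (Below.of_mem (by simp)).trans (.of_mem (show upair x y ε opair x y by simp [opair]))

theorem below_opair_right (x y : M) : Below y (opair x y) :=
  (Below.of_mem (by simp)).trans (.of_mem (show upair x y ε opair x y by simp [opair]))

theorem isLocal_hullStep (g e : M) : IsLocal (hullStep g e) := by
  classical
  intro x F F' h
  unfold hullStep lam
  refine congrArg (fun s => if x = emp then e else app g (opair (fst x) s))
    (img_congr fun n _ => ?_)
  beta_reduce
  split_ifs with hn
  · rw [h _ hn]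
  · rfl

theorem recur_hullStep_emp (g e : M) : recur (hullStep g e) emp = e := by
  rw [recur_eq (isLocal_hullStep g e), hullStep, if_pos rfl]

theorem opair_ne_emp (x y : M) : opair x y ≠ emp := fun h =>
  not_mem_emp (h ▸ show upair x y ε opair x y by simp [opair])

theorem recur_hullStep {g e c s : M} (hs : IsFunOn s om) :
    recur (hullStep g e) (opair c s) =
      app g (opair c (lam om fun n => recur (hullStep g e) (app s n))) := by
  classical
  rw [recur_eq (isLocal_hullStep g e), hullStep, if_neg (opair_ne_emp c s), fst_opair, snd_opair]
  unfold lam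
  refine congrArg (fun s => app g (opair c s)) (img_congr fun n hn => ?_)
  beta_reduce
  rw [if_pos ((below_opair_right n _).trans ((Below.of_mem (hs.opair_mem hn)).trans
    (below_opair_right c s)))]

/-- `X` is the set of values in `N` coded in `her Z`. Since `her Z` is closed under `ω`-sequences,
the codes of the entries of an assignment can be chosen as one `σ` in `her Z`, and `⟨c, σ⟩` codes
the chosen witness. A single recursion thus closes `X` under functions of infinite sequences. -/
theorem exists_hull_of_rel {Z N e : M} (he : e ε N) (hZ : Ample Z) (R : M → M → M → Prop) [Def3 R] :
    ∃ X, e ε X ∧ Sub X N ∧ Cov (her Z) X ∧ ∀ c s, c ε her Z → IsAssignment s X →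
      (∃ z, z ε N ∧ R c s z) → ∃ z, z ε X ∧ R c s z := by
  obtain ⟨g, -, hg⟩ := exists_choice (prod (her Z) (pow (prod om N)))
    (fun u z => z ε N ∧ R (fst u) (snd u) z)
  let G : M → M := recur (hullStep g e)
  have hG : Fun1 G := inferInstance
  refine ⟨sep (img G (her Z)) fun z => z ε N, mem_sep.2 ⟨mem_img.2 ⟨emp, hZ.her.nat _ isNat_emp,
    (recur_hullStep_emp g e).symm⟩, he⟩, fun z hz => (mem_sep.1 hz).2,
    ((Cov.of_sub fun _ h => h).img G).mono fun z hz => (mem_sep.1 hz).1, ?_⟩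
  intro c s hc hs hz
  rw [isAssignment_iff] at hs
  obtain ⟨σ, hσ, hσ'⟩ := exists_choice om fun n k => k ε her Z ∧ app s n = G k
  have hσ'' : ∀ n, IsNat n → app σ n ε her Z ∧ app s n = G (app σ n) := fun n hn =>
    hσ' n (mem_om.2 hn) (mem_img.1 (mem_sep.1 (hs.2 n hn)).1)
  have hσZ : σ ε her Z := hZ.isFunOn_mem_her hσ hZ.cov_om
    (fun n hn => hZ.her.nat n (mem_om.1 hn)) fun n hn => (hσ'' n (mem_om.1 hn)).1
  have hσs : lam om (fun n => G (app σ n)) = s := isFunOn_lam.ext hs.1 fun n hn => by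
    rw [app_lam hn, (hσ'' n (mem_om.1 hn)).2]
  have hGe : G (opair c σ) = app g (opair c s) := by
    rw [← hσs]
    exact recur_hullStep hσ
  have := hg (opair c s) (mem_prod.2 ⟨c, s, hc, mem_pow.2 fun e he => by
    obtain ⟨n, hn, rfl⟩ := hs.1.mem_iff.1 he
    exact mem_prod.2 ⟨n, _, hn, (mem_sep.1 (hs.2 n (mem_om.1 hn))).2, rfl⟩, rfl⟩)
    (by simpa using hz)
  rw [← hGe, fst_opair, snd_opair] at this
  exact ⟨_, mem_sep.2 ⟨mem_img.2 ⟨_, hZ.her.opair _ _ hc hσZ, rfl⟩, this.1⟩, this.2⟩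

/-- Finitely many relations are merged into one by tagging the parameter: a first component `emp`
selects the head of the list, any other the rest. -/
theorem exists_combined_rel (Rs : List (M → M → M → Prop)) (hRs : ∀ R ∈ Rs, Def3 R) :
    ∃ R : M → M → M → Prop, Def3 R ∧ ∀ K, Ample K → ∀ R' ∈ Rs, ∀ c, c ε K →
      ∃ c', c' ε K ∧ ∀ s z, R c' s z ↔ R' c s z := by
  induction Rs with
  | nil => exact ⟨fun _ _ _ => False, inferInstance, by simp⟩
  | cons R₀ Rs ih =>
    obtain ⟨R₁, h1, h2⟩ := ih fun R hR => hRs R (by simp [hR])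
    have h0 := hRs R₀ (by simp)
    refine ⟨fun c s z => (fst c = emp ∧ R₀ (snd c) s z) ∨ (fst c ≠ emp ∧ R₁ (snd c) s z),
      inferInstance, fun K hK R' hR' c hc => ?_⟩
    rcases List.mem_cons.1 hR' with rfl | hR'
    · exact ⟨opair emp c, hK.opair _ _ (hK.nat _ isNat_emp) hc, by simp⟩
    · obtain ⟨c', hc', h3⟩ := h2 K hK R' hR' c hc
      have : (succ emp : M) ≠ emp := fun h => not_mem_emp (h ▸ mem_succ_self (emp : M))
      exact ⟨opair (succ emp) c', hK.opair _ _ (hK.nat _ isNat_emp.succ) hc', by simp [this, h3]⟩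

/-- A small set that is closed under Skolem functions for finitely many relations. -/
theorem exists_hull {Z N e : M} (he : e ε N) (hZ : Ample Z) (Rs : List (M → M → M → Prop))
    (hRs : ∀ R ∈ Rs, Def3 R) :
    ∃ X, e ε X ∧ Sub X N ∧ Cov (her Z) X ∧ ∀ R ∈ Rs, ∀ c s, c ε her Z → IsAssignment s X →
      (∃ z, z ε N ∧ R c s z) → ∃ z, z ε X ∧ R c s z := by
  obtain ⟨R, hR, h⟩ := exists_combined_rel Rs hRs
  obtain ⟨X, h0, h1, h2, h3⟩ := exists_hull_of_rel he hZ R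
  refine ⟨X, h0, h1, h2, fun R' hR' c s hc hs hz => ?_⟩
  obtain ⟨c', hc', h4⟩ := h _ hZ.her R' hR' c hc
  simp only [← h4] at hz ⊢
  exact h3 c' s hc' hs hz

end Internal

end

section

open FirstOrder Language

/-! ### Formula codes and satisfaction -/

set_option linter.unusedSectionVars false

namespace Internal

local infix:50 " ε " => Mem

variable {M : Type v} [setLang.Structure M] [hM : ModelZFC M]

/-- The composition `f ∘ g` of two functions, where `g` has domain `d`. -/
noncomputable def comp (d f g : M) : M := lam d fun x => app f (app g x)

instance {Γ : Type} [Finite Γ] {a b c : (Γ → M) → M} [DF a] [DF b] [DF c] :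
    DF (fun v => comp (a v) (b v) (c v)) := by
  unfold comp; infer_instance

theorem app_comp {d f g x : M} (hx : x ε d) : app (comp d f g) x = app f (app g x) := app_lam hx

theorem isFunOn_comp {d f g : M} : IsFunOn (comp d f g) d := isFunOn_lam

theorem isComp_iff {d e f g h : M} (hg : IsFunOn g d) (hf : IsFunOn f e)
    (hge : ∀ x, x ε d → app g x ε e) : IsComp h f g ↔ h = comp d f g := by
  have key : ∀ z, (∃ k y x, App g k y ∧ App f y x ∧ IsOPair z k x) ↔ z ε comp d f g := by
    intro z
    simp only [app_iff, isOPair_iff, hg.opair_mem_iff, hf.opair_mem_iff, comp, mem_lam]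
    constructor
    · rintro ⟨k, y, x, ⟨hk, rfl⟩, ⟨-, rfl⟩, rfl⟩
      exact ⟨k, hk, rfl⟩
    · rintro ⟨k, hk, rfl⟩
      exact ⟨k, _, _, ⟨hk, rfl⟩, ⟨hge k hk, rfl⟩, rfl⟩
  constructor
  · exact fun H => ext fun z => (H z).trans (key z)
  · rintro rfl z
    exact (key z).symm

@[simp] theorem isTagged_iff {k : ℕ} {c q : M} : IsTagged k c q ↔ c = opair (num k) q := by
  simp [IsTagged]

@[simp] theorem isTaggedPair_iff {k : ℕ} {c x y : M} :
    IsTaggedPair k c x y ↔ c = opair (num k) (opair x y) := by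
  simp [IsTaggedPair]

namespace IsFormulaSet

variable {τ F : M}

/-- The numerals used as tags are distinct, so a code determines its outermost constructor and its
components; likewise in the next lemmas. -/
theorem eq_code (hF : IsFormulaSet τ F) {m n : M} (h : opair (num 0) (opair m n) ε F) :
    IsNat m ∧ IsNat n := by
  have := hF _ h
  simp only [IsEqCode, IsRelCode, IsNegCode, IsAndCode, IsExCode, isTaggedPair_iff, isTagged_iff,
    opair_inj, num_inj] at this
  aesop

theorem rel_code (hF : IsFormulaSet τ F) {i w : M} (h : opair (num 1) (opair i w) ε F) :
    ∃ n, opair i n ε τ ∧ IsFunOn w n ∧ ∀ k, k ε n → IsNat (app w k) := by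
  have := hF _ h
  simp only [IsEqCode, IsRelCode, IsNegCode, IsAndCode, IsExCode, isTaggedPair_iff, isTagged_iff,
    opair_inj, num_inj, app_iff] at this
  rcases this with ⟨m, n, -, -, h, -⟩ | ⟨i', n, w', h1, h2, h3, -, rfl, rfl⟩ | ⟨d, -, h, -⟩ |
    ⟨d, e, -, -, h, -⟩ | ⟨n, d, -, -, h, -⟩
  · omega
  · exact ⟨n, h1, h2, fun k hk => h3 k _ (h2.opair_mem hk)⟩
  all_goals omega

theorem neg_code (hF : IsFormulaSet τ F) {d : M} (h : opair (num 2) d ε F) : d ε F := by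
  have := hF _ h
  simp only [IsEqCode, IsRelCode, IsNegCode, IsAndCode, IsExCode, isTaggedPair_iff, isTagged_iff,
    opair_inj, num_inj] at this
  aesop

theorem and_code (hF : IsFormulaSet τ F) {d e : M} (h : opair (num 3) (opair d e) ε F) :
    d ε F ∧ e ε F := by
  have := hF _ h
  simp only [IsEqCode, IsRelCode, IsNegCode, IsAndCode, IsExCode, isTaggedPair_iff, isTagged_iff,
    opair_inj, num_inj] at this
  aesop

theorem ex_code (hF : IsFormulaSet τ F) {n d : M} (h : opair (num 4) (opair n d) ε F) :
    IsNat n ∧ d ε F := by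
  have := hF _ h
  simp only [IsEqCode, IsRelCode, IsNegCode, IsAndCode, IsExCode, isTaggedPair_iff, isTagged_iff,
    opair_inj, num_inj] at this
  aesop

theorem cases (hF : IsFormulaSet τ F) {c : M} (hc : c ε F) :
    (∃ m n, c = opair (num 0) (opair m n)) ∨ (∃ i w, c = opair (num 1) (opair i w)) ∨
    (∃ d, c = opair (num 2) d) ∨ (∃ d e, c = opair (num 3) (opair d e)) ∨
    ∃ n d, c = opair (num 4) (opair n d) := by
  have := hF _ hc
  simp only [IsEqCode, IsRelCode, IsNegCode, IsAndCode, IsExCode, isTaggedPair_iff,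
    isTagged_iff] at this
  rcases this with ⟨m, n, -, -, h⟩ | ⟨i', n, w', -, -, -, h⟩ | ⟨d, -, h⟩ |
    ⟨d, e, -, -, h⟩ | ⟨n, d, -, -, h⟩
  · exact .inl ⟨_, _, h⟩
  · exact .inr (.inl ⟨_, _, h⟩)
  · exact .inr (.inr (.inl ⟨_, h⟩))
  · exact .inr (.inr (.inr (.inl ⟨_, _, h⟩)))
  · exact .inr (.inr (.inr (.inr ⟨_, _, h⟩)))

end IsFormulaSet

theorem exists_update_iff {s a n : M} (hs : IsAssignment s a) (hn : IsNat n) {Q : M → Prop} :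
    (∃ s', IsAssignment s' a ∧ (∀ m x, m ≠ n → (App s' m x ↔ App s m x)) ∧ Q s') ↔
      ∃ z, z ε a ∧ Q (upd s n z) := by
  have hs' := isAssignment_iff.1 hs
  constructor
  · rintro ⟨s', h1, h2, h3⟩
    rw [isAssignment_iff] at h1
    refine ⟨app s' n, h1.2 n hn, ?_⟩
    rwa [isFunOn_upd.ext h1.1 fun m hm => ?_]
    by_cases h : m = n
    · subst h
      exact app_upd_self hn
    · rw [app_upd_of_ne (mem_om.1 hm) h]
      have := (h2 m (app s m) h).2 (app_iff.2 (hs'.1.opair_mem hm))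
      rw [app_iff, h1.1.opair_mem_iff] at this
      exact this.2
  · rintro ⟨z, hz, h⟩
    refine ⟨_, hs.upd hz, fun m x hm => ?_, h⟩
    simp only [app_iff, isFunOn_upd.opair_mem_iff, hs'.1.opair_mem_iff]
    refine and_congr_right fun hm' => ?_
    rw [app_upd_of_ne (mem_om.1 hm') hm]

namespace IsSatisfaction

variable {a r F T s : M}

theorem eq_iff (hT : IsSatisfaction a r F T) (hs : IsAssignment s a) {m n : M}
    (h : opair (num 0) (opair m n) ε F) (hm : IsNat m) (hn : IsNat n) :
    opair (opair (num 0) (opair m n)) s ε T ↔ app s m = app s n := by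
  have hs' := (isAssignment_iff.1 hs).1
  rw [← app_iff, (hT _ s h hs).1 m n (isTaggedPair_iff.2 rfl)]
  simp only [app_iff, hs'.opair_mem_iff, mem_om, hm, hn, true_and]
  exact ⟨fun ⟨x, h1, h2⟩ => h1.symm.trans h2, fun h => ⟨_, rfl, h⟩⟩

theorem rel_iff (hT : IsSatisfaction a r F T) (hs : IsAssignment s a) {i w n : M}
    (h : opair (num 1) (opair i w) ε F) (hw : IsFunOn w n) (hw' : ∀ k, k ε n → IsNat (app w k)) :
    opair (opair (num 1) (opair i w)) s ε T ↔ ∃ X, opair i X ε r ∧ comp n s w ε X := by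
  have hs' := (isAssignment_iff.1 hs).1
  rw [← app_iff, (hT _ s h hs).2.1 i w (isTaggedPair_iff.2 rfl)]
  simp only [app_iff, isComp_iff hw hs' fun k hk => mem_om.2 (hw' k hk)]
  exact exists_congr fun X => ⟨fun ⟨t, h1, h2, h3⟩ => ⟨h1, h2 ▸ h3⟩, fun h => ⟨_, h.1, rfl, h.2⟩⟩

theorem neg_iff (hT : IsSatisfaction a r F T) (hs : IsAssignment s a) {d : M}
    (h : opair (num 2) d ε F) : opair (opair (num 2) d) s ε T ↔ ¬ opair d s ε T := by
  simpa using (hT _ s h hs).2.2.1 d (isTagged_iff.2 rfl)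

theorem and_iff (hT : IsSatisfaction a r F T) (hs : IsAssignment s a) {d e : M}
    (h : opair (num 3) (opair d e) ε F) :
    opair (opair (num 3) (opair d e)) s ε T ↔ opair d s ε T ∧ opair e s ε T := by
  simpa using (hT _ s h hs).2.2.2.1 d e (isTaggedPair_iff.2 rfl)

theorem ex_iff (hT : IsSatisfaction a r F T) (hs : IsAssignment s a) {n d : M}
    (h : opair (num 4) (opair n d) ε F) (hn : IsNat n) :
    opair (opair (num 4) (opair n d)) s ε T ↔ ∃ z, z ε a ∧ opair d (upd s n z) ε T := by
  rw [← app_iff, (hT _ s h hs).2.2.2.2 n d (isTaggedPair_iff.2 rfl), exists_update_iff hs hn]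
  simp only [app_iff]

/-- The Tarski–Vaught test: a map that preserves atomic formulas and whose range contains enough
witnesses preserves satisfaction. -/
theorem opair_mem_iff {τ F' T' b q j : M} (hF : IsFormulaSet τ F) (hF' : IsFormulaSet τ F')
    (hT : IsSatisfaction b q F T) (hT' : IsSatisfaction a r F' T')
    (hja : ∀ x, x ε b → app j x ε a)
    (hinj : ∀ x y, x ε b → y ε b → app j x = app j y → x = y)
    (hrel : ∀ i n w h, opair i n ε τ → IsFunOn w n → (∀ k, k ε n → IsNat (app w k)) →
      IsAssignment h b → ((∃ X, opair i X ε q ∧ comp n h w ε X) ↔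
        ∃ X, opair i X ε r ∧ comp n (comp om j h) w ε X))
    (hex : ∀ n d h z, IsNat n → d ε F → d ε F' → IsAssignment h b → z ε a →
      opair d (upd (comp om j h) n z) ε T' →
      ∃ y, y ε b ∧ opair d (upd (comp om j h) n (app j y)) ε T')
    {c h : M} (hc : c ε F) (hc' : c ε F') (hh : IsAssignment h b) :
    opair c h ε T ↔ opair c (comp om j h) ε T' := by
  have hcomp : ∀ h, IsAssignment h b → IsAssignment (comp om j h) a := fun h hh =>
    isAssignment_iff.2 ⟨isFunOn_comp, fun n hn => by
      rw [app_comp (mem_om.2 hn)]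
      exact hja _ ((isAssignment_iff.1 hh).2 n hn)⟩
  have hupd : ∀ h n y, comp om j (upd h n y) = upd (comp om j h) n (app j y) := by
    intro h n y
    refine isFunOn_comp.ext isFunOn_upd fun m hm => ?_
    rw [app_comp hm]
    have hm' := mem_om.1 hm
    by_cases hmn : m = n
    · subst hmn
      rw [app_upd_self hm', app_upd_self hm']
    · rw [app_upd_of_ne hm' hmn, app_upd_of_ne hm' hmn, app_comp hm]
  -- Codes of subformulas lie in the transitive closure of the code, so ∈-induction inside `M`
  -- replaces induction on length and covers nonstandard formulas too.
  refine below_induction (P := fun c => c ε F → c ε F' → ∀ h, IsAssignment h b →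
    (opair c h ε T ↔ opair c (comp om j h) ε T')) (fun c ih hc hc' h hh => ?_) c hc hc' h hh
  have hh' := isAssignment_iff.1 hh
  rcases hF.cases hc with ⟨m, n, rfl⟩ | ⟨i, w, rfl⟩ | ⟨d, rfl⟩ | ⟨d, e, rfl⟩ | ⟨n, d, rfl⟩
  · obtain ⟨hm, hn⟩ := hF.eq_code hc
    rw [hT.eq_iff hh hc hm hn, hT'.eq_iff (hcomp h hh) hc' hm hn, app_comp (mem_om.2 hm),
      app_comp (mem_om.2 hn)]
    exact ⟨fun h => by rw [h], hinj _ _ (hh'.2 m hm) (hh'.2 n hn)⟩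
  · obtain ⟨n, hi, hw, hw'⟩ := hF.rel_code hc
    rw [hT.rel_iff hh hc hw hw', hT'.rel_iff (hcomp h hh) hc' hw hw']
    exact hrel i n w h hi hw hw' hh
  · rw [hT.neg_iff hh hc, hT'.neg_iff (hcomp h hh) hc',
      ih d (below_opair_right _ _) (hF.neg_code hc) (hF'.neg_code hc') h hh]
  · rw [hT.and_iff hh hc, hT'.and_iff (hcomp h hh) hc',
      ih d ((below_opair_left _ _).trans (below_opair_right _ _)) (hF.and_code hc).1
        (hF'.and_code hc').1 h hh,
      ih e ((below_opair_right _ _).trans (below_opair_right _ _)) (hF.and_code hc).2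
        (hF'.and_code hc').2 h hh]
  · obtain ⟨hn, hd⟩ := hF.ex_code hc
    have hd' := (hF'.ex_code hc').2
    rw [hT.ex_iff hh hc hn, hT'.ex_iff (hcomp h hh) hc' hn]
    have key : ∀ y, y ε b → (opair d (upd h n y) ε T ↔
        opair d (upd (comp om j h) n (app j y)) ε T') := by
      intro y hy
      rw [ih d ((below_opair_right _ _).trans (below_opair_right _ _)) hd hd' _ (hh.upd hy), hupd]
    constructor
    · rintro ⟨y, hy, hz⟩
      exact ⟨_, hja y hy, (key y hy).1 hz⟩
    · rintro ⟨z, hz, h1⟩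
      obtain ⟨y, hy, h2⟩ := hex n d h z hn hd hd' hh hz h1
      exact ⟨y, hy, (key y hy).2 h2⟩

/-- The Tarski–Vaught lemma for the identity map of `a`. -/
theorem unique {τ F' T' : M} (hF : IsFormulaSet τ F) (hF' : IsFormulaSet τ F')
    (hT : IsSatisfaction a r F T) (hT' : IsSatisfaction a r F' T') {c : M} (hc : c ε F)
    (hc' : c ε F') (hs : IsAssignment s a) : opair c s ε T ↔ opair c s ε T' := by
  have hj : ∀ x, x ε a → app (lam a fun x => x) x = x := fun x hx => app_lam hx
  generalize lam a (fun x => x) = j at hj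
  have hcomp : ∀ h, IsAssignment h a → comp om j h = h := by
    intro h hh
    rw [isAssignment_iff] at hh
    refine isFunOn_comp.ext hh.1 fun n hn => ?_
    rw [app_comp hn, hj _ (hh.2 n (mem_om.1 hn))]
  have := opair_mem_iff hF hF' hT hT' (j := j) (fun x hx => by rwa [hj x hx])
    (fun x y hx hy => by rw [hj x hx, hj y hy]; exact id)
    (fun i n w h _ _ _ hh => by rw [hcomp h hh])
    (fun n d h z _ _ _ _ hz h1 => ⟨z, hz, by rwa [hj z hz]⟩) hc hc' hs
  rwa [hcomp s hs] at this

end IsSatisfaction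

/-- All formula codes are hereditarily small. -/
theorem IsFormulaSet.mem_her {τ F Z : M} (hF : IsFormulaSet τ F) (hZ : Ample Z) (hτ : IsType τ)
    (hτZ : τ ε her Z) {c : M} (hc : c ε F) : c ε her Z := by
  have hK := hZ.her
  have hnum : ∀ k, (num k : M) ε her Z := fun k => hK.nat _ (isNat_num k)
  refine below_induction (P := fun c => c ε F → c ε her Z) (fun c ih hc => ?_) c hc
  rcases hF.cases hc with ⟨m, n, rfl⟩ | ⟨i, w, rfl⟩ | ⟨d, rfl⟩ | ⟨d, e, rfl⟩ | ⟨n, d, rfl⟩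
  · obtain ⟨hm, hn⟩ := hF.eq_code hc
    exact hK.opair _ _ (hnum _) (hK.opair _ _ (hK.nat m hm) (hK.nat n hn))
  · obtain ⟨n, hi, hw, hw'⟩ := hF.rel_code hc
    refine hK.opair _ _ (hnum _) (hK.opair _ _ ?_ ?_)
    · exact (below_opair_left i n).mem_of_isTrans (isTrans_her Z) (isTrans_her Z τ hτZ _ hi)
    · have hn : IsNat n := hτ.2 i n (app_iff.2 hi)
      exact hZ.isFunOn_mem_her hw (.of_sub fun k hk => hZ.nat k (hn.mem hk))
        (fun k hk => hK.nat k (hn.mem hk)) fun k hk => hK.nat _ (hw' k hk)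
  · exact hK.opair _ _ (hnum _) (ih d (below_opair_right _ _) (hF.neg_code hc))
  · exact hK.opair _ _ (hnum _) (hK.opair _ _
      (ih d ((below_opair_left _ _).trans (below_opair_right _ _)) (hF.and_code hc).1)
      (ih e ((below_opair_right _ _).trans (below_opair_right _ _)) (hF.and_code hc).2))
  · obtain ⟨hn, hd⟩ := hF.ex_code hc
    exact hK.opair _ _ (hnum _) (hK.opair _ _ (hK.nat n hn)
      (ih d ((below_opair_right _ _).trans (below_opair_right _ _)) hd))

end Internal

end

section

open FirstOrder Language

/-! ### Small hulls and their collapses -/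

set_option linter.unusedSectionVars false

namespace Internal

local infix:50 " ε " => Mem

variable {M : Type v} [setLang.Structure M] [hM : ModelZFC M]

/-- The recursion step of the transitive collapse of `X`. -/
noncomputable def colStep (X x : M) (F : M → M) : M := img F (sep x fun z => z ε X)

/-- The transitive collapse of `X`. -/
noncomputable def col (X x : M) : M := recur (colStep X) x

instance (X : M) : DefRec (colStep X) := by
  have : DF (fun v : Fin 2 → M => colStep X (v 0) (app (v 1))) := by
    unfold colStep; infer_instance
  infer_instance

instance {Γ : Type} [Finite Γ] {X : M} {a : (Γ → M) → M} [DF a] : DF (fun v => col X (a v)) := by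
  unfold col; infer_instance

theorem mem_col {X x z : M} : z ε col X x ↔ ∃ w, w ε X ∧ w ε x ∧ z = col X w := by
  rw [col, recur_eq fun x F F' h => ?_]
  · simp only [colStep, mem_img, mem_sep]
    exact ⟨fun ⟨w, h, e⟩ => ⟨w, h.2, h.1, e⟩, fun ⟨w, h1, h2, e⟩ => ⟨w, ⟨h2, h1⟩, e⟩⟩
  · exact img_congr fun y hy => h y (.of_mem (mem_sep.1 hy).1)

theorem col_mem {X x z : M} (hz : z ε X) (h : z ε x) : col X z ε col X x :=
  mem_col.2 ⟨z, hz, h, rfl⟩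

/-- The image of `X` under the collapse is transitive and covered by `K`. -/
theorem col_mem_her {K X u : M} (hX : Cov K X) (hu : u ε X) : col X u ε her K := by
  refine mem_her.2 ⟨img (col X) X, fun y hy z hz => ?_, hX.img _, mem_img.2 ⟨u, hu, rfl⟩⟩
  obtain ⟨w, -, rfl⟩ := mem_img.1 hy
  obtain ⟨z, h1, -, rfl⟩ := mem_col.1 hz
  exact mem_img.2 ⟨z, h1, rfl⟩

theorem col_eq_self {K X : M} (hK : IsTrans K) (hKX : Sub K X) {c : M} (hc : c ε K) :
    col X c = c := by
  refine mem_induction (P := fun c => c ε K → col X c = c) (fun c ih hc => ext fun z => ?_) c hc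
  rw [mem_col]
  constructor
  · rintro ⟨w, -, hw, rfl⟩
    rwa [ih w hw (hK c hc w hw)]
  · exact fun hz => ⟨z, hKX z (hK c hc z hz), hz, (ih z hz (hK c hc z hz)).symm⟩

theorem col_upair {X a b : M} (ha : a ε X) (hb : b ε X) :
    col X (upair a b) = upair (col X a) (col X b) := by
  refine ext fun z => ?_
  simp only [mem_col, mem_upair]
  constructor
  · rintro ⟨w, -, rfl | rfl, rfl⟩ <;> simp
  · rintro (rfl | rfl)
    exacts [⟨a, ha, .inl rfl, rfl⟩, ⟨b, hb, .inr rfl, rfl⟩]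

/-- `X` is a subset of the transitive set `N`, includes the set `K`, and is closed under the
operations needed to reflect the structure `⟨a, r⟩` of type `τ`. -/
structure IsSmallHull (K τ a r N X : M) : Prop where
  isTrans : IsTrans N
  sub : Sub X N
  her_sub : Sub K X
  extensional : ∀ u v, u ε X → v ε X → (∃ z, z ε u ∧ ¬ z ε v) → ∃ z, z ε X ∧ z ε u ∧ ¬ z ε v
  sub_of_cov : ∀ u, u ε X → Cov K u → Sub u X
  -- For atomic formulas: `w` lists the variables, and `t` is the tuple of their values under `s`.
  mem_of_isComp : ∀ s w t, w ε K → IsAssignment s X → IsComp t s w → t ε N → t ε X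
  fiber : ∀ u c y, u ε X → c ε K → opair c y ε u → ∃ y', opair c y' ε u ∧ opair c y' ε X
  -- The parameter of the Skolem relation is only `⟨n, d⟩`, so the new witness may come with another
  -- formula set and satisfaction relation; `IsSatisfaction.unique` reconciles them.
  skolem : ∀ F T d n s z, IsFormulaSet τ F → IsSatisfaction a r F T → d ε F → d ε K → n ε K →
    IsAssignment s X → z ε a → z ε N → opair d (upd s n z) ε T →
    ∃ z', z' ε X ∧ z' ε a ∧ ∃ F' T', IsFormulaSet τ F' ∧ IsSatisfaction a r F' T' ∧ d ε F' ∧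
      opair d (upd s n z') ε T'

theorem def3_boundedSkolem {β : Type} [Finite β] {n : ℕ} (φ : setLang.BoundedFormula β (n + 1))
    (y : β ⊕ Fin n) (enc : β ⊕ Fin n → ℕ) :
    Def3 (fun _ s z : M => z ε app s (num (enc y)) ∧
      ¬ φ.Realize (fun b => app s (num (enc (.inl b))))
        (Fin.snoc (α := fun _ => M) (fun i => app s (num (enc (.inr i)))) z)) := by
  let t : β ⊕ Fin (n + 1) → (Fin 3 → M) → M := fun q v =>
    Sum.elim (fun b => app (v 1) (num (enc (.inl b))))
      (Fin.snoc (α := fun _ => M) (fun i => app (v 1) (num (enc (.inr i)))) (v 2)) q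
  have ht : ∀ q, DF (t q) := by
    rintro (b | i)
    · simp only [t, Sum.elim_inl]
      infer_instance
    · refine Fin.lastCases ?_ (fun i => ?_) i
      · simp only [t, Sum.elim_inr, Fin.snoc_last]
        infer_instance
      · simp only [t, Sum.elim_inr, Fin.snoc_castSucc]
        infer_instance
  have h : Dfn (fun v : Fin 3 → M => φ.Realize (fun b => app (v 1) (num (enc (.inl b))))
      (Fin.snoc (α := fun _ => M) (fun i => app (v 1) (num (enc (.inr i)))) (v 2))) :=
    (Dfn.realize (φ := φ.toFormula) (t := t)).congr fun v => BoundedFormula.realize_toFormula _ _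
  exact ⟨inferInstance⟩

-- Each closure condition asks that a definable relation `R c s z` solvable in `N` be solvable in
-- `X`, for `c` in `her Z` and `s` a sequence in `X`. There are finitely many, so `exists_hull`
-- applies.
set_option synthInstance.maxSize 2000 in
set_option synthInstance.maxHeartbeats 200000 in
theorem exists_isSmallHull {Z : M} (hZ : Ample Z) (τ a r : M) {m : ℕ} (f : Fin m → M)
    {β : Type} [Finite β] (L : List (Σ n, setLang.BoundedFormula β (n + 1) × (β ⊕ Fin n))) :
    ∃ N X, IsSmallHull (her Z) τ a r N X ∧ Cov (her Z) X ∧ (∀ i, f i ε X) ∧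
      ∀ e ∈ L, BoundedSkolem {z | z ε X} e.2.1 e.2.2 := by
  obtain ⟨S, hS⟩ := exists_forall_mem (Fin.cons (her Z) f : Fin (m + 1) → M)
  obtain ⟨N, hN, hSN⟩ := inTr S
  have hKN : her Z ε N := hN S hSN _ (hS 0)
  have hfN : ∀ i, f i ε N := fun i => hN S hSN _ (hS i.succ)
  obtain ⟨e, -, he⟩ := exists_choice N fun u g => ∀ y, y ε u → ∃ z, z ε her Z ∧ app g z = y
  let enc : ∀ n, β ⊕ Fin n → Fin (Nat.card (β ⊕ Fin n)) := fun n => Finite.equivFin _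
  -- The entries yield, in order, the fields from `her_sub` to `skolem`. In the second, `e` assigns
  -- to each covered `u` in `N` a covering by `her Z`.
  let Rs₁ : List (M → M → M → Prop) := [fun c _ z => z = c,
    fun c s z => z = app (app e (app s (num 0))) c,
    fun _ s z => z ε app s (num 0) ∧ ¬ z ε app s (num 1),
    fun c s z => IsComp z s c,
    fun c s z => z ε app s (num 0) ∧ ∃ y, z = opair c y,
    fun c s z => z ε a ∧ ∃ F T, IsFormulaSet τ F ∧ IsSatisfaction a r F T ∧ snd c ε F ∧
      opair (snd c) (upd s (fst c) z) ε T]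
  let Rs₂ : List (M → M → M → Prop) := List.ofFn fun i _ _ z => z = f i
  let Rs₃ : List (M → M → M → Prop) := L.map fun e _ s z =>
    z ε app s (num (enc e.1 e.2.2)) ∧ ¬ e.2.1.Realize (fun b => app s (num (enc e.1 (.inl b))))
        (Fin.snoc (α := fun _ => M) (fun i => app s (num (enc e.1 (.inr i)))) z)
  obtain ⟨X, heX, hXN, hX, h⟩ := exists_hull hKN hZ (Rs₁ ++ Rs₂ ++ Rs₃) (by
    intro R hR
    rw [List.mem_append, List.mem_append] at hR
    rcases hR with (hR | hR) | hR
    · simp only [Rs₁, List.mem_cons, List.not_mem_nil, or_false] at hR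
      rcases hR with rfl | rfl | rfl | rfl | rfl | rfl <;> infer_instance
    · obtain ⟨i, rfl⟩ := List.mem_ofFn.1 hR
      infer_instance
    · obtain ⟨e, -, rfl⟩ := List.mem_map.1 hR
      exact def3_boundedSkolem e.2.1 e.2.2 fun q => enc e.1 q)
  have h' : ∀ R ∈ Rs₁, ∀ c s, c ε her Z → IsAssignment s X →
      (∃ z, z ε N ∧ R c s z) → ∃ z, z ε X ∧ R c s z := fun R hR => h R (by simp [hR])
  simp only [Rs₁, List.forall_mem_cons, List.not_mem_nil, false_imp_iff, implies_true,
    and_true] at h'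
  obtain ⟨h1, h2, h3, h4, h5, h6⟩ := h'
  have h0 : (emp : M) ε her Z := hZ.her.nat _ isNat_emp
  have hseq : ∀ {m : ℕ} (f : Fin m → M), (∀ i, f i ε X) →
      ∃ s, IsAssignment s X ∧ ∀ i : Fin m, app s (num i) = f i :=
    fun f hf => exists_isAssignment heX f hf
  obtain ⟨s₀, hs₀, -⟩ := hseq (Fin.elim0 : Fin 0 → M) fun i => i.elim0
  have hseq₁ : ∀ u, u ε X → ∃ s, IsAssignment s X ∧ app s (num 0) = u := by
    intro u hu
    obtain ⟨s, hs, hs'⟩ := hseq ![u] (by simpa using hu)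
    exact ⟨s, hs, hs' 0⟩
  refine ⟨N, X, ⟨hN, hXN, ?_, ?_, ?_, ?_, ?_, ?_⟩, hX, ?_, ?_⟩
  · intro c hc
    obtain ⟨z, hz, rfl⟩ := h1 c s₀ hc hs₀ ⟨c, hN _ hKN c hc, rfl⟩
    exact hz
  · rintro u v hu hv ⟨z, hz, hzv⟩
    obtain ⟨s, hs, hs'⟩ := hseq ![u, v] (by simp [Fin.forall_fin_two, hu, hv])
    have e0 : app s (num 0) = u := hs' 0
    have e1 : app s (num 1) = v := hs' 1
    have := h3 emp s h0 hs ⟨z, hN u (hXN u hu) z hz, by rwa [e0], by rwa [e1]⟩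
    rwa [e0, e1] at this
  · intro u hu hcov y hy
    obtain ⟨s, hs, e0⟩ := hseq₁ u hu
    obtain ⟨c, hc, hcy⟩ := he u (hXN u hu) hcov y hy
    obtain ⟨z, hz, hzy⟩ := h2 c s hc hs ⟨y, hN u (hXN u hu) y hy, by rw [e0, hcy]⟩
    rw [e0, hcy] at hzy
    rwa [← hzy]
  · intro s w t hw hs ht htN
    obtain ⟨z, hz, hzt⟩ := h4 w s hw hs ⟨t, htN, ht⟩
    rwa [ext fun e => (ht e).trans (hzt e).symm]
  · intro u c y hu hc hy
    obtain ⟨s, hs, e0⟩ := hseq₁ u hu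
    obtain ⟨z, hz, hzu, y', rfl⟩ := h5 c s hc hs
      ⟨opair c y, hN u (hXN u hu) _ hy, by rwa [e0], y, rfl⟩
    rw [e0] at hzu
    exact ⟨y', hzu, hz⟩
  · intro F T d n s z hF hT hd hdK hnK hs hza hzN hz
    obtain ⟨z', hz', hza', F', T', hF', hT', hd', h7⟩ := h6 (opair n d) s
      (hZ.her.opair _ _ hnK hdK) hs ⟨z, hzN, hza, F, T, hF, hT, by simpa using hd, by simpa using hz⟩
    rw [snd_opair] at hd'
    rw [fst_opair, snd_opair] at h7
    exact ⟨z', hz', hza', F', T', hF', hT', hd', h7⟩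
  · intro i
    obtain ⟨z, hz, rfl⟩ := h (fun _ _ z => z = f i) (by simp [Rs₂, List.mem_ofFn]) emp s₀ h0 hs₀
      ⟨_, hfN i, rfl⟩
    exact hz
  · intro e he v xs hv hxs ⟨z, hz, hφ⟩
    have hvx : ∀ q, Sum.elim v xs q ε X := by
      rintro (b | i)
      exacts [hv b, hxs i]
    obtain ⟨s, hs, hs'⟩ := hseq
      (fun i => Sum.elim v xs ((Finite.equivFin (β ⊕ Fin e.1)).symm i)) fun i => hvx _
    have henc : ∀ q, app s (num (enc e.1 q)) = Sum.elim v xs q := by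
      intro q
      rw [hs' (enc e.1 q)]
      simp [enc]
    have := h _ (List.mem_append_right _ (List.mem_map.2 ⟨e, he, rfl⟩)) emp s h0 hs
    simp only [henc, Sum.elim_inl, Sum.elim_inr] at this
    exact this ⟨z, hN _ (hXN _ (hvx _)) z hz, hz, hφ⟩

end Internal

end

section

open FirstOrder Language

/-! ### Structural reflection in models of `ZFC` -/

set_option linter.unusedSectionVars false

namespace Internal

local infix:50 " ε " => Mem

variable {M : Type v} [setLang.Structure M] [hM : ModelZFC M]

namespace IsSmallHull

variable {Z τ a r N X : M}

theorem isCollapseOn {K : M} (h : IsSmallHull K τ a r N X) :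
    IsCollapseOn (col X) {z | z ε X} := by
  refine ⟨fun u _ z => by simp [mem_col], fun u hu v hv huv => ?_⟩
  refine mem_induction (P := fun u => u ε X → ∀ v, v ε X → col X u = col X v → u = v)
    (fun u ih hu v hv huv => ?_) u hu v hv huv
  have h1 : ¬ ∃ z, z ε u ∧ ¬ z ε v := fun hz => by
    obtain ⟨z, hzX, hzu, hzv⟩ := h.extensional u v hu hv hz
    have := col_mem hzX hzu
    rw [huv] at this
    obtain ⟨w, hw, hwv, e⟩ := mem_col.1 this
    exact hzv (ih z hzu hzX w hw e ▸ hwv)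
  have h2 : ¬ ∃ z, z ε v ∧ ¬ z ε u := fun hz => by
    obtain ⟨z, hzX, hzv, hzu⟩ := h.extensional v u hv hu hz
    have := col_mem hzX hzv
    rw [← huv] at this
    obtain ⟨w, hw, hwu, e⟩ := mem_col.1 this
    exact hzu (ih w hwu hw z hzX e.symm ▸ hwu)
  push Not at h1 h2
  exact ext fun z => ⟨h1 z, h2 z⟩

theorem opair_mem (h : IsSmallHull (her Z) τ a r N X) (hZ : Ample Z) {x y : M}
    (hxy : opair x y ε X) : x ε X ∧ y ε X ∧ col X (opair x y) = opair (col X x) (col X y) := by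
  have h1 := h.sub_of_cov _ hxy (hZ.her.cov_upair _ _)
  have hxx : upair x x ε X := h1 _ (mem_upair.2 (.inl rfl))
  have hxy' : upair x y ε X := h1 _ (mem_upair.2 (.inr rfl))
  have hx : x ε X := h.sub_of_cov _ hxy' (hZ.her.cov_upair _ _) x (by simp)
  have hy : y ε X := h.sub_of_cov _ hxy' (hZ.her.cov_upair _ _) y (by simp)
  refine ⟨hx, hy, ?_⟩
  rw [opair, col_upair hxx hxy', col_upair hx hx, col_upair hx hy, opair]

/-- The graph of a function on a natural number is covered by `her Z`, so it is a subset of `X`, and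
the collapse fixes the arguments. -/
theorem col_isFunOn (h : IsSmallHull (her Z) τ a r N X) (hZ : Ample Z) {t n : M} (ht : t ε X)
    (hn : IsNat n) (htn : IsFunOn t n) :
    (∀ k, k ε n → app t k ε X) ∧ col X t = lam n fun k => col X (app t k) := by
  have hnK : Sub n (her Z) := fun k hk => hZ.her.nat k (hn.mem hk)
  have htX : Sub t X := h.sub_of_cov t ht (.of_isFunOn htn (.of_sub hnK))
  have key : ∀ k, k ε n → opair k (app t k) ε X := fun k hk => htX _ (htn.opair_mem hk)
  refine ⟨fun k hk => (h.opair_mem hZ (key k hk)).2.1, ext fun z => ?_⟩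
  have hcol : ∀ k, k ε n → col X (opair k (app t k)) = opair k (col X (app t k)) := by
    intro k hk
    rw [(h.opair_mem hZ (key k hk)).2.2, col_eq_self (isTrans_her Z) h.her_sub (hnK k hk)]
  rw [mem_col, mem_lam]
  constructor
  · rintro ⟨w, -, hw, rfl⟩
    obtain ⟨k, hk, rfl⟩ := htn.mem_iff.1 hw
    exact ⟨k, hk, hcol k hk⟩
  · rintro ⟨k, hk, rfl⟩
    exact ⟨_, key k hk, htn.opair_mem hk, (hcol k hk).symm⟩

/-- The inverse of the collapse is an elementary embedding of the collapsed structure. -/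
theorem exists_isElementaryEmbedding (h : IsSmallHull (her Z) τ a r N X) (hZ : Ample Z)
    (hτ : IsType τ) (hτZ : τ ε her Z) (har : IsStructureOn τ a r) (hX : opair a r ε X) :
    ∃ j, IsElementaryEmbedding τ j (col X (opair a r)) (opair a r) := by
  obtain ⟨haX, hrX, harX⟩ := h.opair_mem hZ hX
  have hinj := h.isCollapseOn.injOn
  have hj : ∀ z, z ε X → z ε a → app (lam (col X a) fun y => the fun z => (z ε X ∧ z ε a) ∧
      col X z = y) (col X z) = z := by
    intro z hz hza
    rw [app_lam (col_mem hz hza)]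
    exact the_eq ⟨⟨hz, hza⟩, rfl⟩ fun w hw => hinj hw.1.1 hz hw.2
  have hjfun : IsFunOn (lam (col X a) fun y => the fun z => (z ε X ∧ z ε a) ∧ col X z = y)
      (col X a) := isFunOn_lam
  generalize lam (col X a) (fun y => the fun z => (z ε X ∧ z ε a) ∧ col X z = y) = j at hj hjfun
  have hj' : ∀ y, y ε col X a → app j y ε X ∧ app j y ε a ∧ col X (app j y) = y := by
    intro y hy
    obtain ⟨z, hz, hza, rfl⟩ := mem_col.1 hy
    rw [hj z hz hza]
    exact ⟨hz, hza, rfl⟩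
  obtain ⟨-, ⟨d, hτd, hrd⟩, hrel⟩ := har
  have hdK : ∀ i n, opair i n ε τ → i ε her Z := fun i n hi =>
    (below_opair_left i n).mem_of_isTrans (isTrans_her Z) (isTrans_her Z τ hτZ _ hi)
  refine ⟨j, col X a, col X r, a, r, isOPair_iff.2 harX, isOPair_iff.2 rfl, hjfun,
    fun x y hxy => ?_, fun F T T' hF hT hT' c s s' hc hs hs' => ?_⟩
  · rw [app_iff, hjfun.opair_mem_iff] at hxy
    rw [hxy.2]
    exact (hj' x hxy.1).2.1
  have hs₁ := isAssignment_iff.1 hs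
  rw [isComp_iff hs₁.1 hjfun fun n hn => hs₁.2 n (mem_om.1 hn)] at hs'
  subst hs'
  rw [app_iff, app_iff]
  have hcomp : ∀ s, IsAssignment s (col X a) → IsAssignment (comp om j s) X := by
    intro s hs
    refine isAssignment_iff.2 ⟨isFunOn_comp, fun n hn => ?_⟩
    rw [app_comp (mem_om.2 hn)]
    exact (hj' _ ((isAssignment_iff.1 hs).2 n hn)).1
  refine IsSatisfaction.opair_mem_iff hF hF hT hT' (fun x hx => (hj' x hx).2.1) ?_ ?_ ?_ hc hc hs
  · intro x y hx hy hxy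
    rw [← (hj' x hx).2.2, hxy, (hj' y hy).2.2]
  · intro i n w s hi hw hw' hs
    have hn : IsNat n := hτ.2 i n (app_iff.2 hi)
    have hiK := hdK i n hi
    rw [isAssignment_iff] at hs
    constructor
    · rintro ⟨Q, hQ, hsQ⟩
      obtain ⟨e, heX, her, he⟩ := mem_col.1 hQ
      obtain ⟨i', hi', rfl⟩ := hrd.mem_iff.1 her
      obtain ⟨h1, h2, h3⟩ := h.opair_mem hZ heX
      rw [h3, col_eq_self (isTrans_her Z) h.her_sub (hdK i' _ (hτd.opair_mem hi')),
        opair_inj] at he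
      obtain ⟨rfl, rfl⟩ := he
      obtain ⟨t, htX, ht, hst⟩ := mem_col.1 hsQ
      obtain ⟨htn, hta⟩ := hrel i n _ t (app_iff.2 hi) (app_iff.2 her) ht
      obtain ⟨h4, h5⟩ := h.col_isFunOn hZ htX hn htn
      refine ⟨_, her, ?_⟩
      rwa [isFunOn_comp.ext htn fun k hk => ?_]
      have h6 : app s (app w k) = col X (app t k) := by
        rw [← app_comp hk, hst, h5, app_lam hk]
      rw [app_comp hk, app_comp (mem_om.2 (hw' k hk)), h6,
        hj _ (h4 k hk) (hta k _ (app_iff.2 (htn.opair_mem hk)))]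
    · rintro ⟨Q, hQ, hsQ⟩
      -- Some pair of `r` with first component `i` lies in `X`; as `r` is a function, it is `⟨i,
      -- Q⟩`.
      obtain ⟨Q', hQ', hQX⟩ := h.fiber r i Q hrX hiK hQ
      obtain rfl : Q' = Q := by
        rw [(hrd.opair_mem_iff.1 hQ).2, (hrd.opair_mem_iff.1 hQ').2]
      obtain ⟨-, h2, h3⟩ := h.opair_mem hZ hQX
      rw [col_eq_self (isTrans_her Z) h.her_sub hiK] at h3
      have hwK : w ε her Z := hZ.isFunOn_mem_her hw (.of_sub fun k hk => hZ.nat k (hn.mem hk))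
        (fun k hk => hZ.her.nat k (hn.mem hk)) fun k hk => hZ.her.nat _ (hw' k hk)
      have htX : comp n (comp om j s) w ε X := h.mem_of_isComp (comp om j s) w _ hwK
        (hcomp s (isAssignment_iff.2 hs))
        ((isComp_iff hw isFunOn_comp fun k hk => mem_om.2 (hw' k hk)).2 rfl)
        (h.isTrans _ (h.sub _ h2) _ hsQ)
      refine ⟨col X Q', h3 ▸ col_mem hQX hQ, ?_⟩
      rw [isFunOn_comp.ext (g := col X (comp n (comp om j s) w)) ?_ fun k hk => ?_]
      · exact col_mem htX hsQ
      · rw [(h.col_isFunOn hZ htX hn isFunOn_comp).2]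
        exact isFunOn_lam
      · rw [(h.col_isFunOn hZ htX hn isFunOn_comp).2, app_lam hk, app_comp hk, app_comp hk,
          app_comp (mem_om.2 (hw' k hk)), (hj' _ (hs.2 _ (hw' k hk))).2.2]
  · intro n d s z hn hd _ hs hz hsz
    obtain ⟨z', hzX, hza, F', T'', hF', hT'', hd', h1⟩ := h.skolem F T' d n (comp om j s) z hF hT' hd
      (hF.mem_her hZ hτ hτZ hd) (hZ.her.nat n hn) (hcomp s hs) hz
      (h.isTrans _ (h.sub _ haX) _ hz) hsz
    refine ⟨col X z', col_mem hzX hza, ?_⟩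
    rw [hj z' hzX hza]
    refine (IsSatisfaction.unique hF' hF hT'' hT' hd' hd (.upd ?_ hza)).1 h1
    refine isAssignment_iff.2 ⟨isFunOn_comp, fun m hm => ?_⟩
    rw [app_comp (mem_om.2 hm)]
    exact (hj' _ ((isAssignment_iff.1 hs).2 m hm)).2.1

end IsSmallHull

/-- `Z` includes a transitive set around the type and the parameters, so these lie in `her Z` and
are fixed by every collapse used. -/
theorem sigmaOneSR (M : Type v) [setLang.Structure M] [ModelZFC M] : SigmaOneSR M := by
  intro k φ hφ p τ hτ hC
  obtain ⟨m, ψ, hψ, hφψ⟩ := hφ.exists_normalForm.{v}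
  have hφψ' : ∀ x, φ.Realize (Fin.cons x p : Fin (k + 1) → M) ↔ ∃ ys : Fin m → M,
      ψ.Realize (Sum.elim (Sum.elim (Fin.cons x p : Fin (k + 1) → M) default) ys) :=
    fun x => (realize_congr_of_eq fun _ => rfl).trans (hφψ M (Fin.cons x p) default)
  obtain ⟨L, hL⟩ := hψ.exists_skolem.{v}
  obtain ⟨S, hS⟩ := exists_forall_mem (Fin.cons τ p : Fin (k + 1) → M)
  obtain ⟨t, ht, hSt⟩ := inTr S
  obtain ⟨Z, hZ, htZ⟩ := exists_ample t
  have hmem : ∀ i, (Fin.cons τ p : Fin (k + 1) → M) i ε her Z := fun i =>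
    mem_her.2 ⟨t, ht, .of_sub htZ, ht S hSt _ (hS i)⟩
  have hτZ : τ ε her Z := hmem 0
  have hpZ : ∀ i, p i ε her Z := fun i => hmem i.succ
  -- The ordinal depends only on `Z`, chosen before `x`: every hull is covered by `her Z`, hence
  -- every collapsed structure lies in `her (her Z)`.
  refine ⟨rank (her (her Z)), isOrd_rank _, fun x hx => ?_⟩
  obtain ⟨a, r, hxar, har⟩ := hC x hx
  rw [isOPair_iff] at hxar
  subst hxar
  obtain ⟨ys, hys⟩ := (hφψ' _).1 hx
  obtain ⟨N, X, hull, hcov, hfX, hLX⟩ := exists_isSmallHull hZ τ a r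
    (Fin.cons (opair a r) ys : Fin (m + 1) → M) L
  have hxX : opair a r ε X := hfX 0
  have hysX : ∀ i, ys i ε X := fun i => hfX i.succ
  obtain ⟨j, hj⟩ := hull.exists_isElementaryEmbedding hZ hτ hτZ har hxX
  refine ⟨_, _, j, (hφψ' _).2 ⟨fun i => col X (ys i), ?_⟩, (isOrd_rank _).isV_cumul,
    sub_cumul_rank _ _ (col_mem_her hcov hxX), hj⟩
  have := (hL M {z | z ε X} (col X) hull.isCollapseOn hLX
    (Sum.elim (Sum.elim (Fin.cons (opair a r) p : Fin (k + 1) → M) default) ys) default (fun q => by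
      rcases q with (i | i) | i
      · refine Fin.cases ?_ (fun i => ?_) i
        · exact hxX
        · exact hull.her_sub _ (hpZ i)
      · exact i.elim0
      · exact hysX i) (fun i => i.elim0)).1
      ((realize_congr_of_eq fun _ => rfl).1 hys)
  refine (realize_congr_of_eq fun q => ?_).1 this
  rcases q with (i | i) | i
  · refine Fin.cases ?_ (fun i => ?_) i
    · rfl
    · exact col_eq_self (isTrans_her Z) hull.her_sub (hpZ i)
  · exact i.elim0
  · rfl

end Internal

theorem sigmaOneSRProvableInZFC : SigmaOneSRProvableInZFC.{v} :=
  fun M _ hM => haveI : Internal.ModelZFC M := ⟨hM⟩; Internal.sigmaOneSR M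

end

theorem proposition3p1 :
    (∀ α : Ordinal.{u},
      List.TFAE
        [WitnessesSR (fun _ φ => IsSigmaZero φ) α,
         WitnessesSR (fun _ φ => IsSigmaOne φ) α,
         α ∈ classCOne]) ∧
    SigmaOneSRProvableInZFC.{v} := by
  exact ⟨witnessesSR_tfae, sigmaOneSRProvableInZFC⟩
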